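/- Let $K$ be a field of characteristic zero. **Operads.** Let $(\mathcal O,\mu,e,\tau)$ be a cyclic operad with multiplication over $K$: a unital non-$\Sigma$ operad $\{\mathcal O(n)\}_{n\ge 0}$ of $K$-vector spaces with partial compositions $\circ_i:\mathcal O(p)\otimes\mathcal O(q)\to\mathcal O(p+q-1)$, $1\le i\le p$, elements $\mu\in\mathcal O(2)$, $e\in\mathcal O(0)$ with $\mu\circ_1\mu=\mu\circ_2\mu$, $\mu\circ_1e=\mu\circ_2e=\mathbb 1$, and linear maps $\tau:\mathcal O(p)\to\mathcal O(p)$ with $\tau^{p+1}=\mathrm{id}$, $\tau\mu=\mu$, $\tau(\varphi\circ_i\psi)=\tau\varphi\circ_{i-1}\psi$ for $2\le i\le p$, and $\tau(\varphi\circ_1\psi)=\tau\psi\circ_q\tau\varphi$ for $p,q\ge1$. Let $(\mathcal M,\tau)$ be a cyclic module over it: a sequence $\{\mathcal M(q)\}_{q\ge 0}$ of $K$-vector spaces with left compositions $\varphi\circ_i m$ and right compositions $m\circ_i\varphi$ satisfying the associativity and unit axioms of an operad whenever exactly one of the elements involved is taken from $\mathcal M$, and linear maps $\tau:\mathcal M(q)\to\mathcal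 M(q)$ with $\tau^{q+1}=\mathrm{id}$ satisfying the two displayed compatibilities of $\tau$ with $\circ_i$ for left and for right compositions. The normalised parts $\overline{\mathcal O}(p)$, $\overline{\mathcal M}(q)$ are the common kernels of the maps $x\mapsto x\circ_i e$, $1\le i\le p$ (resp. $q$). Put $\delta\varphi=\mu\circ_1\varphi+\sum_{i=1}^p(-1)^i\varphi\circ_{p-i+1}\mu+(-1)^{p+1}\mu\circ_2\varphi$ for $\varphi \in \mathcal O(p)$, and let $\{\varphi,\psi\}=\varphi\{\psi\}-(-1)^{(p-1)(q-1)}\psi\{\varphi\}$ with $\varphi\{\psi\}=\sum_{i=1}^p(-1)^{(q-1)(i-1)}\varphi\circ_i\psi$ be the Gerstenhaber bracket. **Calculi.** Let $(\mathfrak g,d,[\cdot,\cdot]_{\mathfrak g})$ be a $\mathbb Z$-graded dg Lie algebra and $(M,b,B)$ a mixed cochain complex ($\deg b=1$, $\deg B=-1$, $b^2=B^2=bB+Bb=0$). A *homotopy Cartan–Gerstenhaber calculus* of $\mathfrak g$ on $M$ consists of linear maps $\iota,L,S:\mathfrak g\to\mathrm{End}(M)$ of degrees $1,0,-1$, a bilinear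 map $T:\mathfrak g\times\mathfrak g\to\mathrm{End}(M)$ of degree $0$, and a product $\smallsmile$ making $\mathfrak g[-1]$, with the differential induced by $d$, a unital dg associative algebra, such that, with $[\cdot,\cdot]$ the graded commutator, for homogeneous $f,g$: $$L_f=[B,\iota_f]+[b,S_f]+S_{df},\quad [b,\iota_f]+\iota_{df}=0,\quad [B,S_f]=0,$$ $$[\iota_f,L_g]-\iota_{[f,g]_{\mathfrak g}}=[b,T(f,g)]-T(df,g)-(-1)^{f}T(f,dg),\quad [S_f,L_g]-S_{[f,g]_{\mathfrak g}}=[B,T(f,g)],$$ $$\iota_{f\smallsmile g}=\iota_f\iota_g,\qquad \iota_1=\mathrm{id}.$$ **Operators.** For $m\in\mathcal M(q)$, $\varphi\in\mathcal O(p)$, $\psi\in\mathcal O(r)$ put $$b(m)=\mu\circ_2m+\sum_{i=1}^q(-1)^im\circ_i\mu+(-1)^{q+1}\mu\circ_1m,\qquad B(m)=\sum_{i=0}^{q-1}(-1)^{(q-1)i}\tau^i(\tau m\circ_qe),$$ $$\iota_\varphi m=(\mu\circ_2m)\circ_1\varphi,$$ $$\mathcal L_\varphi m=\sum_{i=1}^q(-1)^{(p-1)(i-1)}m\circ_i\varphi+\sum_{i=1}^p(-1)^{(p-1)i+q(i-1)}\tau^i\varphi\circ_{p-i+1}m,$$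 $$\mathcal S_\varphi m=\sum_{i=1}^{q-1}\sum_{j=1}^i(-1)^{p(i-j)+q(j-1)+i-1}(\tau^jm\circ_{q-j+1}e)\circ_{i-j+1}\varphi,$$ $$\mathcal T(\varphi,\psi)(m)=\sum_{j=1}^{p-1}\sum_{i=j}^{p-1}(-1)^{q(j-1)+r(i-1)+(p-1)j+i}(\tau^j\varphi\circ_{p-j+1}m)\circ_{p-i}\psi.$$ **Theorem.** These operators restrict to the normalised spaces, and, up to signs and the order of arguments, they form there a homotopy Cartan–Gerstenhaber calculus. Precisely: let $\mathfrak g^k=\overline{\mathcal O}(k+1)$ and $M^k=\overline{\mathcal M}(k)$ (zero where the index is negative). For $\varphi\in\overline{\mathcal O}(p)$ and $\psi\in\overline{\mathcal O}(r)$ put $$d\varphi=(-1)^p\delta\varphi,\quad[\varphi,\psi]_{\mathfrak g}=\{\psi,\varphi\},\quad\varphi\smallsmile\psi=(\mu\circ_2\psi)\circ_1\varphi,$$ $$L_\varphi=(-1)^{p-1}\mathcal L_\varphi,\quad S_\varphi=\mathcal S_\varphi,\quad T(\varphi,\psi)=(-1)^{p(r-1)}\mathcal T(\psi,\varphi).$$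 Then $\mathfrak g$ with $d$ and $[\cdot,\cdot]_{\mathfrak g}$ is a dg Lie algebra, $\mathfrak g[-1]$ is a dg algebra under $\smallsmile$ with unit $e$, $(M,b,B)$ is a mixed cochain complex, and $(\iota,L,S,T,\smallsmile)$ is a homotopy Cartan–Gerstenhaber calculus of $\mathfrak g$ on $M$. -/

import Mathlib

open scoped DirectSum

universe u v w

/-! ### Graded objects and homotopy Cartan–Gerstenhaber calculi -/

/-- Graded commutator `X Y - (-1)^(a c) Y X` of endomorphisms `X` of degree `a`, `Y` of degree `c`. -/
def gradedComm {K : Type u} [Field K] {V : Type v} [AddCommGroup V] [Module K V]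
    (a c : ℤ) (X Y : Module.End K V) : Module.End K V :=
  X * Y - (a * c).negOnePow • (Y * X)

/-- A (cohomologically graded) dg Lie algebra structure on the graded vector space `g = ⨁ 𝓰 k`. -/
structure DGLieStructure {K : Type u} [Field K] {g : Type v} [AddCommGroup g] [Module K g]
    (𝓰 : ℤ → Submodule K g) where
  g_isInternal : DirectSum.IsInternal 𝓰
  d : g →ₗ[K] g
  bracket : g →ₗ[K] g →ₗ[K] g
  d_mem : ∀ {h : ℤ} {f : g}, f ∈ 𝓰 h → d f ∈ 𝓰 (h + 1)
  bracket_mem : ∀ {h j : ℤ} {f f' : g}, f ∈ 𝓰 h → f' ∈ 𝓰 j → bracket f f' ∈ 𝓰 (h + j)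
  d_d : ∀ f : g, d (d f) = 0
  bracket_antisymm : ∀ {h j : ℤ} {f f' : g}, f ∈ 𝓰 h → f' ∈ 𝓰 j →
    bracket f f' = -((h * j).negOnePow • bracket f' f)
  jacobi : ∀ {h j k : ℤ} {f f' f'' : g}, f ∈ 𝓰 h → f' ∈ 𝓰 j → f'' ∈ 𝓰 k →
    bracket f (bracket f' f'') =
      bracket (bracket f f') f'' + (h * j).negOnePow • bracket f' (bracket f f'')
  d_bracket : ∀ {h j : ℤ} {f f' : g}, f ∈ 𝓰 h → f' ∈ 𝓰 j →
    d (bracket f f') = bracket (d f) f' + h.negOnePow • bracket f (d f')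

/-- A mixed cochain complex structure `(M, b, B)` on the graded vector space `M = ⨁ 𝓜 k`. -/
structure MixedComplexStructure {K : Type u} [Field K] {M : Type v} [AddCommGroup M] [Module K M]
    (𝓜 : ℤ → Submodule K M) where
  M_isInternal : DirectSum.IsInternal 𝓜
  b : Module.End K M
  B : Module.End K M
  b_mem : ∀ {k : ℤ} {m : M}, m ∈ 𝓜 k → b m ∈ 𝓜 (k + 1)
  B_mem : ∀ {k : ℤ} {m : M}, m ∈ 𝓜 k → B m ∈ 𝓜 (k - 1)
  b_b : b * b = 0
  B_B : B * B = 0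
  B_b : gradedComm (-1) 1 B b = 0

/-- A homotopy pre-Cartan calculus of the dg Lie algebra `g` on the mixed complex `M`. -/
structure HomotopyPreCartanCalculus {K : Type u} [Field K]
    {g : Type v} [AddCommGroup g] [Module K g] (𝓰 : ℤ → Submodule K g)
    {M : Type w} [AddCommGroup M] [Module K M] (𝓜 : ℤ → Submodule K M)
    extends DGLieStructure 𝓰, MixedComplexStructure 𝓜 where
  ι : g →ₗ[K] Module.End K M
  L : g →ₗ[K] Module.End K M
  S : g →ₗ[K] Module.End K M
  ι_mem : ∀ {h k : ℤ} {f : g} {m : M}, f ∈ 𝓰 h → m ∈ 𝓜 k → ι f m ∈ 𝓜 (h + k + 1)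
  L_mem : ∀ {h k : ℤ} {f : g} {m : M}, f ∈ 𝓰 h → m ∈ 𝓜 k → L f m ∈ 𝓜 (h + k)
  S_mem : ∀ {h k : ℤ} {f : g} {m : M}, f ∈ 𝓰 h → m ∈ 𝓜 k → S f m ∈ 𝓜 (h + k - 1)
  cartan : ∀ {h : ℤ} {f : g}, f ∈ 𝓰 h →
    L f = gradedComm (-1) (h + 1) B (ι f) + gradedComm 1 (h - 1) b (S f) + S (d f)
  b_ι : ∀ {h : ℤ} {f : g}, f ∈ 𝓰 h → gradedComm 1 (h + 1) b (ι f) + ι (d f) = 0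
  B_S : ∀ {h : ℤ} {f : g}, f ∈ 𝓰 h → gradedComm (-1) (h - 1) B (S f) = 0

/-- A homotopy Cartan calculus: a pre-Cartan calculus with a Gelfand–Daletskii–Tsygan homotopy.
The two equations are the coefficients of `u^0` and `u^1` in
`[I_f, L_g] - I_{f,g} = [b + u B, T(f,g)] - T(d f, g) - (-1)^f T(f, d g)`, where `I = ι + u S`. -/
structure HomotopyCartanCalculus {K : Type u} [Field K]
    {g : Type v} [AddCommGroup g] [Module K g] (𝓰 : ℤ → Submodule K g)
    {M : Type w} [AddCommGroup M] [Module K M] (𝓜 : ℤ → Submodule K M)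
    extends HomotopyPreCartanCalculus 𝓰 𝓜 where
  T : g →ₗ[K] g →ₗ[K] Module.End K M
  T_mem : ∀ {h j k : ℤ} {f f' : g} {m : M}, f ∈ 𝓰 h → f' ∈ 𝓰 j → m ∈ 𝓜 k →
    T f f' m ∈ 𝓜 (h + j + k)
  ι_L : ∀ {h j : ℤ} {f f' : g}, f ∈ 𝓰 h → f' ∈ 𝓰 j →
    gradedComm (h + 1) j (ι f) (L f') - ι (bracket f f') =
      gradedComm 1 (h + j) b (T f f') - T (d f) f' - h.negOnePow • T f (d f')
  S_L : ∀ {h j : ℤ} {f f' : g}, f ∈ 𝓰 h → f' ∈ 𝓰 j →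
    gradedComm (h - 1) j (S f) (L f') - S (bracket f f') = gradedComm (-1) (h + j) B (T f f')

/-- A homotopy Cartan–Gerstenhaber calculus: moreover the shifted complex `g[-1]` (where `𝓰 h` has
degree `h + 1`) is a unital dg algebra and `ι` is a morphism of unital dg algebras into `End M`
(compatibility with the differentials is the field `b_ι`). -/
structure HomotopyCartanGerstenhaberCalculus {K : Type u} [Field K]
    {g : Type v} [AddCommGroup g] [Module K g] (𝓰 : ℤ → Submodule K g)
    {M : Type w} [AddCommGroup M] [Module K M] (𝓜 : ℤ → Submodule K M)
    extends HomotopyCartanCalculus 𝓰 𝓜 where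
  cup : g →ₗ[K] g →ₗ[K] g
  unit : g
  cup_mem : ∀ {h j : ℤ} {f f' : g}, f ∈ 𝓰 h → f' ∈ 𝓰 j → cup f f' ∈ 𝓰 (h + j + 1)
  unit_mem : unit ∈ 𝓰 (-1)
  cup_assoc : ∀ f f' f'' : g, cup (cup f f') f'' = cup f (cup f' f'')
  unit_cup : ∀ f : g, cup unit f = f
  cup_unit : ∀ f : g, cup f unit = f
  d_cup : ∀ {h j : ℤ} {f f' : g}, f ∈ 𝓰 h → f' ∈ 𝓰 j →
    d (cup f f') = cup (d f) f' + (h + 1).negOnePow • cup f (d f')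
  ι_cup : ∀ f f' : g, ι (cup f f') = ι f * ι f'
  ι_unit : ι unit = 1

/-- The `ℤ`-grading of `⨁ n, A n` in which `A n` sits in degree `n - s`. -/
def shiftedGrading (K : Type u) [Field K] (A : ℕ → Type v) [∀ n, AddCommGroup (A n)]
    [∀ n, Module K (A n)] (s : ℤ) (k : ℤ) : Submodule K (⨁ n, A n) where
  carrier := {x | ∀ n : ℕ, (n : ℤ) ≠ k + s → x n = 0}
  zero_mem' := fun _ _ => rfl
  add_mem' := fun {x y} hx hy n hn => by
    rw [DirectSum.add_apply, hx n hn, hy n hn, add_zero]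
  smul_mem' := fun c x hx n hn => by
    rw [DirectSum.smul_apply, hx n hn, smul_zero]

/-! ### Cyclic operads with multiplication

The partial composition `φ ∘_i ψ ∈ O (p + q - 1)` is `comp i h φ ψ : O n` with `h : p + q = n + 1`;
for `p = q = 0` it is zero by convention and there is no such `n`. -/

/-- A unital non-`Σ` operad in vector spaces. -/
structure Operad (K : Type u) [Field K] (O : ℕ → Type v) [∀ n, AddCommGroup (O n)]
    [∀ n, Module K (O n)] where
  comp : ∀ (_i : ℕ) {p q n : ℕ}, p + q = n + 1 → (O p →ₗ[K] O q →ₗ[K] O n)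
  comp_eq_zero : ∀ {i p q n : ℕ} (h : p + q = n + 1) (φ : O p) (ψ : O q),
    ¬(1 ≤ i ∧ i ≤ p) → comp i h φ ψ = 0
  comp_comp_of_lt : ∀ {i j p q r a c n : ℕ} (hpq : p + q = a + 1) (har : a + r = n + 1)
    (hpr : p + r = c + 1) (hcq : c + q = n + 1) (φ : O p) (ψ : O q) (χ : O r),
    1 ≤ j → j < i → i ≤ p →
    comp j har (comp i hpq φ ψ) χ = comp (i + r - 1) hcq (comp j hpr φ χ) ψ
  comp_comp_of_mid : ∀ {i j p q r a c n : ℕ} (hpq : p + q = a + 1) (har : a + r = n + 1)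
    (hqr : q + r = c + 1) (hpc : p + c = n + 1) (φ : O p) (ψ : O q) (χ : O r),
    1 ≤ i → i ≤ p → i ≤ j → j < q + i →
    comp j har (comp i hpq φ ψ) χ = comp i hpc φ (comp (j - i + 1) hqr ψ χ)
  comp_comp_of_ge : ∀ {i j p q r a c n : ℕ} (hpq : p + q = a + 1) (har : a + r = n + 1)
    (hpr : p + r = c + 1) (hcq : c + q = n + 1) (φ : O p) (ψ : O q) (χ : O r),
    1 ≤ i → i ≤ p → q + i ≤ j → j ≤ a →
    comp j har (comp i hpq φ ψ) χ = comp i hcq (comp (j - q + 1) hpr φ χ) ψ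
  one : O 1
  comp_one : ∀ {p : ℕ} (i : ℕ) (φ : O p), 1 ≤ i → i ≤ p → comp i rfl φ one = φ
  one_comp : ∀ {p : ℕ} (φ : O p), comp 1 (Nat.add_comm 1 p) one φ = φ

/-- A cyclic operad with multiplication `(O, μ, e, τ)`. -/
structure CyclicOperadWithMul (K : Type u) [Field K] (O : ℕ → Type v) [∀ n, AddCommGroup (O n)]
    [∀ n, Module K (O n)] extends Operad K O where
  μ : O 2
  e : O 0
  μ_assoc : comp 1 (q := 2) (n := 3) rfl μ μ = comp 2 (q := 2) (n := 3) rfl μ μ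
  μ_e_left : comp 1 (q := 0) (n := 1) rfl μ e = one
  μ_e_right : comp 2 (q := 0) (n := 1) rfl μ e = one
  τ : ∀ p : ℕ, Module.End K (O p)
  τ_comp : ∀ {i p q n : ℕ} (h : p + q = n + 1) (φ : O p) (ψ : O q), 2 ≤ i → i ≤ p →
    τ n (comp i h φ ψ) = comp (i - 1) h (τ p φ) ψ
  τ_comp_one : ∀ {p q n : ℕ} (h : p + q = n + 1) (φ : O p) (ψ : O q), 1 ≤ p → 1 ≤ q →
    τ n (comp 1 h φ ψ) = comp q ((Nat.add_comm q p).trans h) (τ q ψ) (τ p φ)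
  τ_pow : ∀ p : ℕ, τ p ^ (p + 1) = 1
  τ_μ : τ 2 μ = μ

namespace CyclicOperadWithMul

variable {K : Type u} [Field K] {O : ℕ → Type v} [∀ n, AddCommGroup (O n)] [∀ n, Module K (O n)]
  (P : CyclicOperadWithMul K O)

/-- The normalised part: the common kernel of the codegeneracies `φ ↦ φ ∘_i e`, `1 ≤ i ≤ p`. -/
def bar (p : ℕ) : Submodule K (O p) where
  carrier := {φ | ∀ (i n : ℕ) (h : p + 0 = n + 1), 1 ≤ i → i ≤ p → P.comp i h φ P.e = 0}
  zero_mem' := fun i n h _ _ => by simp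
  add_mem' := fun {φ ψ} hφ hψ i n h h1 h2 => by
    rw [map_add, LinearMap.add_apply, hφ i n h h1 h2, hψ i n h h1 h2, add_zero]
  smul_mem' := fun c φ hφ i n h h1 h2 => by
    rw [map_smul, LinearMap.smul_apply, hφ i n h h1 h2, smul_zero]

/-- The differential `δ` of the cochain complex of an operad with multiplication. -/
def delta {p : ℕ} (φ : O p) : O (p + 1) :=
  P.comp 1 (by omega) P.μ φ
    + ∑ i ∈ Finset.Icc 1 p, (i : ℤ).negOnePow • P.comp (p - i + 1) (by omega) φ P.μ
    + ((p : ℤ) + 1).negOnePow • P.comp 2 (by omega) P.μ φ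

/-- The brace `φ{ψ}`. -/
def brace {p q n : ℕ} (h : p + q = n + 1) (φ : O p) (ψ : O q) : O n :=
  ∑ i ∈ Finset.Icc 1 p, (((q : ℤ) - 1) * ((i : ℤ) - 1)).negOnePow • P.comp i h φ ψ

/-- The Gerstenhaber bracket `{φ, ψ} = φ{ψ} - (-1)^((p-1)(q-1)) ψ{φ}`. -/
def gerstenhaber {p q n : ℕ} (h : p + q = n + 1) (φ : O p) (ψ : O q) : O n :=
  P.brace h φ ψ
    - (((p : ℤ) - 1) * ((q : ℤ) - 1)).negOnePow • P.brace ((Nat.add_comm q p).trans h) ψ φ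

/-- The product `(μ ∘_2 ψ) ∘_1 φ`, that is, `μ(φ, ψ)`. -/
def cupProd {p q n : ℕ} (h : p + q = n) (φ : O p) (ψ : O q) : O n :=
  P.comp 1 (p := q + 1) (by omega) (P.comp 2 (by omega) P.μ ψ) φ

end CyclicOperadWithMul

/-! ### Cyclic modules and the explicit operators -/

/-- A cyclic (unital) module `(M, τ)` over a cyclic operad with multiplication. `compL i h φ m` is
the left composition `φ ∘_i m` and `compR i h m φ` the right composition `m ∘_i φ`. -/
structure CyclicModule {K : Type u} [Field K] {O : ℕ → Type v} [∀ n, AddCommGroup (O n)]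
    [∀ n, Module K (O n)] (P : CyclicOperadWithMul K O) (M : ℕ → Type w)
    [∀ n, AddCommGroup (M n)] [∀ n, Module K (M n)] where
  compL : ∀ (_i : ℕ) {p q n : ℕ}, p + q = n + 1 → (O p →ₗ[K] M q →ₗ[K] M n)
  compR : ∀ (_i : ℕ) {q p n : ℕ}, q + p = n + 1 → (M q →ₗ[K] O p →ₗ[K] M n)
  compL_eq_zero : ∀ {i p q n : ℕ} (h : p + q = n + 1) (φ : O p) (m : M q),
    ¬(1 ≤ i ∧ i ≤ p) → compL i h φ m = 0
  compR_eq_zero : ∀ {i q p n : ℕ} (h : q + p = n + 1) (m : M q) (φ : O p),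
    ¬(1 ≤ i ∧ i ≤ q) → compR i h m φ = 0
  -- associativity on `O p ⊗ O q ⊗ M r`
  assocOOM_of_lt : ∀ {i j p q r a c n : ℕ} (hpq : p + q = a + 1) (har : a + r = n + 1)
    (hpr : p + r = c + 1) (hcq : c + q = n + 1) (φ : O p) (ψ : O q) (m : M r),
    1 ≤ j → j < i → i ≤ p →
    compL j har (P.comp i hpq φ ψ) m = compR (i + r - 1) hcq (compL j hpr φ m) ψ
  assocOOM_of_mid : ∀ {i j p q r a c n : ℕ} (hpq : p + q = a + 1) (har : a + r = n + 1)
    (hqr : q + r = c + 1) (hpc : p + c = n + 1) (φ : O p) (ψ : O q) (m : M r),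
    1 ≤ i → i ≤ p → i ≤ j → j < q + i →
    compL j har (P.comp i hpq φ ψ) m = compL i hpc φ (compL (j - i + 1) hqr ψ m)
  assocOOM_of_ge : ∀ {i j p q r a c n : ℕ} (hpq : p + q = a + 1) (har : a + r = n + 1)
    (hpr : p + r = c + 1) (hcq : c + q = n + 1) (φ : O p) (ψ : O q) (m : M r),
    1 ≤ i → i ≤ p → q + i ≤ j → j ≤ a →
    compL j har (P.comp i hpq φ ψ) m = compR i hcq (compL (j - q + 1) hpr φ m) ψ
  -- associativity on `O p ⊗ M q ⊗ O r`
  assocOMO_of_lt : ∀ {i j p q r a c n : ℕ} (hpq : p + q = a + 1) (har : a + r = n + 1)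
    (hpr : p + r = c + 1) (hcq : c + q = n + 1) (φ : O p) (m : M q) (χ : O r),
    1 ≤ j → j < i → i ≤ p →
    compR j har (compL i hpq φ m) χ = compL (i + r - 1) hcq (P.comp j hpr φ χ) m
  assocOMO_of_mid : ∀ {i j p q r a c n : ℕ} (hpq : p + q = a + 1) (har : a + r = n + 1)
    (hqr : q + r = c + 1) (hpc : p + c = n + 1) (φ : O p) (m : M q) (χ : O r),
    1 ≤ i → i ≤ p → i ≤ j → j < q + i →
    compR j har (compL i hpq φ m) χ = compL i hpc φ (compR (j - i + 1) hqr m χ)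
  assocOMO_of_ge : ∀ {i j p q r a c n : ℕ} (hpq : p + q = a + 1) (har : a + r = n + 1)
    (hpr : p + r = c + 1) (hcq : c + q = n + 1) (φ : O p) (m : M q) (χ : O r),
    1 ≤ i → i ≤ p → q + i ≤ j → j ≤ a →
    compR j har (compL i hpq φ m) χ = compL i hcq (P.comp (j - q + 1) hpr φ χ) m
  -- associativity on `M p ⊗ O q ⊗ O r`
  assocMOO_of_lt : ∀ {i j p q r a c n : ℕ} (hpq : p + q = a + 1) (har : a + r = n + 1)
    (hpr : p + r = c + 1) (hcq : c + q = n + 1) (m : M p) (ψ : O q) (χ : O r),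
    1 ≤ j → j < i → i ≤ p →
    compR j har (compR i hpq m ψ) χ = compR (i + r - 1) hcq (compR j hpr m χ) ψ
  assocMOO_of_mid : ∀ {i j p q r a c n : ℕ} (hpq : p + q = a + 1) (har : a + r = n + 1)
    (hqr : q + r = c + 1) (hpc : p + c = n + 1) (m : M p) (ψ : O q) (χ : O r),
    1 ≤ i → i ≤ p → i ≤ j → j < q + i →
    compR j har (compR i hpq m ψ) χ = compR i hpc m (P.comp (j - i + 1) hqr ψ χ)
  assocMOO_of_ge : ∀ {i j p q r a c n : ℕ} (hpq : p + q = a + 1) (har : a + r = n + 1)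
    (hpr : p + r = c + 1) (hcq : c + q = n + 1) (m : M p) (ψ : O q) (χ : O r),
    1 ≤ i → i ≤ p → q + i ≤ j → j ≤ a →
    compR j har (compR i hpq m ψ) χ = compR i hcq (compR (j - q + 1) hpr m χ) ψ
  -- unitality
  compR_one : ∀ {q : ℕ} (i : ℕ) (m : M q), 1 ≤ i → i ≤ q → compR i rfl m P.one = m
  one_compL : ∀ {q : ℕ} (m : M q), compL 1 (Nat.add_comm 1 q) P.one m = m
  -- cyclic structure, compatible with the left and with the right compositions
  τ : ∀ q : ℕ, Module.End K (M q)
  τ_compL : ∀ {i p q n : ℕ} (h : p + q = n + 1) (φ : O p) (m : M q), 2 ≤ i → i ≤ p →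
    τ n (compL i h φ m) = compL (i - 1) h (P.τ p φ) m
  τ_compL_one : ∀ {p q n : ℕ} (h : p + q = n + 1) (φ : O p) (m : M q), 1 ≤ p → 1 ≤ q →
    τ n (compL 1 h φ m) = compR q ((Nat.add_comm q p).trans h) (τ q m) (P.τ p φ)
  τ_compR : ∀ {i q p n : ℕ} (h : q + p = n + 1) (m : M q) (φ : O p), 2 ≤ i → i ≤ q →
    τ n (compR i h m φ) = compR (i - 1) h (τ q m) φ
  τ_compR_one : ∀ {q p n : ℕ} (h : q + p = n + 1) (m : M q) (φ : O p), 1 ≤ q → 1 ≤ p →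
    τ n (compR 1 h m φ) = compL p ((Nat.add_comm p q).trans h) (P.τ p φ) (τ q m)
  τ_pow : ∀ q : ℕ, τ q ^ (q + 1) = 1

namespace CyclicModule

variable {K : Type u} [Field K] {O : ℕ → Type v} [∀ n, AddCommGroup (O n)] [∀ n, Module K (O n)]
  {P : CyclicOperadWithMul K O} {M : ℕ → Type w} [∀ n, AddCommGroup (M n)] [∀ n, Module K (M n)]
  (Q : CyclicModule P M)

/-- The normalised part: the common kernel of the codegeneracies `m ↦ m ∘_i e`, `1 ≤ i ≤ q`. -/
def bar (q : ℕ) : Submodule K (M q) where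
  carrier := {m | ∀ (i n : ℕ) (h : q + 0 = n + 1), 1 ≤ i → i ≤ q → Q.compR i h m P.e = 0}
  zero_mem' := fun i n h _ _ => by simp
  add_mem' := fun {φ ψ} hφ hψ i n h h1 h2 => by
    rw [map_add, LinearMap.add_apply, hφ i n h h1 h2, hψ i n h h1 h2, add_zero]
  smul_mem' := fun c φ hφ i n h h1 h2 => by
    rw [map_smul, LinearMap.smul_apply, hφ i n h h1 h2, smul_zero]

/-- `b m = μ ∘_2 m + ∑ (-1)^i m ∘_i μ + (-1)^(q+1) μ ∘_1 m`. -/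
def opb {q : ℕ} (m : M q) : M (q + 1) :=
  Q.compL 2 (by omega) P.μ m
    + ∑ i ∈ Finset.Icc 1 q, (i : ℤ).negOnePow • Q.compR i (by omega) m P.μ
    + ((q : ℤ) + 1).negOnePow • Q.compL 1 (by omega) P.μ m

/-- `B m = ∑_{i=0}^{q-1} (-1)^((q-1) i) τ^i (τ m ∘_q e)`, where `q = n + 1`. -/
def opB {n : ℕ} (m : M (n + 1)) : M n :=
  ∑ i ∈ Finset.range (n + 1), ((n : ℤ) * (i : ℤ)).negOnePow •
    (Q.τ n ^ i) (Q.compR (n + 1) (p := 0) rfl (Q.τ (n + 1) m) P.e)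

/-- The contraction `ι_φ m = (μ ∘_2 m) ∘_1 φ`. -/
def opι {p q n : ℕ} (h : p + q = n) (φ : O p) (m : M q) : M n :=
  Q.compR 1 (q := q + 1) (by omega) (Q.compL 2 (by omega) P.μ m) φ

/-- The Lie derivative
`L_φ m = ∑_{i=1}^q (-1)^((p-1)(i-1)) m ∘_i φ
  + ∑_{i=1}^p (-1)^((p-1) i + q (i-1)) τ^i φ ∘_{p-i+1} m`. -/
def opL {p q n : ℕ} (h : p + q = n + 1) (φ : O p) (m : M q) : M n :=
  ∑ i ∈ Finset.Icc 1 q, (((p : ℤ) - 1) * ((i : ℤ) - 1)).negOnePow •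
      Q.compR i ((Nat.add_comm q p).trans h) m φ
    + ∑ i ∈ Finset.Icc 1 p, (((p : ℤ) - 1) * (i : ℤ) + (q : ℤ) * ((i : ℤ) - 1)).negOnePow •
      Q.compL (p - i + 1) h ((P.τ p ^ i) φ) m

/-- The operator
`S_φ m = ∑_{i=1}^{q-1} ∑_{j=1}^i (-1)^(p(i-j) + q(j-1) + i-1) (τ^j m ∘_{q-j+1} e) ∘_{i-j+1} φ`,
with `q = k + 1` in the second clause; the sum is empty for `q = 0`. -/
def opS : ∀ {p q n : ℕ}, p + q = n + 2 → O p → M q → M n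
  | _, 0, _, _, _, _ => 0
  | p, k + 1, _, h, φ, m =>
    ∑ i ∈ Finset.Icc 1 k, ∑ j ∈ Finset.Icc 1 i,
      ((p : ℤ) * ((i : ℤ) - j) + ((k : ℤ) + 1) * ((j : ℤ) - 1) + i - 1).negOnePow •
        Q.compR (i - j + 1) (q := k) (by omega)
          (Q.compR (k + 1 - j + 1) (p := 0) rfl ((Q.τ (k + 1) ^ j) m) P.e) φ

/-- The homotopy
`T(φ, ψ)(m) = ∑_{j=1}^{p-1} ∑_{i=j}^{p-1} (-1)^(q(j-1) + r(i-1) + (p-1)j + i)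
  (τ^j φ ∘_{p-j+1} m) ∘_{p-i} ψ`,
with `p = k + 1` in the second clause; the sum is empty for `p = 0`. -/
def opT : ∀ {p r q n : ℕ}, p + r + q = n + 2 → O p → O r → M q → M n
  | 0, _, _, _, _, _, _, _ => 0
  | k + 1, r, q, _, h, φ, ψ, m =>
    ∑ j ∈ Finset.Icc 1 k, ∑ i ∈ Finset.Icc j k,
      ((q : ℤ) * ((j : ℤ) - 1) + (r : ℤ) * ((i : ℤ) - 1) + (k : ℤ) * j + i).negOnePow •
        Q.compR (k + 1 - i) (q := k + q) (by omega)
          (Q.compL (k + 1 - j + 1) (by omega) ((P.τ (k + 1) ^ j) φ) m) ψ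

end CyclicModule

/-! Reduction to the operad. The square-zero extension `O ⊕ M`, in which compositions of two module
elements vanish, is again a cyclic operad with multiplication (`squareZeroExt`). The operators on
`M` are the `M`-components of the same formulas for the extension acting on itself, and normalised
elements match. Hence it suffices to prove the identities for a cyclic operad acting on itself.

Signs. Give a composition at input `i` (counted from `0`) the sign `(-1)^((q-1)i)` and rotate by `t
= (-1)^n τ`. Nested compositions and rotations that do not cross the root are then sign-free, and
exchanging two elements costs the Koszul sign of the degrees `p-1` and `q-1`. The target arity of
`cmp` is a free parameter, with value zero when the arities do not match; this avoids transport
between arities.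

Trees. Rotation treats the root of an element as one more leg. `theta a y m` glues the root of `m`
to the root of `y` and makes input `a` of `y` the new root. Summing over `a` gives `graft`. The Lie
derivative `lie g m` is `m{g}` minus a signed `graft g m`: the element `g` is attached at every leg
of `m`, root included. `hom x f m` sums over pairs `a < b` of inputs of `x`, with new root at `a`,
the element `f` at `b` and `m` at the old root. Up to sign, `b = lie μ`, `B m = graft m e`, `ι_f m =
hom μ f m`, `S_f m = hom m f e` and `T(f,g) m = hom g f m`.

Master identity (`lie_hom`). Attach `g` in all possible ways to the tree `hom x f m`. It lands in
`m`, in `x`, in `f`, or at the new root. Compared with `hom (x{g}) f m`, the terms left over have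
`g` inside `f`, or `f` inside `g` with the new root outside `g` or in `g` as well. They give `hom x
[f,g] m` and `hom g f (graft x m)`. Three instances yield the main formulas. Acting by `μ` on `hom m
f e` gives the Cartan homotopy formula (`cartan_homotopy`). Acting by `g` on `hom m f e` gives the
formula for `[S_f, L_g]` (`cyclicHomotopy_lieDer`). Antisymmetrising in `g` and `x` (`lie_hom_sub`)
and taking `x = μ` gives the formula for `[ι_f, L_g]` (`cup_lieDer`).

The rest. The pre-Lie identity gives Jacobi, and `d = [-, μ]` squares to zero because `[μ, μ] = 0`.
The relation `Bb + bB = 0` is the analogue of the master identity for `graft`. The vanishing of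
`BB`, `BS`, `SB` and `BT` holds on normalised elements because the new root of a grafted tree is an
input of a normalised element, which `e` annihilates (`RootKilled`). -/

/-- The sign `(-1)^a` as a scalar. -/
def sgn (K : Type u) [Field K] (a : ℤ) : K := ((a.negOnePow : ℤˣ) : ℤ)

/-! ### Signs and the Koszul rule -/

section Sign

variable {K : Type u} [Field K]

theorem negOnePow_smul_eq_sgn {V : Type v} [AddCommGroup V] [Module K V] (a : ℤ) (x : V) :
    a.negOnePow • x = sgn K a • x := by
  rw [sgn, Units.smul_def, Int.cast_smul_eq_zsmul]

theorem sgn_add (a b : ℤ) : sgn K (a + b) = sgn K a * sgn K b := by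
  simp [sgn, Int.negOnePow_add]

theorem sgn_even {a : ℤ} (h : Even a) : sgn K a = 1 := by
  simp [sgn, Int.negOnePow_even a h]

theorem sgn_odd {a : ℤ} (h : Odd a) : sgn K a = -1 := by
  simp [sgn, Int.negOnePow_odd a h]

theorem sgn_zero : sgn K 0 = 1 := sgn_even (by simp)

theorem sgn_mul_self (a : ℤ) : sgn K a * sgn K a = 1 := by
  rw [← sgn_add]; exact sgn_even ⟨a, rfl⟩

theorem sgn_congr {a b : ℤ} (h : Even (a - b)) : sgn K a = sgn K b := by
  have : sgn K (a - b + b) = sgn K b := by rw [sgn_add, sgn_even h, one_mul]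
  simpa using this

/-- The Koszul sign of two operad elements of arities `p` and `q`. -/
def koszul (K : Type u) [Field K] (p q : ℕ) : K := sgn K (((p : ℤ) - 1) * ((q : ℤ) - 1))

theorem koszul_comm (p q : ℕ) : koszul K p q = koszul K q p := by
  rw [koszul, koszul, mul_comm]

theorem koszul_mul_self (p q : ℕ) : koszul K p q * koszul K p q = 1 := sgn_mul_self _

/-- The suspended degree is additive under composition: `n - 1 = (p - 1) + (q - 1)`. -/
theorem koszul_add_left {p q n : ℕ} (h : p + q = n + 1) (r : ℕ) :
    koszul K n r = koszul K p r * koszul K q r := by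
  rw [koszul, koszul, koszul, ← sgn_add]
  congr 1
  have : (n : ℤ) = p + q - 1 := by omega
  rw [this]; ring

theorem koszul_add_right {p q n : ℕ} (h : p + q = n + 1) (r : ℕ) :
    koszul K r n = koszul K r p * koszul K r q := by
  rw [koszul_comm, koszul_add_left h, koszul_comm p, koszul_comm q]

end Sign

/-! ### Suspended compositions, rotations and re-rooting -/

namespace CyclicOperadWithMul

variable {K : Type u} [Field K] {O : ℕ → Type v} [∀ n, AddCommGroup (O n)] [∀ n, Module K (O n)]
  (P : CyclicOperadWithMul K O)

/-- The partial composition at the input numbered `i` from `0`, with the operadic suspension sign;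
it vanishes unless the target arity `n` is the right one. -/
def cmp (i : ℕ) {p q : ℕ} (n : ℕ) : O p →ₗ[K] O q →ₗ[K] O n :=
  if h : p + q = n + 1 then sgn K (((q : ℤ) - 1) * i) • P.comp (i + 1) h else 0

theorem cmp_eq {i p q n : ℕ} (h : p + q = n + 1) (φ : O p) (ψ : O q) :
    P.cmp i n φ ψ = sgn K (((q : ℤ) - 1) * i) • P.comp (i + 1) h φ ψ := by
  simp [cmp, h]

theorem cmp_of_ne {i p q n : ℕ} (h : p + q ≠ n + 1) (φ : O p) (ψ : O q) :
    P.cmp i n φ ψ = 0 := by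
  simp [cmp, h]

theorem cmp_of_le {i p q n : ℕ} (h : p ≤ i) (φ : O p) (ψ : O q) : P.cmp i n φ ψ = 0 := by
  by_cases hn : p + q = n + 1
  · rw [cmp_eq P hn, P.comp_eq_zero hn φ ψ (by omega), smul_zero]
  · exact P.cmp_of_ne hn φ ψ

/-- The exponent `(degree) * (position)` is additive in both factors, and the composite of `ψ` and
`χ` has degree `(q - 1) + (r - 1)`; so nesting produces no sign. -/
theorem cmp_cmp_seq {i j p q r a c n : ℕ} (hpq : p + q = a + 1) (har : a + r = n + 1)
    (hqr : q + r = c + 1) (hi : i < p) (hj : j < q) (φ : O p) (ψ : O q) (χ : O r) :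
    P.cmp (i + j) n (P.cmp i a φ ψ) χ = P.cmp i n φ (P.cmp j c ψ χ) := by
  have hpc : p + c = n + 1 := by omega
  rw [cmp_eq P hpq, cmp_eq P har, cmp_eq P hqr, cmp_eq P hpc]
  simp only [map_smul, LinearMap.smul_apply, smul_smul, ← sgn_add]
  rw [P.comp_comp_of_mid hpq har hqr hpc φ ψ χ (by omega) (by omega) (by omega) (by omega)]
  rw [show i + j + 1 - (i + 1) + 1 = j + 1 by omega]
  congr 2
  have : (c : ℤ) = q + r - 1 := by omega
  rw [this]; push_cast; ring

/-- Inserting `χ` first shifts the position of `ψ` by `r - 1`, which costs exactly the Koszul sign.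
-/
theorem cmp_cmp_par {i j p q r a c n : ℕ} (hpq : p + q = a + 1) (har : a + r = n + 1)
    (hpr : p + r = c + 1) (hj : j < i) (hi : i < p) (φ : O p) (ψ : O q) (χ : O r) :
    P.cmp j n (P.cmp i a φ ψ) χ = koszul K q r • P.cmp (i + r - 1) n (P.cmp j c φ χ) ψ := by
  have hcq : c + q = n + 1 := by omega
  rw [cmp_eq P hpq, cmp_eq P har, cmp_eq P hpr, cmp_eq P hcq, koszul]
  simp only [map_smul, LinearMap.smul_apply, smul_smul, ← sgn_add]
  rw [P.comp_comp_of_lt hpq har hpr hcq φ ψ χ (by omega) (by omega) (by omega)]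
  rw [show i + 1 + r - 1 = i + r - 1 + 1 by omega]
  congr 1
  apply sgn_congr
  have : ((i + r - 1 : ℕ) : ℤ) = i + r - 1 := by omega
  rw [this]
  exact ⟨-((r : ℤ) - 1) * (q - 1), by ring⟩

theorem cmp_cmp_par' {i j p q r a c n : ℕ} (hpq : p + q = a + 1) (har : a + r = n + 1)
    (hpr : p + r = c + 1) (hj : j < i) (hi : i < p) (φ : O p) (ψ : O q) (χ : O r) :
    P.cmp (i + q - 1) n (P.cmp j a φ ψ) χ = koszul K q r • P.cmp j n (P.cmp i c φ χ) ψ := by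
  rw [P.cmp_cmp_par hpr (by omega) hpq hj hi φ χ ψ, smul_smul, koszul_comm r q, koszul_mul_self,
    one_smul]

/-- The cyclic operator with the suspension sign. -/
def t (n : ℕ) : Module.End K (O n) := sgn K n • P.τ n

theorem t_pow_eq (n l : ℕ) : P.t n ^ l = sgn K (n * l) • P.τ n ^ l := by
  induction l with
  | zero => simp [sgn_zero]
  | succ l ih =>
    rw [pow_succ, ih, t, pow_succ, smul_mul_smul_comm, ← sgn_add]
    push_cast; ring_nf

theorem t_pow_succ_arity (n : ℕ) : P.t n ^ (n + 1) = 1 := by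
  rw [t_pow_eq, P.τ_pow, sgn_even, one_smul]
  exact_mod_cast Nat.even_mul_succ_self n

theorem t_pow_apply_succ (n l : ℕ) (x : O n) : (P.t n ^ (l + 1)) x = P.t n ((P.t n ^ l) x) := by
  rw [pow_succ']; rfl

theorem t_pow_apply_succ' (n l : ℕ) (x : O n) : (P.t n ^ (l + 1)) x = (P.t n ^ l) (P.t n x) := by
  rw [pow_succ]; rfl

theorem t_pow_apply_add (n k l : ℕ) (x : O n) :
    (P.t n ^ (k + l)) x = (P.t n ^ k) ((P.t n ^ l) x) := by
  rw [pow_add]; rfl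

/-- The factor `(-1)^(n-p) = (-1)^(q-1)` lost by `t` is the sign gained when `ψ` moves down one
position. -/
theorem t_cmp {i p q n : ℕ} (hi : i + 1 < p) (φ : O p) (ψ : O q) :
    P.t n (P.cmp (i + 1) n φ ψ) = P.cmp i n (P.t p φ) ψ := by
  by_cases h : p + q = n + 1
  · rw [cmp_eq P h, cmp_eq P h, t, t]
    simp only [map_smul, LinearMap.smul_apply, smul_smul, ← sgn_add]
    rw [P.τ_comp h φ ψ (by omega) (by omega)]
    rw [show i + 1 + 1 - 1 = i + 1 by omega]
    congr 1
    apply sgn_congr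
    have : (n : ℤ) = p + q - 1 := by omega
    rw [this]; push_cast
    exact ⟨(q : ℤ) - 1, by ring⟩
  · rw [cmp_of_ne P h, cmp_of_ne P h, map_zero]

theorem t_cmp_zero {p q n : ℕ} (hp : 1 ≤ p) (hq : 1 ≤ q) (φ : O p) (ψ : O q) :
    P.t n (P.cmp 0 n φ ψ) = -koszul K p q • P.cmp (q - 1) n (P.t q ψ) (P.t p φ) := by
  by_cases h : p + q = n + 1
  · rw [cmp_eq P h, cmp_eq P ((Nat.add_comm q p).trans h), t, t, t, koszul]
    simp only [map_smul, LinearMap.smul_apply, smul_smul, ← sgn_add]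
    rw [P.τ_comp_one h φ ψ hp hq, show q - 1 + 1 = q by omega]
    congr 1
    rw [neg_mul, ← neg_one_mul, ← sgn_odd (a := 1) (by simp), ← sgn_add, ← sgn_add]
    apply sgn_congr
    have h1 : (n : ℤ) = p + q - 1 := by omega
    have h2 : ((q - 1 : ℕ) : ℤ) = q - 1 := by omega
    rw [h1, h2]; push_cast
    exact ⟨-((p : ℤ) - 1) * (q - 1) - 1, by ring⟩
  · rw [cmp_of_ne P h, cmp_of_ne P (by omega), map_zero, smul_zero]

theorem t_pow_cmp {i l p q n : ℕ} (hi : l + i < p) (φ : O p) (ψ : O q) :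
    (P.t n ^ l) (P.cmp (l + i) n φ ψ) = P.cmp i n ((P.t p ^ l) φ) ψ := by
  induction l generalizing i with
  | zero => simp
  | succ l ih =>
    rw [t_pow_apply_succ, show l + 1 + i = l + (i + 1) by omega, ih (by omega),
      P.t_cmp (by omega), ← t_pow_apply_succ]

/-- Rotating past the element inserted at the first input. -/
theorem t_pow_cmp_zero {p q n : ℕ} (hp : 1 ≤ p) (φ : O p) (ψ : O q) :
    (P.t n ^ (q + 1)) (P.cmp 0 n φ ψ) = P.cmp (p - 1) n ((P.t p ^ 2) φ) ψ := by
  by_cases h : p + q = n + 1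
  swap
  · rw [cmp_of_ne P h, cmp_of_ne P h, map_zero]
  rcases Nat.eq_zero_or_pos q with rfl | hq
  -- For `q = 0` the axiom for crossing the root is not available. Instead, `n` rotations carry an
  -- insertion at the last input to the first one, and `t ^ (n + 1) = 1` inverts this.
  · obtain ⟨k, rfl⟩ : ∃ k, p = k + 1 := ⟨p - 1, by omega⟩
    obtain rfl : n = k := by omega
    have h1 := P.t_pow_cmp (n := n) (i := 0) (l := n) (by omega) ((P.t (n + 1) ^ 2) φ) ψ
    rw [← t_pow_apply_add, P.t_pow_succ_arity (n + 1)] at h1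
    simp only [Module.End.one_apply, add_zero] at h1
    rw [← h1, zero_add, ← t_pow_apply_add, add_comm, t_pow_succ_arity]
    simp
  -- The first rotation makes `ψ` the outer element, `k` more bring `φ` to its first input, and the
  -- last one exchanges them back; the two signs cancel.
  · obtain ⟨k, rfl⟩ : ∃ k, q = k + 1 := ⟨q - 1, by omega⟩
    rw [t_pow_apply_succ, t_pow_apply_succ', P.t_cmp_zero hp hq]
    simp only [map_smul]
    have h1 := P.t_pow_cmp (n := n) (i := 0) (l := k) (by omega) (P.t (k + 1) ψ) (P.t p φ)
    rw [add_zero] at h1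
    rw [show k + 1 - 1 = k by omega, h1, ← t_pow_apply_succ', P.t_cmp_zero hq hp, smul_smul,
      koszul_comm (k + 1), neg_mul_neg, koszul_mul_self, one_smul, ← t_pow_apply_succ,
      t_pow_succ_arity, t_pow_apply_succ, pow_one]
    rfl

/-- `k` rotations bring `ψ` to the first input, `q + 1` carry it past the root to the last input,
and `l` move it further down. -/
theorem t_pow_cmp_wrap {k l p q n : ℕ} (hk : k + l < p) (φ : O p) (ψ : O q) :
    (P.t n ^ (k + q + 1 + l)) (P.cmp k n φ ψ) =
      P.cmp (p - 1 - l) n ((P.t p ^ (k + 2 + l)) φ) ψ := by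
  have h1 := P.t_pow_cmp (n := n) (i := 0) (l := k) (by omega) φ ψ
  rw [add_zero] at h1
  rw [show k + q + 1 + l = l + ((q + 1) + k) by omega, t_pow_apply_add, t_pow_apply_add, h1,
    P.t_pow_cmp_zero (by omega), show p - 1 = l + (p - 1 - l) by omega,
    P.t_pow_cmp (by omega), ← t_pow_apply_add, ← t_pow_apply_add,
    show l + (p - 1 - l) - l = p - 1 - l by omega, show l + 2 + k = k + 2 + l by omega]

/-- The element `y` with `m` inserted at its root, re-rooted at the input `a` of `y`. -/
def theta (a : ℕ) {n q : ℕ} (N : ℕ) : O n →ₗ[K] O q →ₗ[K] O N :=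
  P.cmp (n - 1 - a) N ∘ₗ (P.t n ^ (a + 1))

/-- After `a + 1` rotations input `a` of `y` is the root and the former root is input `n - 1 - a`,
which receives `m`. -/
theorem theta_apply {a n q N : ℕ} (y : O n) (m : O q) :
    P.theta a N y m = P.cmp (n - 1 - a) N ((P.t n ^ (a + 1)) y) m := rfl

theorem theta_of_ne {a n q N : ℕ} (h : n + q ≠ N + 1) (y : O n) (m : O q) :
    P.theta a N y m = 0 := P.cmp_of_ne h _ _

/-- Both sides are the chain `m`, `y`, `g`: the root of `m` is joined to that of `y`, input `a` of
`y` to the root of `g`, and input `c` of `g`, which is input `a + c` of the composite, is the new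
root. -/
theorem theta_theta {a c n s q N v w : ℕ} (hy : n + q = v + 1) (hg : s + v = N + 1)
    (hw : n + s = w + 1) (ha : a < n) (hc : c < s) (y : O n) (g : O s) (m : O q) :
    P.theta c N g (P.theta a v y m) = -koszul K n s • P.theta (a + c) N (P.cmp a w y g) m := by
  have h1 := P.t_pow_cmp (n := w) (i := 0) (l := a) (by omega) y g
  rw [add_zero] at h1
  have h2 := P.t_pow_cmp (n := w) (i := s - 1 - c) (l := c) (by omega) (P.t s g)
    ((P.t n ^ (a + 1)) y)
  -- Here `a` rotations bring `g` to the first input of `y`, one more makes `g` the outer element,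
  -- with a sign, and `c` more stay within `g`.
  have h3 : (P.t w ^ (a + c + 1)) (P.cmp a w y g) =
      -koszul K n s • P.cmp (s - 1 - c) w ((P.t s ^ (c + 1)) g) ((P.t n ^ (a + 1)) y) := by
    rw [show a + c + 1 = c + 1 + a by omega, t_pow_apply_add, h1, t_pow_apply_succ',
      P.t_cmp_zero (by omega) (by omega), map_smul, ← t_pow_apply_succ,
      show s - 1 = c + (s - 1 - c) by omega, h2, ← t_pow_apply_succ',
      show c + (s - 1 - c) - c = s - 1 - c by omega]
  simp only [theta_apply]
  rw [← P.cmp_cmp_seq (a := w) (by omega) (by omega) (by omega) (by omega) (by omega), h3,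
    map_smul, LinearMap.smul_apply, smul_smul, neg_mul_neg, koszul_mul_self, one_smul,
    show s - 1 - c + (n - 1 - a) = w - 1 - (a + c) by omega]

end CyclicOperadWithMul

/-! ### Reindexing sums over inputs -/

section Sums

open Finset

variable {V : Type v} [AddCommMonoid V]

/-- The inputs of a composite at position `i` are those of the outer element before `i`, those of
the inner element, and those of the outer element after `i`. -/
theorem sum_range_split {i p s n : ℕ} (hi : i < p) (h : p + s = n + 1) (F : ℕ → V) :
    ∑ k ∈ range n, F k = ∑ k ∈ range i, F k + ∑ k ∈ range s, F (i + k)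
      + ∑ k ∈ range (p - 1 - i), F (i + s + k) := by
  rw [show n = i + s + (p - 1 - i) by omega, sum_range_add, sum_range_add]

theorem sum_range_triangle (p : ℕ) (F : ℕ → ℕ → V) :
    ∑ b ∈ range p, ∑ k ∈ range (p - 1 - b), F b (b + 1 + k) =
      ∑ k ∈ range p, ∑ b ∈ range k, F b k := by
  rw [sum_sigma', sum_sigma']
  refine sum_nbij' (fun x => ⟨x.1 + 1 + x.2, x.1⟩) (fun x => ⟨x.2, x.1 - 1 - x.2⟩) ?_ ?_ ?_ ?_ ?_
  all_goals simp only [mem_sigma, mem_range]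
  · intro x hx; omega
  · intro x hx; omega
  · rintro ⟨a, b⟩ hx; simp
  · rintro ⟨a, b⟩ hx
    simp only at hx ⊢
    rw [show b + 1 + (a - 1 - b) = a by omega]
  · intros; trivial

end Sums

/-! ### Braces, the pre-Lie identity and insertion with a marked input -/

namespace CyclicOperadWithMul

open Finset

variable {K : Type u} [Field K] {O : ℕ → Type v} [∀ n, AddCommGroup (O n)] [∀ n, Module K (O n)]
  (P : CyclicOperadWithMul K O)

/-- The brace `φ{ψ}` for the signed compositions. -/
def insertion {p q : ℕ} (n : ℕ) : O p →ₗ[K] O q →ₗ[K] O n :=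
  ∑ i ∈ range p, P.cmp i n

theorem insertion_apply {p q n : ℕ} (φ : O p) (ψ : O q) :
    P.insertion n φ ψ = ∑ i ∈ range p, P.cmp i n φ ψ := by
  simp [insertion]

theorem insertion_of_ne {p q n : ℕ} (h : p + q ≠ n + 1) (φ : O p) (ψ : O q) :
    P.insertion n φ ψ = 0 := by
  rw [insertion_apply]; exact sum_eq_zero fun i _ => P.cmp_of_ne h _ _

theorem cmp_insertion {i p q r a n : ℕ} (hpq : p + q = a + 1) (har : a + r = n + 1)
    (hi : i < p) (φ : O p) (ψ : O q) (χ : O r) :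
    ∑ k ∈ range q, P.cmp (i + k) n (P.cmp i a φ ψ) χ =
      P.cmp i n φ (P.insertion (q + r - 1) ψ χ) := by
  rw [insertion_apply, map_sum]
  refine sum_congr rfl fun k hk => ?_
  rw [mem_range] at hk
  rw [P.cmp_cmp_seq hpq har (by omega : q + r = q + r - 1 + 1) hi hk]

/-- Insertion of `χ` into a composite. -/
theorem insertion_cmp {i p q r a c n : ℕ} (hpq : p + q = a + 1) (har : a + r = n + 1)
    (hpr : p + r = c + 1) (hi : i < p) (φ : O p) (ψ : O q) (χ : O r) :
    P.insertion n (P.cmp i a φ ψ) χ =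
      ∑ k ∈ range i, P.cmp k n (P.cmp i a φ ψ) χ + P.cmp i n φ (P.insertion (q + r - 1) ψ χ)
      + koszul K q r • ∑ k ∈ range (p - 1 - i), P.cmp i n (P.cmp (i + 1 + k) c φ χ) ψ := by
  rw [insertion_apply, sum_range_split hi hpq, P.cmp_insertion hpq har hi, smul_sum]
  congr 1
  refine sum_congr rfl fun k hk => ?_
  rw [mem_range] at hk
  rw [show i + q + k = i + 1 + k + q - 1 by omega,
    P.cmp_cmp_par' hpq har hpr (by omega) (by omega)]

/-- Either `χ` lands in `ψ`, or both sit at distinct inputs of `φ`. The last two sums are the two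
orders of these inputs; exchanging `ψ` and `χ` swaps them up to the Koszul sign, whence the pre-Lie
identity. -/
theorem insertion_insertion {p q r a c n : ℕ} (hpq : p + q = a + 1) (har : a + r = n + 1)
    (hpr : p + r = c + 1) (φ : O p) (ψ : O q) (χ : O r) :
    P.insertion n (P.insertion a φ ψ) χ =
      P.insertion n φ (P.insertion (q + r - 1) ψ χ)
      + ∑ i ∈ range p, ∑ k ∈ range i, P.cmp k n (P.cmp i a φ ψ) χ
      + koszul K q r • ∑ i ∈ range p, ∑ k ∈ range i, P.cmp k n (P.cmp i c φ χ) ψ := by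
  have h1 : ∀ i ∈ range p, P.insertion n (P.cmp i a φ ψ) χ = _ := fun i hi =>
    P.insertion_cmp hpq har hpr (mem_range.1 hi) φ ψ χ
  rw [P.insertion_apply φ ψ, map_sum, LinearMap.sum_apply, sum_congr rfl h1, sum_add_distrib,
    sum_add_distrib, ← smul_sum, sum_range_triangle p fun b k => P.cmp b n (P.cmp k c φ χ) ψ,
    ← insertion_apply]
  abel

theorem insertion_prelie {p q r a c d n : ℕ} (ha : a = p + q - 1) (hc : c = p + r - 1)
    (hd : d = q + r - 1) (φ : O p) (ψ : O q) (χ : O r) :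
    P.insertion n (P.insertion a φ ψ) χ - P.insertion n φ (P.insertion d ψ χ) =
      koszul K q r • (P.insertion n (P.insertion c φ χ) ψ
        - P.insertion n φ (P.insertion d χ ψ)) := by
  by_cases h : p + q = a + 1 ∧ a + r = n + 1 ∧ p + r = c + 1
  · obtain ⟨h1, h2, h3⟩ := h
    subst hd
    rw [P.insertion_insertion h1 h2 h3, P.insertion_insertion h3 (by omega) h1,
      show r + q - 1 = q + r - 1 by omega, koszul_comm r q]
    simp only [smul_add, smul_sub, smul_smul, koszul_mul_self, one_smul]
    abel
  -- Outside the valid arities (truncated subtraction included) every term vanishes, by an arity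
  -- mismatch or because `p = 0` leaves no input.
  · have e1 : P.insertion n (P.insertion a φ ψ) χ = 0 := by
      by_cases h1 : p + q = a + 1
      · by_cases h2 : a + r = n + 1
        · have hp : p = 0 := by omega
          subst hp
          simp [insertion]
        · exact P.insertion_of_ne h2 _ _
      · rw [P.insertion_of_ne h1, map_zero, LinearMap.zero_apply]
    have e2 : P.insertion n (P.insertion c φ χ) ψ = 0 := by
      by_cases h1 : p + r = c + 1
      · by_cases h2 : c + q = n + 1
        · have hp : p = 0 := by omega
          subst hp
          simp [insertion]
        · exact P.insertion_of_ne h2 _ _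
      · rw [P.insertion_of_ne h1, map_zero, LinearMap.zero_apply]
    have e3 : ∀ (x : O q) (y : O r), P.insertion n φ (P.insertion d x y) = 0 := fun x y => by
      by_cases h1 : q + r = d + 1
      · by_cases h2 : p + d = n + 1
        · have hp : p = 0 := by omega
          subst hp
          simp [insertion]
        · exact P.insertion_of_ne h2 _ _
      · rw [P.insertion_of_ne h1, map_zero]
    have e4 : ∀ (x : O q) (y : O r), P.insertion n φ (P.insertion d y x) = 0 := fun x y => by
      by_cases h1 : r + q = d + 1
      · by_cases h2 : p + d = n + 1
        · have hp : p = 0 := by omega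
          subst hp
          simp [insertion]
        · exact P.insertion_of_ne h2 _ _
      · rw [P.insertion_of_ne h1, map_zero]
    rw [e1, e2, e3, e4]
    simp

/-- Insertion of `g` into `y` with a marked input `a`; if `g` is inserted at the marked input,
the mark moves to all the inputs of `g`. The functional `W` records the marked element. -/
def markedInsertion {N : ℕ} {V : Type w} [AddCommGroup V] [Module K V] (W : ℕ → O N →ₗ[K] V)
    {n s : ℕ} (y : O n) (a : ℕ) (g : O s) : V :=
  ∑ k ∈ range a, W (a + s - 1) (P.cmp k N y g) + ∑ c ∈ range s, W (a + c) (P.cmp a N y g)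
    + ∑ k ∈ range (n - 1 - a), W a (P.cmp (a + 1 + k) N y g)

variable {V : Type w} [AddCommGroup V] [Module K V]

/-- An input of a composite comes from exactly one of its factors, so marking `φ` and then inserting
`γ` counts the same pairs as inserting and then marking. -/
theorem sum_markedInsertion {x g N : ℕ} (W : ℕ → O N →ₗ[K] V) (h : x + g = N + 1)
    (φ : O x) (γ : O g) :
    ∑ a ∈ range x, P.markedInsertion W φ a γ = ∑ a ∈ range N, W a (P.insertion N φ γ) := by
  simp only [markedInsertion, insertion_apply, map_sum]
  rw [sum_comm (s := range N)]
  have h1 : ∀ k ∈ range x, ∑ a ∈ range N, W a (P.cmp k N φ γ) = _ := fun k hk =>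
    sum_range_split (mem_range.1 hk) h _
  rw [sum_congr rfl h1, sum_add_distrib, sum_add_distrib, sum_add_distrib, sum_add_distrib,
    sum_range_triangle x fun b k => W b (P.cmp k N φ γ),
    ← sum_range_triangle x fun b k => W (k + g - 1) (P.cmp b N φ γ)]
  have h2 : ∀ k ∈ range x, ∑ a ∈ range (x - 1 - k), W (k + g + a) (P.cmp k N φ γ) =
      ∑ a ∈ range (x - 1 - k), W (k + 1 + a + g - 1) (P.cmp k N φ γ) := fun k _ =>
    sum_congr rfl fun a _ => by rw [show k + 1 + a + g - 1 = k + g + a by omega]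
  rw [sum_congr rfl h2]
  abel

/-- `(x{f})` with a marked input before `f`. -/
theorem sum_sum_markedInsertion {p r s u v N : ℕ} (W : ℕ → O N →ₗ[K] V) (hu : p + r = u + 1)
    (hN : u + s = N + 1) (hv : p + s = v + 1) (x : O p) (f : O r) (g : O s) :
    ∑ b ∈ range p, ∑ a ∈ range b, P.markedInsertion W (P.cmp b u x f) a g =
      koszul K r s • (∑ b ∈ range v, ∑ a ∈ range b, W a (P.cmp b N (P.insertion v x g) f)
        - ∑ k ∈ range p, ∑ b ∈ range s, ∑ a ∈ range b,
            W (k + a) (P.cmp k N x (P.cmp b (r + s - 1) g f))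
        - ∑ b ∈ range p, ∑ a ∈ range b, W a (P.cmp b N x (P.insertion (r + s - 1) g f)))
      + ∑ b ∈ range p, ∑ a ∈ range b, W a (P.cmp b N x (P.insertion (r + s - 1) f g)) := by
  have hw : r + s - 1 = s + r - 1 := by omega
  -- the right-hand side, by the position of `g`
  have key : ∑ b ∈ range v, ∑ a ∈ range b, W a (P.cmp b N (P.insertion v x g) f) =
      ∑ k ∈ range p, ∑ b ∈ range k, ∑ a ∈ range b, W a (P.cmp b N (P.cmp k v x g) f)
      + (∑ b ∈ range p, ∑ a ∈ range b, W a (P.cmp b N x (P.insertion (r + s - 1) g f))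
        + ∑ k ∈ range p, ∑ b ∈ range s, ∑ a ∈ range b,
            W (k + a) (P.cmp k N x (P.cmp b (r + s - 1) g f)))
      + koszul K r s • ∑ b ∈ range p, ∑ k ∈ range b,
          (∑ a ∈ range k, W a (P.cmp k N (P.cmp b u x f) g)
            + ∑ a ∈ range s, W (k + a) (P.cmp k N (P.cmp b u x f) g)
            + ∑ a ∈ range (b - 1 - k), W (k + s + a) (P.cmp k N (P.cmp b u x f) g)) := by
    have e1 : ∑ b ∈ range v, ∑ a ∈ range b, W a (P.cmp b N (P.insertion v x g) f) =
        ∑ k ∈ range p, ∑ b ∈ range v, ∑ a ∈ range b, W a (P.cmp b N (P.cmp k v x g) f) := by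
      simp only [insertion_apply, map_sum, LinearMap.sum_apply]
      rw [sum_comm]
      exact sum_congr rfl fun b _ => sum_comm
    have e2 : ∀ k ∈ range p, ∑ b ∈ range v, ∑ a ∈ range b, W a (P.cmp b N (P.cmp k v x g) f) =
        ∑ b ∈ range k, ∑ a ∈ range b, W a (P.cmp b N (P.cmp k v x g) f)
        + (∑ a ∈ range k, W a (P.cmp k N x (P.insertion (r + s - 1) g f))
          + ∑ b ∈ range s, ∑ a ∈ range b, W (k + a) (P.cmp k N x (P.cmp b (r + s - 1) g f)))
        + koszul K r s • ∑ b ∈ range (p - 1 - k),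
          (∑ a ∈ range k, W a (P.cmp k N (P.cmp (k + 1 + b) u x f) g)
            + ∑ a ∈ range s, W (k + a) (P.cmp k N (P.cmp (k + 1 + b) u x f) g)
            + ∑ a ∈ range (k + 1 + b - 1 - k),
                W (k + s + a) (P.cmp k N (P.cmp (k + 1 + b) u x f) g)) := fun k hk => by
      rw [mem_range] at hk
      rw [sum_range_split hk hv]
      congr 1
      · congr 1
        simp only [insertion_apply, map_sum]
        rw [sum_comm, ← sum_add_distrib]
        refine sum_congr rfl fun b hb => ?_
        rw [mem_range] at hb
        rw [sum_range_add, P.cmp_cmp_seq hv (by omega) (by omega : s + r = r + s - 1 + 1) hk hb]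
      · rw [smul_sum]
        refine sum_congr rfl fun b hb => ?_
        rw [mem_range] at hb
        have h3 : P.cmp (k + s + b) N (P.cmp k v x g) f =
            koszul K r s • P.cmp k N (P.cmp (k + 1 + b) u x f) g := by
          rw [koszul_comm, show k + s + b = k + 1 + b + s - 1 by omega,
            P.cmp_cmp_par' hv (by omega) hu (by omega) (by omega)]
        rw [h3, sum_range_add, sum_range_add, show k + 1 + b - 1 - k = b by omega]
        simp only [map_smul, smul_add, smul_sum]
    rw [e1, sum_congr rfl e2, sum_add_distrib, sum_add_distrib, sum_add_distrib, ← smul_sum,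
      sum_range_triangle p fun k b => (∑ a ∈ range k, W a (P.cmp k N (P.cmp b u x f) g)
            + ∑ a ∈ range s, W (k + a) (P.cmp k N (P.cmp b u x f) g)
            + ∑ a ∈ range (b - 1 - k), W (k + s + a) (P.cmp k N (P.cmp b u x f) g))]
  -- With `f` placed first, `g` goes before `f` (on either side of the mark or at it), into `f`, or
  -- after `f`. Only the terms with `g` in `f` have no counterpart in `key`.
  have lhs : ∀ b ∈ range p, ∑ a ∈ range b, P.markedInsertion W (P.cmp b u x f) a g =
      ∑ k ∈ range b,
          (∑ a ∈ range k, W a (P.cmp k N (P.cmp b u x f) g)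
            + ∑ a ∈ range s, W (k + a) (P.cmp k N (P.cmp b u x f) g)
            + ∑ a ∈ range (b - 1 - k), W (k + s + a) (P.cmp k N (P.cmp b u x f) g))
      + ∑ a ∈ range b, W a (P.cmp b N x (P.insertion (r + s - 1) f g))
      + koszul K r s • ∑ k ∈ range (p - 1 - b), ∑ a ∈ range b,
          W a (P.cmp b N (P.cmp (b + 1 + k) v x g) f) := fun b hb => by
    rw [mem_range] at hb
    have e1 : ∀ a ∈ range b, P.markedInsertion W (P.cmp b u x f) a g =
        ∑ k ∈ range a, W (a + s - 1) (P.cmp k N (P.cmp b u x f) g)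
        + ∑ c ∈ range s, W (a + c) (P.cmp a N (P.cmp b u x f) g)
        + (∑ k ∈ range (b - 1 - a), W a (P.cmp (a + 1 + k) N (P.cmp b u x f) g)
          + W a (P.cmp b N x (P.insertion (r + s - 1) f g))
          + koszul K r s • ∑ k ∈ range (p - 1 - b),
              W a (P.cmp b N (P.cmp (b + 1 + k) v x g) f)) := fun a ha => by
      rw [mem_range] at ha
      rw [markedInsertion]
      congr 1
      rw [show u - 1 - a = (b - 1 - a) + r + (p - 1 - b) by omega, sum_range_add, sum_range_add]
      congr 1
      · congr 1
        rw [← P.cmp_insertion hu hN hb, map_sum]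
        refine sum_congr rfl fun k _ => ?_
        rw [show a + 1 + (b - 1 - a + k) = b + k by omega]
      · rw [smul_sum]
        refine sum_congr rfl fun k hk => ?_
        rw [mem_range] at hk
        rw [← map_smul, ← P.cmp_cmp_par' hu hN hv (by omega) (by omega),
          show a + 1 + (b - 1 - a + r + k) = b + 1 + k + r - 1 by omega]
    rw [sum_congr rfl e1]
    simp only [sum_add_distrib]
    rw [sum_range_triangle b fun a k => W a (P.cmp k N (P.cmp b u x f) g),
      ← sum_range_triangle b fun k a => W (a + s - 1) (P.cmp k N (P.cmp b u x f) g),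
      ← smul_sum, sum_comm (s := range b) (t := range (p - 1 - b))]
    have h2 : ∀ k ∈ range b, ∑ a ∈ range (b - 1 - k),
          W (k + 1 + a + s - 1) (P.cmp k N (P.cmp b u x f) g) =
        ∑ a ∈ range (b - 1 - k), W (k + s + a) (P.cmp k N (P.cmp b u x f) g) := fun k _ =>
      sum_congr rfl fun a _ => by rw [show k + 1 + a + s - 1 = k + s + a by omega]
    rw [sum_congr rfl h2]
    abel
  rw [sum_congr rfl lhs, sum_add_distrib, sum_add_distrib, ← smul_sum,
    sum_range_triangle p fun b k => ∑ a ∈ range b, W a (P.cmp b N (P.cmp k v x g) f), key]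
  simp only [smul_add, smul_sub, smul_smul, koszul_mul_self, one_smul]
  abel

end CyclicOperadWithMul

/-! ### The Lie derivative, the homotopy and the master identity -/

namespace CyclicOperadWithMul

open Finset

variable {K : Type u} [Field K] {O : ℕ → Type v} [∀ n, AddCommGroup (O n)] [∀ n, Module K (O n)]
  (P : CyclicOperadWithMul K O)

/-- The Gerstenhaber bracket for the signed compositions. -/
def gbracket {p q : ℕ} (n : ℕ) : O p →ₗ[K] O q →ₗ[K] O n :=
  P.insertion n - koszul K p q • (P.insertion n).flip

theorem gbracket_apply {p q n : ℕ} (φ : O p) (ψ : O q) :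
    P.gbracket n φ ψ = P.insertion n φ ψ - koszul K p q • P.insertion n ψ φ := rfl

/-- The root of `m` glued to the root of `φ`, with all inputs of `φ` as new roots. -/
def graft {p q : ℕ} (n : ℕ) : O p →ₗ[K] O q →ₗ[K] O n :=
  ∑ a ∈ range p, P.theta a n

theorem graft_apply {p q n : ℕ} (φ : O p) (m : O q) :
    P.graft n φ m = ∑ a ∈ range p, P.theta a n φ m := by
  simp [graft]

theorem graft_of_ne {p q n : ℕ} (h : p + q ≠ n + 1) (φ : O p) (m : O q) :
    P.graft n φ m = 0 := by
  rw [graft_apply]; exact sum_eq_zero fun i _ => P.theta_of_ne h _ _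

/-- The Lie derivative `lie n φ m`. -/
def lie {p q : ℕ} (n : ℕ) : O p →ₗ[K] O q →ₗ[K] O n :=
  (P.insertion n).flip - koszul K p q • P.graft n

theorem lie_apply {p q n : ℕ} (φ : O p) (m : O q) :
    P.lie n φ m = P.insertion n m φ - koszul K p q • P.graft n φ m := rfl

/-- The homotopy: the root of `m` glued to the root of `x`, a new root at an input of `x`, and `f`
at a later input of `x`. -/
def hom {p r q : ℕ} (n : ℕ) : O p →ₗ[K] O r →ₗ[K] O q →ₗ[K] O n :=
  ∑ b ∈ range p, ∑ a ∈ range b, (P.cmp b (p + r - 1)).compr₂ (P.theta a n)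

theorem hom_apply {p r q n : ℕ} (x : O p) (f : O r) (m : O q) :
    P.hom n x f m =
      ∑ b ∈ range p, ∑ a ∈ range b, P.theta a n (P.cmp b (p + r - 1) x f) m := by
  simp [hom]

theorem hom_of_ne {p r q n : ℕ} (h : p + r + q ≠ n + 2) (x : O p) (f : O r) (m : O q) :
    P.hom n x f m = 0 := by
  rw [hom_apply]
  refine sum_eq_zero fun b hb => sum_eq_zero fun a ha => P.theta_of_ne ?_ _ _
  rw [mem_range] at hb ha
  omega

theorem hom_of_le_one {p r q n : ℕ} (h : p ≤ 1) (x : O p) (f : O r) (m : O q) :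
    P.hom n x f m = 0 := by
  rw [hom_apply]
  refine sum_eq_zero fun b hb => sum_eq_zero fun a ha => ?_
  rw [mem_range] at hb ha
  omega

/-- The legs of the glued tree are the inputs of `m`, the unmarked inputs of `y`, and the marked
input `a`, which is its root. Attaching `g` at the first kind gives `m{g}`; the other two make up
the marked insertion, with the root supplied by the `graft` term of `lie`. -/
theorem lie_theta {a n q s v w N : ℕ} (hv : n + q = v + 1) (hN : v + s = N + 1)
    (hw : n + s = w + 1) (ha : a < n) (g : O s) (y : O n) (m : O q) :
    P.lie N g (P.theta a v y m) = P.theta a N y (P.insertion (q + s - 1) m g)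
      + koszul K q s • P.markedInsertion (fun i => (P.theta i (n := w) N).flip m) y a g := by
  -- Re-rooting permutes the inputs cyclically: those of `y` after the mark now precede `m`.
  have h1 : ∑ k ∈ range (n - 1 - a),
        P.cmp k N (P.cmp (n - 1 - a) v ((P.t n ^ (a + 1)) y) m) g =
      koszul K q s • ∑ k ∈ range (n - 1 - a), P.theta a N (P.cmp (a + 1 + k) w y g) m := by
    rw [smul_sum]
    refine sum_congr rfl fun k hk => ?_
    rw [mem_range] at hk
    rw [P.cmp_cmp_par hv hN hw hk (by omega), theta_apply, P.t_pow_cmp (by omega),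
      show n - 1 - a + s - 1 = w - 1 - a by omega]
  -- The inputs of `y` before the mark now follow `m`. Inserting `g` there shifts the mark to `a + s
  -- - 1`, and the comparison rotates `g` past the root.
  have h2 : ∑ k ∈ range (n - 1 - (n - 1 - a)),
        P.cmp (n - 1 - a) N (P.cmp (n - 1 - a + 1 + k) w ((P.t n ^ (a + 1)) y) g) m =
      ∑ k ∈ range a, P.theta (a + s - 1) N (P.cmp k w y g) m := by
    rw [show n - 1 - (n - 1 - a) = a by omega]
    refine sum_congr rfl fun k hk => ?_
    rw [mem_range] at hk
    rw [theta_apply, show a + s - 1 + 1 = k + s + 1 + (a - 1 - k) by omega,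
      P.t_pow_cmp_wrap (by omega), show k + 2 + (a - 1 - k) = a + 1 by omega,
      show w - 1 - (a + s - 1) = n - 1 - a by omega,
      show n - 1 - (a - 1 - k) = n - 1 - a + 1 + k by omega]
  have h3 : P.graft N g (P.theta a v y m) =
      -koszul K n s • ∑ c ∈ range s, P.theta (a + c) N (P.cmp a w y g) m := by
    rw [graft_apply, smul_sum]
    refine sum_congr rfl fun c hc => ?_
    rw [mem_range] at hc
    rw [P.theta_theta hv (by omega) hw ha hc]
  rw [lie_apply, h3, theta_apply, P.insertion_cmp hv hN hw (by omega), h1, h2, smul_smul,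
    koszul_add_right (p := n) (q := q) (n := v) (by omega), koszul_comm s n, koszul_comm s q]
  have h4 : koszul K n s * koszul K q s * -koszul K n s = -koszul K q s := by
    linear_combination (-koszul K q s) * koszul_mul_self (K := K) n s
  rw [h4, markedInsertion]
  simp only [LinearMap.flip_apply, theta_apply, smul_add, neg_smul]
  abel

/-- Sum of `lie_theta` over the marks; by `sum_markedInsertion` the marked insertions add up to
`x{g}` with all its marks. -/
theorem lie_graft {p q s v N : ℕ} (hv : p + q = v + 1) (hN : v + s = N + 1)
    (g : O s) (x : O p) (m : O q) :
    P.lie N g (P.graft v x m) = P.graft N x (P.insertion (q + s - 1) m g)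
      + koszul K q s • P.graft N (P.insertion (p + s - 1) x g) m := by
  rcases Nat.eq_zero_or_pos p with rfl | hp
  · simp [graft, insertion]
  have h1 : ∀ a ∈ range p, P.lie N g (P.theta a v x m) = _ := fun a ha =>
    P.lie_theta hv hN (by omega : p + s = p + s - 1 + 1) (mem_range.1 ha) g x m
  rw [P.graft_apply x m, map_sum, sum_congr rfl h1, sum_add_distrib, ← graft_apply, ← smul_sum,
    P.sum_markedInsertion _ (by omega), graft_apply _ (P.insertion (p + s - 1) x g)]
  rfl

theorem hom_eq {p r q u n : ℕ} (hu : p + r = u + 1) (x : O p) (f : O r) (m : O q) :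
    P.hom n x f m = ∑ b ∈ range p, ∑ a ∈ range b, P.theta a n (P.cmp b u x f) m := by
  obtain rfl : u = p + r - 1 := by omega
  exact P.hom_apply x f m

/-- When the mark and `f` both lie in `g`, the input of `x` that holds `g` is arbitrary. By
`theta_theta` it acts as the root of the subtree formed by `x` and `m`, so the sum over it is `graft
x m`. -/
theorem sum_theta_cmp_cmp {p r q s w N : ℕ} (hw : p + r + s = w + 2) (hN : w + q = N + 1)
    (x : O p) (f : O r) (g : O s) (m : O q) :
    ∑ k ∈ range p, ∑ b ∈ range s, ∑ a ∈ range b,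
        P.theta (k + a) N (P.cmp k w x (P.cmp b (r + s - 1) g f)) m =
      -(koszul K p r * koszul K p s) • P.hom N g f (P.graft (p + q - 1) x m) := by
  rcases Nat.eq_zero_or_pos s with rfl | hs
  · simp [hom]
  rw [P.hom_eq (by omega : s + r = r + s - 1 + 1), graft_apply, smul_sum, sum_comm]
  refine sum_congr rfl fun b hb => ?_
  rw [sum_comm, smul_sum]
  refine sum_congr rfl fun a ha => ?_
  rw [map_sum, smul_sum]
  refine sum_congr rfl fun k hk => ?_
  rw [mem_range] at hb ha hk
  rw [P.theta_theta (by omega) (by omega) (by omega : p + (r + s - 1) = w + 1) hk (by omega),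
    smul_smul, ← koszul_add_right (by omega : r + s = r + s - 1 + 1), neg_mul_neg,
    koszul_mul_self, one_smul]

/-- The action of `g` on the homotopy. -/
theorem lie_hom {p r q s v N : ℕ} (hv : v = p + r + q - 2) (hN : p + r + q + s = N + 3)
    (g : O s) (x : O p) (f : O r) (m : O q) :
    P.lie N g (P.hom v x f m) = P.hom N x f (P.insertion (q + s - 1) m g)
      + koszul K q s • (koszul K r s • P.hom N (P.insertion (p + s - 1) x g) f m
        + (koszul K r s * (koszul K p r * koszul K p s)) •
            P.hom N g f (P.graft (p + q - 1) x m)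
        + P.hom N x (P.gbracket (r + s - 1) f g) m) := by
  rcases Nat.eq_zero_or_pos p with rfl | hp
  · simp [hom, graft, insertion]
  have hu : p + r = p + r - 1 + 1 := by omega
  have hw : p + r - 1 + s = p + r + s - 2 + 1 ∨ p + r + s = 1 := by omega
  rcases hw with hw | hw
  swap
  · rw [P.hom_of_le_one (by omega) x, P.hom_of_le_one (by omega) x,
      P.hom_of_le_one (by omega) x, P.hom_of_le_one (by omega) (P.insertion _ x g),
      P.hom_of_le_one (by omega) g]
    simp
  have h1 : P.lie N g (P.hom v x f m) = ∑ b ∈ range p, ∑ a ∈ range b,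
      (P.theta a N (P.cmp b (p + r - 1) x f) (P.insertion (q + s - 1) m g)
        + koszul K q s • P.markedInsertion
            (fun i => (P.theta i (n := p + r + s - 2) N).flip m) (P.cmp b (p + r - 1) x f) a g) := by
    rw [hom_apply, map_sum]
    refine sum_congr rfl fun b hb => ?_
    rw [map_sum]
    refine sum_congr rfl fun a ha => ?_
    rw [mem_range] at hb ha
    exact P.lie_theta (by omega) (by omega) (by omega) (by omega) g _ m
  rw [h1]
  simp only [sum_add_distrib, ← smul_sum]
  rw [← hom_apply, P.sum_sum_markedInsertion _ hu hw (by omega : p + s = p + s - 1 + 1)]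
  simp only [LinearMap.flip_apply]
  rw [P.sum_theta_cmp_cmp (w := p + r + s - 2) (by omega) (by omega), ← P.hom_eq (by omega : p + s - 1 + r = p + r + s - 2 + 1)]
  have h2 : ∀ y : O (r + s - 1), r + s ≠ 0 → ∑ b ∈ range p, ∑ a ∈ range b,
      P.theta a N (P.cmp b (p + r + s - 2) x y) m = P.hom N x y m := fun y h =>
    (P.hom_eq (by omega) x y m).symm
  congr 2
  -- For `r = s = 0` neither of `f` and `g` has an input, so both insertions in the bracket vanish.
  by_cases hrs : r + s = 0
  · rw [gbracket_apply, P.insertion_of_ne (by omega) g f, P.insertion_of_ne (by omega) f g]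
    simp only [map_zero, LinearMap.zero_apply, sum_const_zero, smul_zero, sub_zero, add_zero,
      smul_add, neg_smul, sub_neg_eq_add, smul_smul]
  · rw [h2 _ hrs, h2 _ hrs, gbracket_apply]
    simp only [map_sub, LinearMap.sub_apply, map_smul, LinearMap.smul_apply, smul_sub]
    module

/-- The cocycle property of the homotopy. -/
theorem lie_hom_sub {p r q s N : ℕ} (hN : p + r + q + s = N + 3)
    (g : O s) (x : O p) (f : O r) (m : O q) :
    koszul K q s • (P.lie N g (P.hom (p + r + q - 2) x f m)
        - P.hom N x f (P.lie (q + s - 1) g m))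
      - (koszul K r s * (koszul K p r * koszul K p s) * koszul K q p) •
        (P.lie N x (P.hom (s + r + q - 2) g f m) - P.hom N g f (P.lie (q + p - 1) x m)) =
    koszul K r s • P.hom N (P.gbracket (p + s - 1) x g) f m
      + P.hom N x (P.gbracket (r + s - 1) f g) m
      - (koszul K r s * (koszul K p r * koszul K p s)) •
        P.hom N g (P.gbracket (r + p - 1) f x) m := by
  -- Expanding `hom x f (lie g m)` yields a term in `graft g m`. It cancels the `graft` term of
  -- `lie_hom` with `g` and `x` exchanged, and the two insertions of `x` and `g` combine to their
  -- bracket.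
  rw [P.lie_hom rfl hN, P.lie_hom rfl (by omega), lie_apply, lie_apply, P.gbracket_apply x g,
    show s + p - 1 = p + s - 1 by omega, show p + q - 1 = q + p - 1 by omega,
    show s + q - 1 = q + s - 1 by omega]
  simp only [map_sub, map_smul, LinearMap.sub_apply, LinearMap.smul_apply]
  rw [koszul_comm s q, koszul_comm p q, koszul_comm s r, koszul_comm r p, koszul_comm s p]
  have h1 := koszul_mul_self (K := K) q s
  have h2 := koszul_mul_self (K := K) q p
  have h3 := koszul_mul_self (K := K) r s
  have h4 := koszul_mul_self (K := K) p r
  have h5 := koszul_mul_self (K := K) p s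
  generalize koszul K q s = a at *
  generalize koszul K q p = b at *
  generalize koszul K r s = c at *
  generalize koszul K p r = d at *
  generalize koszul K p s = e at *
  match_scalars
  all_goals grind

end CyclicOperadWithMul

/-! ### Koszul signs of `μ` and `e`, of arities `2` and `0` -/

section Sign

variable {K : Type u} [Field K]

theorem sgn_sub_one (a : ℤ) : sgn K (a - 1) = -sgn K a := by
  rw [sub_eq_add_neg, sgn_add, sgn_odd (a := -1) (by decide), mul_neg_one]

theorem sgn_add_one (a : ℤ) : sgn K (a + 1) = -sgn K a := by
  rw [sgn_add, sgn_odd (a := 1) (by decide), mul_neg_one]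

theorem koszul_two_right (p : ℕ) : koszul K p 2 = -sgn K p := by
  rw [koszul, show ((p : ℤ) - 1) * ((2 : ℕ) - 1) = p - 1 by push_cast; ring, sgn_sub_one]

theorem koszul_two_left (p : ℕ) : koszul K 2 p = -sgn K p := by
  rw [koszul_comm, koszul_two_right]

theorem koszul_zero_right (p : ℕ) : koszul K p 0 = -sgn K p := by
  rw [koszul, ← sgn_sub_one]
  apply sgn_congr
  push_cast
  exact ⟨1 - p, by ring⟩

theorem koszul_zero_left (p : ℕ) : koszul K 0 p = -sgn K p := by
  rw [koszul_comm, koszul_zero_right]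

theorem koszul_succ_left (p q : ℕ) : koszul K (p + 1) q = -sgn K q * koszul K p q := by
  rw [← koszul_two_left, ← koszul_add_left (by omega : 2 + p = p + 1 + 1)]

theorem koszul_succ_right (p q : ℕ) : koszul K q (p + 1) = -sgn K q * koszul K q p := by
  rw [koszul_comm, koszul_succ_left, koszul_comm]

end Sign

/-! ### Compositions with the multiplication and its unit -/

namespace CyclicOperadWithMul

open Finset

variable {K : Type u} [Field K] {O : ℕ → Type v} [∀ n, AddCommGroup (O n)] [∀ n, Module K (O n)]
  (P : CyclicOperadWithMul K O)

theorem t_μ : P.t 2 P.μ = P.μ := by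
  rw [t, LinearMap.smul_apply, P.τ_μ, sgn_even (by decide), one_smul]

theorem cmp_one_left {q : ℕ} (y : O q) : P.cmp 0 q P.one y = y := by
  rw [P.cmp_eq (Nat.add_comm 1 q), P.one_comp]
  simp [sgn_zero]

theorem cmp_one_right {i p : ℕ} (hi : i < p) (y : O p) : P.cmp i p y P.one = y := by
  rw [P.cmp_eq rfl, P.comp_one (i + 1) y (by omega) (by omega)]
  simp [sgn_zero]

theorem cmp_zero_μ_e : P.cmp 0 1 P.μ P.e = P.one := by
  rw [P.cmp_eq (rfl : 2 + 0 = 1 + 1), P.μ_e_left]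
  simp [sgn_zero]

theorem cmp_one_μ_e : P.cmp 1 1 P.μ P.e = -P.one := by
  rw [P.cmp_eq (rfl : 2 + 0 = 1 + 1), P.μ_e_right, sgn_odd (by decide), neg_smul, one_smul]

theorem cmp_zero_μ_μ : P.cmp 0 3 P.μ P.μ = -P.cmp 1 3 P.μ P.μ := by
  rw [P.cmp_eq (rfl : 2 + 2 = 3 + 1), P.cmp_eq (rfl : 2 + 2 = 3 + 1), P.μ_assoc, sgn_even (by decide), sgn_odd (by decide), neg_smul,
    neg_neg, one_smul]

theorem t_cmp_one_μ {n : ℕ} (y : O n) :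
    P.t (n + 1) (P.cmp 1 (n + 1) P.μ y) = P.cmp 0 (n + 1) P.μ y := by
  rw [P.t_cmp (i := 0) (by omega), t_μ]

theorem cmp_last_mul_e {n : ℕ} (y : O n) :
    P.cmp n n (P.cmp 0 (n + 1) P.μ y) P.e = sgn K n • y := by
  have h := P.cmp_cmp_par' (i := 1) (j := 0) (a := n + 1) (n := n) (c := 1) (by omega) (by omega)
    (by omega) (by omega) (by omega) P.μ y P.e
  rw [cmp_one_μ_e, show 1 + n - 1 = n by omega] at h
  rw [h, map_neg, LinearMap.neg_apply, cmp_one_left, koszul_zero_right]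
  module

theorem cmp_first_mul_e {n : ℕ} (y : O n) :
    P.cmp 0 n (P.cmp 1 (n + 1) P.μ y) P.e = -sgn K n • y := by
  rw [P.cmp_cmp_par (i := 1) (j := 0) (c := 1) (by omega) (by omega) (by omega) (by omega)
    (by omega), cmp_zero_μ_e, cmp_one_left, koszul_zero_right]

/-- Since `μ` is invariant under rotation, `e` at its root may be read as `e` at one of its inputs,
and the unit law removes both. -/
theorem theta_mul_e_first {n : ℕ} (y : O n) :
    P.theta 0 n (P.cmp 1 (n + 1) P.μ y) P.e = sgn K n • y := by
  rw [theta_apply, zero_add, pow_one, t_cmp_one_μ]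
  exact P.cmp_last_mul_e y

theorem theta_mul_e_last {n : ℕ} (y : O n) :
    P.theta n n (P.cmp 0 (n + 1) P.μ y) P.e = -sgn K n • y := by
  rw [theta_apply, P.t_pow_cmp_zero (by omega), show n + 1 - 1 - n = 0 by omega,
    t_pow_apply_succ, pow_one, t_μ, t_μ]
  exact P.cmp_first_mul_e y

/-- In the chain `e`, `μ`, `y` the part formed by `e` and `μ` collapses to the operadic unit, so
what remains is a rotation of `y`, the same as in `theta_mul_e_left` but with the opposite sign. -/
theorem theta_mul_e_right {n a : ℕ} (ha : a < n) (y : O n) :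
    P.theta (a + 1) n (P.cmp 1 (n + 1) P.μ y) P.e = sgn K n • P.theta a n y P.one := by
  have h := P.theta_theta (a := 1) (c := a) (v := 1) (w := n + 1) (N := n) (by omega) (by omega)
    (by omega) (by omega) ha P.μ y P.e
  rw [add_comm 1 a, koszul_two_left, neg_neg] at h
  have h1 : P.theta 1 1 P.μ P.e = P.one := by
    rw [theta_apply, t_pow_apply_succ, pow_one, t_μ, t_μ]
    exact P.cmp_zero_μ_e
  rw [← h1, h, smul_smul, sgn_mul_self, one_smul]

theorem theta_mul_e_left {n a : ℕ} (ha : a < n) (y : O n) :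
    P.theta a n (P.cmp 0 (n + 1) P.μ y) P.e = -sgn K n • P.theta a n y P.one := by
  have h := P.theta_theta (a := 0) (c := a) (v := 1) (w := n + 1) (N := n) (by omega) (by omega)
    (by omega) (by omega) ha P.μ y P.e
  rw [zero_add, koszul_two_left, neg_neg] at h
  have h1 : P.theta 0 1 P.μ P.e = -P.one := by
    rw [theta_apply, zero_add, pow_one, t_μ]
    exact P.cmp_one_μ_e
  rw [h1, map_neg] at h
  rw [neg_smul, ← smul_neg, h, smul_smul, sgn_mul_self, one_smul]

theorem insertion_μ {q n : ℕ} (m : O q) :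
    P.insertion n P.μ m = P.cmp 0 n P.μ m + P.cmp 1 n P.μ m := by
  rw [insertion_apply, sum_range_succ, sum_range_one]

/-- Every re-rooting of `μ` is `μ` itself; hence the Lie derivative along `μ` is a bracket, that is,
the differential. -/
theorem graft_μ {q n : ℕ} (m : O q) : P.graft n P.μ m = P.insertion n P.μ m := by
  rw [graft_apply, insertion_μ, sum_range_succ, sum_range_one, theta_apply, theta_apply,
    zero_add, pow_one, t_μ, t_pow_apply_succ, pow_one, t_μ, t_μ, add_comm]

theorem lie_μ {q n : ℕ} (m : O q) : P.lie n P.μ m = P.gbracket n m P.μ := by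
  rw [lie_apply, gbracket_apply, graft_μ, koszul_comm]

theorem insertion_e {q n : ℕ} (m : O q) : P.insertion n P.e m = 0 := by
  simp [insertion]

/-- New roots in `m` contribute rotations of `m` from both composites of `μ` and `m`, with opposite
signs; new roots at the free input of `μ` contribute multiples of `m` that cancel too. This is the
part of `Bb + bB = 0` that involves the outer terms of `b`. -/
theorem graft_insertion_μ_e {q : ℕ} (m : O q) :
    P.graft q (P.insertion (q + 1) P.μ m) P.e = 0 := by
  rw [insertion_μ, map_add, LinearMap.add_apply, graft_apply, graft_apply, sum_range_succ,
    sum_range_succ', theta_mul_e_first, theta_mul_e_last,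
    sum_congr rfl fun a ha => P.theta_mul_e_right (mem_range.1 ha) m,
    sum_congr rfl fun a ha => P.theta_mul_e_left (mem_range.1 ha) m]
  simp only [neg_smul, sum_neg_distrib]
  abel

/-- All terms with both the new root and `f` in `m` cancel. The survivors use the free input of `μ`:
as new root it gives `m{f}`, and as the place of `f` it gives `graft m f`. In the Cartan formula the
former becomes half of the Lie derivative. -/
theorem hom_insertion_μ_e {p q N : ℕ} (h : p + q = N + 1) (m : O q) (f : O p) :
    P.hom N (P.insertion (q + 1) P.μ m) f P.e =
      sgn K N • P.insertion N m f + (sgn K q * sgn K p) • P.graft N m f := by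
  have e1 : ∀ b ∈ range q, ∑ a ∈ range (b + 1),
        P.theta a N (P.cmp (b + 1) (q + p) (P.cmp 1 (q + 1) P.μ m) f) P.e =
      ∑ a ∈ range b, sgn K N • P.theta a N (P.cmp b N m f) P.one + sgn K N • P.cmp b N m f :=
    fun b hb => by
      rw [mem_range] at hb
      have h1 := P.cmp_cmp_seq (i := 1) (j := b) (a := q + 1) (c := N) (n := q + p)
        (by omega) (by omega) (by omega) (by omega) hb P.μ m f
      rw [add_comm 1 b] at h1
      obtain h2 : q + p = N + 1 := by omega
      rw [h1, h2, sum_range_succ', theta_mul_e_first]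
      congr 1
      refine sum_congr rfl fun a ha => ?_
      rw [mem_range] at ha
      rw [theta_mul_e_right _ (by omega)]
  have e2 : ∀ b ∈ range q, ∑ a ∈ range b,
        P.theta a N (P.cmp b (q + p) (P.cmp 0 (q + 1) P.μ m) f) P.e =
      ∑ a ∈ range b, -sgn K N • P.theta a N (P.cmp b N m f) P.one := fun b hb => by
    rw [mem_range] at hb
    have h1 := P.cmp_cmp_seq (i := 0) (j := b) (a := q + 1) (c := N) (n := q + p)
      (by omega) (by omega) (by omega) (by omega) hb P.μ m f
    rw [zero_add] at h1
    obtain h2 : q + p = N + 1 := by omega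
    rw [h1, h2]
    refine sum_congr rfl fun a ha => ?_
    rw [mem_range] at ha
    rw [theta_mul_e_left _ (by omega)]
  have e3 : ∀ a ∈ range q, P.theta a N (P.cmp q (q + p) (P.cmp 0 (q + 1) P.μ m) f) P.e =
      (sgn K q * sgn K p) • P.theta a N m f := fun a ha => by
    rw [mem_range] at ha
    have h1 := P.cmp_cmp_par' (i := 1) (j := 0) (a := q + 1) (c := p + 1) (n := q + p)
      (by omega) (by omega) (by omega) (by omega) (by omega) P.μ m f
    have h2 := P.theta_theta (a := 0) (c := a) (v := p) (w := q + p) (N := N) (by omega)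
      (by omega) (by omega) (by omega) ha (P.cmp 1 (p + 1) P.μ f) m P.e
    rw [theta_mul_e_first, zero_add] at h2
    rw [show 1 + q - 1 = q by omega] at h1
    rw [h1, map_smul, LinearMap.smul_apply]
    rw [koszul_succ_left, map_smul, koszul_comm p q] at h2
    have h3 := congrArg (fun z => (sgn K (q : ℤ)) • z) h2
    simp only [smul_smul] at h3
    rw [h3]
    congr 1
    linear_combination (-koszul K q p) * sgn_mul_self (K := K) (q : ℤ)
  rw [insertion_μ, map_add, LinearMap.add_apply, LinearMap.add_apply,
    P.hom_eq (by omega : q + 1 + p = q + p + 1), P.hom_eq (by omega : q + 1 + p = q + p + 1),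
    sum_range_succ, sum_congr rfl e2, sum_congr rfl e3, sum_range_succ', sum_congr rfl e1,
    sum_add_distrib, ← smul_sum, ← smul_sum, ← insertion_apply, ← graft_apply]
  simp only [range_zero, sum_empty, add_zero, neg_smul, sum_neg_distrib]
  abel

/-- The cup product; on suspended compositions it carries a sign. -/
def cup {p q : ℕ} (n : ℕ) : O p →ₗ[K] O q →ₗ[K] O n :=
  -sgn K (q : ℤ) • (P.cmp 0 n ∘ₗ P.cmp 1 (q + 1) P.μ).flip

theorem cup_apply {p q n : ℕ} (φ : O p) (ψ : O q) :
    P.cup n φ ψ = -sgn K (q : ℤ) • P.cmp 0 n (P.cmp 1 (q + 1) P.μ ψ) φ := rfl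

theorem cup_of_ne {p q n : ℕ} (h : p + q ≠ n) (φ : O p) (ψ : O q) : P.cup n φ ψ = 0 := by
  rw [cup_apply, P.cmp_of_ne (by omega), smul_zero]

theorem cup_eq {p q n : ℕ} (h : p + q = n) (φ : O p) (ψ : O q) :
    P.cup n φ ψ = P.cupProd h φ ψ := by
  rw [cup_apply, P.cmp_eq (by omega), P.cmp_eq (by omega), cupProd]
  simp only [map_smul, LinearMap.smul_apply, smul_smul]
  rw [← sgn_sub_one, ← sgn_add, ← sgn_add, sgn_even, one_smul]
  push_cast
  exact ⟨(q : ℤ) - 1, by ring⟩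

/-- The new root is an input of `f` or of `m`. In either case `e` and `μ` collapse and the remaining
factor is left glued at the root. The first kind supplies the other half of the Lie derivative; the
second cancels the `graft` term of `hom_insertion_μ_e`. -/
theorem graft_cup_e {p q N : ℕ} (h : p + q = N + 1) (f : O p) (m : O q) :
    P.graft N (P.cup (p + q) f m) P.e =
      (-sgn K p * koszul K p q) • P.graft N f m + sgn K p • P.graft N m f := by
  have e1 : ∀ a ∈ range p, P.theta a N (P.cmp 0 (p + q) (P.cmp 1 (q + 1) P.μ m) f) P.e =
      (sgn K p * sgn K q * koszul K p q) • P.theta a N f m := fun a ha => by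
    rw [mem_range] at ha
    have h2 := P.theta_theta (a := 0) (c := a) (v := q) (w := p + q) (N := N) (by omega)
      (by omega) (by omega) (by omega) ha (P.cmp 1 (q + 1) P.μ m) f P.e
    rw [theta_mul_e_first, zero_add, koszul_succ_left, map_smul, koszul_comm q p] at h2
    have h3 := congrArg (fun z => (sgn K (p : ℤ) * koszul K p q) • z) h2
    simp only [smul_smul] at h3
    rw [mul_right_comm, h3]
    rw [show sgn K (p : ℤ) * koszul K p q * -(-sgn K (p : ℤ) * koszul K p q) =
      (sgn K (p : ℤ) * sgn K (p : ℤ)) * (koszul K p q * koszul K p q) by ring, sgn_mul_self,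
      koszul_mul_self, one_mul, one_smul]
  have e2 : ∀ c ∈ range q,
      P.theta (p + c) N (P.cmp 0 (p + q) (P.cmp 1 (q + 1) P.μ m) f) P.e =
      (-sgn K q * sgn K p) • P.theta c N m f := fun c hc => by
    rw [mem_range] at hc
    have h1 := P.cmp_cmp_par (i := 1) (j := 0) (a := q + 1) (c := p + 1) (n := p + q)
      (by omega) (by omega) (by omega) (by omega) (by omega) P.μ m f
    have h2 := P.theta_theta (a := p) (c := c) (v := p) (w := p + q) (N := N) (by omega)
      (by omega) (by omega) (by omega) hc (P.cmp 0 (p + 1) P.μ f) m P.e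
    rw [theta_mul_e_last, koszul_succ_left, map_smul] at h2
    rw [show 1 + p - 1 = p by omega] at h1
    rw [h1, map_smul, LinearMap.smul_apply]
    have h3 := congrArg (fun z => (sgn K (q : ℤ)) • z) h2
    simp only [smul_smul] at h3
    rw [neg_mul, ← mul_neg, h3]
    congr 1
    rw [koszul_comm]
    linear_combination (-koszul K p q) * sgn_mul_self (K := K) (q : ℤ)
  rw [graft_apply, sum_range_add, cup_apply]
  simp only [map_smul, LinearMap.smul_apply]
  rw [← smul_sum, ← smul_sum, sum_congr rfl e1, sum_congr rfl e2, ← smul_sum, ← smul_sum,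
    ← graft_apply, ← graft_apply, smul_smul, smul_smul]
  congr 2
  · linear_combination (-sgn K (p : ℤ) * koszul K p q) * sgn_mul_self (K := K) (q : ℤ)
  · linear_combination (sgn K (p : ℤ)) * sgn_mul_self (K := K) (q : ℤ)

/-- The only pair of inputs of `μ` has the new root first and `f` second, and one rotation turns
this into a product. -/
theorem hom_μ {p q n : ℕ} (h : p + q = n) (f : O p) (m : O q) :
    P.hom n P.μ f m = (-sgn K q * koszul K p q) • P.cup n f m := by
  have h1 := P.cmp_cmp_par' (i := 1) (j := 0) (a := p + 1) (c := q + 1) (n := n)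
      (by omega) (by omega) (by omega) (by omega) (by omega) P.μ f m
  rw [P.hom_eq (by omega : 2 + p = p + 1 + 1), sum_range_succ, sum_range_one, sum_range_one,
    range_zero, sum_empty, zero_add, theta_apply, zero_add, pow_one, t_cmp_one_μ]
  rw [show 1 + p - 1 = p by omega] at h1
  rw [show p + 1 - 1 - 0 = p by omega, h1, cup_apply, smul_smul]
  congr 1
  linear_combination (-koszul K p q) * sgn_mul_self (K := K) (q : ℤ)

end CyclicOperadWithMul

namespace CyclicOperadWithMul

open Finset

variable {K : Type u} [Field K] {O : ℕ → Type v} [∀ n, AddCommGroup (O n)] [∀ n, Module K (O n)]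
  (P : CyclicOperadWithMul K O)

/-! ### The Lie bracket -/

theorem gbracket_of_ne {p q n : ℕ} (h : p + q ≠ n + 1) (φ : O p) (ψ : O q) :
    P.gbracket n φ ψ = 0 := by
  rw [gbracket_apply, P.insertion_of_ne h, P.insertion_of_ne (by omega), smul_zero, sub_zero]

theorem gbracket_antisymm {p q n : ℕ} (φ : O p) (ψ : O q) :
    P.gbracket n ψ φ = -(koszul K p q • P.gbracket n φ ψ) := by
  rw [gbracket_apply, gbracket_apply, smul_sub, smul_smul, koszul_comm q p, koszul_mul_self]
  module

theorem gbracket_gbracket_left {p q r a n : ℕ} (ha : a = p + q - 1) (φ : O p) (ψ : O q) (χ : O r) :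
    P.gbracket n (P.gbracket a φ ψ) χ =
      P.insertion n (P.insertion a φ ψ) χ - koszul K p q • P.insertion n (P.insertion a ψ φ) χ
      - (koszul K p r * koszul K q r) • (P.insertion n χ (P.insertion a φ ψ)
        - koszul K p q • P.insertion n χ (P.insertion a ψ φ)) := by
  by_cases h : p + q = a + 1
  · rw [P.gbracket_apply (P.gbracket a φ ψ), P.gbracket_apply φ, koszul_add_left h]
    simp only [map_sub, map_smul, LinearMap.sub_apply, LinearMap.smul_apply]
  · rw [P.gbracket_of_ne h, P.insertion_of_ne h, P.insertion_of_ne (p := q) (by omega)]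
    simp

/-- A signed combination of three pre-Lie identities. The arguments are reversed because the Lie
bracket of the calculus is the opposite of the Gerstenhaber bracket. -/
theorem gbracket_jacobi {p q r a b c n : ℕ} (ha : a = p + q - 1) (hb : b = q + r - 1)
    (hc : c = p + r - 1) (φ : O p) (ψ : O q) (χ : O r) :
    P.gbracket n (P.gbracket b χ ψ) φ =
      P.gbracket n χ (P.gbracket a ψ φ)
      + koszul K p q • P.gbracket n (P.gbracket c χ φ) ψ := by
  have e : P.gbracket n χ (P.gbracket a ψ φ) =
      -(koszul K p r * koszul K q r) • P.gbracket n (P.gbracket a ψ φ) χ := by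
    by_cases h : p + q = a + 1
    · rw [gbracket_antisymm, koszul_add_left h, neg_smul]
    · rw [P.gbracket_of_ne (p := q) (by omega)]
      simp
  have h1 := P.insertion_prelie (n := n) ha hc (by omega : b = q + r - 1) φ ψ χ
  have h2 := P.insertion_prelie (n := n) (by omega : a = q + p - 1) hb hc ψ φ χ
  have h3 := P.insertion_prelie (n := n) (by omega : c = r + p - 1) (by omega : b = r + q - 1) ha
    χ φ ψ
  rw [e, P.gbracket_gbracket_left (by omega), P.gbracket_gbracket_left (by omega),
    P.gbracket_gbracket_left (by omega)]
  have k1 := koszul_mul_self (K := K) p q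
  have k2 := koszul_mul_self (K := K) p r
  have k3 := koszul_mul_self (K := K) q r
  rw [koszul_comm q p, koszul_comm r p, koszul_comm r q]
  generalize koszul K p q = x at *
  generalize koszul K p r = y at *
  generalize koszul K q r = z at *
  rw [sub_eq_iff_eq_add] at h1 h2 h3
  rw [h1, h2, h3]
  match_scalars
  all_goals grind

/-- Associativity of `μ`: with the suspension sign its two self-compositions are opposite. -/
theorem gbracket_μ_μ (n : ℕ) : P.gbracket n P.μ P.μ = 0 := by
  have : P.insertion n P.μ P.μ = 0 := by
    by_cases h : n = 3
    · subst h
      rw [insertion_μ, cmp_zero_μ_μ, neg_add_cancel]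
    · exact P.insertion_of_ne (by omega) _ _
  rw [gbracket_apply, this, smul_zero, sub_zero]

/-- The differential of the dg Lie algebra. -/
def diff {p : ℕ} (n : ℕ) : O p →ₗ[K] O n := (P.gbracket n).flip P.μ

theorem diff_apply {p n : ℕ} (φ : O p) : P.diff n φ = P.gbracket n φ P.μ := rfl

theorem diff_of_ne {p n : ℕ} (h : p + 1 ≠ n) (φ : O p) : P.diff n φ = 0 :=
  P.gbracket_of_ne (by omega) _ _

/-- Jacobi with two entries `μ` gives twice the claim, and `2` is invertible. -/
theorem diff_diff [CharZero K] {p n : ℕ} (φ : O p) : P.diff n (P.diff (p + 1) φ) = 0 := by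
  have h := P.gbracket_jacobi (a := 3) (b := p + 1) (c := p + 1) (n := n) (p := 2) (q := 2)
    (by omega) (by omega) (by omega) P.μ P.μ φ
  rw [gbracket_μ_μ, map_zero, zero_add, koszul_two_left, sgn_even (by decide)] at h
  have h2 : (2 : K) • P.diff n (P.diff (p + 1) φ) = 0 := by
    rw [two_smul, diff_apply, diff_apply]
    nth_rewrite 1 [h]
    module
  exact (smul_eq_zero.1 h2).resolve_left two_ne_zero

theorem diff_gbracket {p r a n : ℕ} (ha : a = p + r - 1) (φ : O p) (ψ : O r) :
    P.diff n (P.gbracket a ψ φ) =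
      P.gbracket n ψ (P.diff (p + 1) φ)
      + -sgn K p • P.gbracket n (P.diff (r + 1) ψ) φ := by
  have h := P.gbracket_jacobi (a := p + 1) (b := a) (c := r + 1) (n := n) (p := 2) (q := p)
    (by omega) (by omega) (by omega) P.μ φ ψ
  rw [koszul_two_left] at h
  exact h

theorem diff_eq {p : ℕ} (φ : O p) : P.diff (p + 1) φ =
    P.insertion (p + 1) φ P.μ + sgn K p • P.insertion (p + 1) P.μ φ := by
  rw [diff_apply, gbracket_apply, koszul_two_right]
  module

/-! ### The cup product -/

/-- After both products are flattened, this is the associativity of `μ` with `f`, `g`, `h` at its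
three inputs. -/
theorem cup_assoc {p q r n : ℕ} (f : O p) (g : O q) (h : O r) :
    P.cup n (P.cup (p + q) f g) h = P.cup n f (P.cup (q + r) g h) := by
  by_cases hn : p + q + r = n
  swap
  · rw [P.cup_of_ne hn, P.cup_of_ne (by omega)]
  subst hn
  have h1 : P.cmp 0 (r + 2) (P.cmp 1 (r + 1) P.μ h) P.μ =
      sgn K r • P.cmp 1 (r + 2) P.μ (P.cmp 1 (r + 1) P.μ h) := by
    rw [P.cmp_cmp_par (i := 1) (j := 0) (c := 3) (by omega) (by omega) (by omega) (by omega)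
      (by omega), cmp_zero_μ_μ, koszul_two_right,
      ← P.cmp_cmp_seq (i := 1) (j := 1) (a := 3) (by omega) (by omega) (by omega) (by omega)
      (by omega)]
    simp
  have h2 : P.cmp 0 (p + q + r) (P.cmp 1 (r + 1) P.μ h) (P.cmp 0 (p + q) (P.cmp 1 (q + 1) P.μ g) f)
      = sgn K r • P.cmp 0 (p + q + r)
        (P.cmp 1 (q + r + 1) P.μ (P.cmp 0 (q + r) (P.cmp 1 (r + 1) P.μ h) g)) f := by
    rw [← P.cmp_cmp_seq (i := 0) (j := 0) (a := q + r + 1) (by omega) (by omega) (by omega)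
      (by omega) (by omega),
      ← P.cmp_cmp_seq (i := 0) (j := 1) (a := r + 2) (by omega) (by omega) (by omega)
      (by omega) (by omega), h1, map_smul, LinearMap.smul_apply,
      P.cmp_cmp_seq (i := 1) (j := 0) (a := r + 2) (c := q + r) (by omega) (by omega) (by omega)
      (by omega) (by omega), map_smul, LinearMap.smul_apply]
  simp only [cup_apply, map_smul, LinearMap.smul_apply]
  rw [h2]
  simp only [smul_smul]
  congr 1
  push_cast
  rw [sgn_add]
  ring

theorem e_cup {p : ℕ} (f : O p) : P.cup p P.e f = f := by
  rw [cup_apply, cmp_first_mul_e, smul_smul, neg_mul_neg, sgn_mul_self, one_smul]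

theorem cup_e {p : ℕ} (f : O p) : P.cup p f P.e = f := by
  rw [cup_apply, cmp_one_μ_e, map_neg, LinearMap.neg_apply, cmp_one_left]
  simp [sgn_zero]

/-- Inserting `μ` into the product gives the inner terms. Of the outer terms, `hB` and `hC` match
the two extreme products with `μ` outside, while `hA` identifies the two middle ones, which cancel.
-/
theorem diff_cup {p q n : ℕ} (f : O p) (g : O q) :
    P.diff n (P.cup (p + q) f g) =
      P.cup n (P.diff (p + 1) f) g + sgn K p • P.cup n f (P.diff (q + 1) g) := by
  by_cases hn : n = p + q + 1
  swap
  · rw [P.diff_of_ne (by omega), P.cup_of_ne (by omega), P.cup_of_ne (by omega), smul_zero,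
      add_zero]
  subst hn
  have h1 : P.cmp 0 (q + 2) (P.cmp 1 (q + 1) P.μ g) P.μ =
      sgn K q • P.cmp 1 (q + 2) P.μ (P.cmp 1 (q + 1) P.μ g) := by
    rw [P.cmp_cmp_par (i := 1) (j := 0) (c := 3) (by omega) (by omega) (by omega) (by omega)
      (by omega), cmp_zero_μ_μ, koszul_two_right,
      ← P.cmp_cmp_seq (i := 1) (j := 1) (a := 3) (by omega) (by omega) (by omega) (by omega)
      (by omega)]
    simp
  have hA : P.cmp 0 (p + q + 1) (P.cmp 1 (q + 1) P.μ g) (P.cmp 0 (p + 1) P.μ f) =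
      sgn K q • P.cmp 0 (p + q + 1) (P.cmp 1 (q + 2) P.μ (P.cmp 1 (q + 1) P.μ g)) f := by
    rw [← P.cmp_cmp_seq (i := 0) (j := 0) (a := q + 2) (by omega) (by omega) (by omega)
      (by omega) (by omega), h1, map_smul, LinearMap.smul_apply]
  have hB : P.cmp 0 (p + q + 1) (P.cmp 1 (q + 1) P.μ g) (P.cmp 1 (p + 1) P.μ f) =
      sgn K q • P.cmp 1 (p + q + 1) P.μ (P.cmp 0 (p + q) (P.cmp 1 (q + 1) P.μ g) f) := by
    rw [← P.cmp_cmp_seq (i := 0) (j := 1) (a := q + 2) (by omega) (by omega) (by omega)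
      (by omega) (by omega), h1, map_smul, LinearMap.smul_apply,
      ← P.cmp_cmp_seq (i := 1) (j := 0) (a := q + 2) (by omega) (by omega) (by omega)
      (by omega) (by omega)]
  have hC : P.cmp 0 (p + q + 1) P.μ (P.cmp 0 (p + q) (P.cmp 1 (q + 1) P.μ g) f) =
      -P.cmp 0 (p + q + 1) (P.cmp 1 (q + 2) P.μ (P.cmp 0 (q + 1) P.μ g)) f := by
    rw [← P.cmp_cmp_seq (i := 0) (j := 0) (a := q + 2) (by omega) (by omega) (by omega)
      (by omega) (by omega),
      ← P.cmp_cmp_seq (i := 0) (j := 1) (a := 3) (by omega) (by omega) (by omega)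
      (by omega) (by omega), cmp_zero_μ_μ, map_neg, LinearMap.neg_apply,
      P.cmp_cmp_seq (i := 1) (j := 0) (a := 3) (c := q + 1) (by omega) (by omega) (by omega)
      (by omega) (by omega), map_neg, LinearMap.neg_apply]
  have hY : P.insertion (p + q + 1) (P.cmp 0 (p + q) (P.cmp 1 (q + 1) P.μ g) f) P.μ =
      P.cmp 0 (p + q + 1) (P.cmp 1 (q + 1) P.μ g) (P.insertion (p + 1) f P.μ)
      + -sgn K p • P.cmp 0 (p + q + 1) (P.cmp 1 (q + 2) P.μ (P.insertion (q + 1) g P.μ)) f := by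
    rw [P.insertion_cmp (c := q + 2) (by omega) (by omega) (by omega) (by omega), koszul_two_right,
      range_zero, sum_empty, zero_add, show p + 2 - 1 = p + 1 by omega]
    congr 2
    have h2 := P.cmp_insertion (i := 1) (a := q + 1) (n := q + 2) (by omega) (by omega) (by omega)
      P.μ g P.μ
    rw [show q + 2 - 1 = q + 1 by omega] at h2
    rw [← h2, map_sum, LinearMap.sum_apply]
    exact sum_congr rfl fun k _ => by rw [zero_add]
  rw [diff_eq, diff_eq, diff_eq]
  simp only [cup_apply, map_add, map_smul, LinearMap.add_apply, LinearMap.smul_apply, insertion_μ]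
  rw [hY, hA, hB, hC]
  have s1 := sgn_mul_self (K := K) (p : ℤ)
  have s2 := sgn_mul_self (K := K) (q : ℤ)
  push_cast
  rw [sgn_add_one, sgn_add]
  generalize sgn K (p : ℤ) = x at *
  generalize sgn K (q : ℤ) = y at *
  match_scalars
  all_goals grind

end CyclicOperadWithMul

namespace CyclicOperadWithMul

open Finset

variable {K : Type u} [Field K] {O : ℕ → Type v} [∀ n, AddCommGroup (O n)] [∀ n, Module K (O n)]
  (P : CyclicOperadWithMul K O)

/-! ### Normalised elements -/

theorem mem_bar_iff {p : ℕ} (φ : O p) :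
    φ ∈ P.bar p ↔ ∀ i n : ℕ, P.cmp i n φ P.e = 0 := by
  constructor
  · intro h i n
    by_cases hn : p + 0 = n + 1
    · by_cases hi : i < p
      · rw [P.cmp_eq hn, h (i + 1) n hn (by omega) (by omega), smul_zero]
      · exact P.cmp_of_le (by omega) _ _
    · exact P.cmp_of_ne hn _ _
  · intro h i n hn h1 h2
    obtain ⟨j, rfl⟩ : ∃ j, i = j + 1 := ⟨i - 1, by omega⟩
    have h3 := h j n
    rw [P.cmp_eq hn] at h3
    have h4 := congrArg (fun z => sgn K (((0 : ℕ) - 1 : ℤ) * j) • z) h3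
    simpa [smul_smul, sgn_mul_self] using h4

theorem mem_bar_zero (φ : O 0) : φ ∈ P.bar 0 :=
  (P.mem_bar_iff φ).2 fun i _ => P.cmp_of_le (Nat.zero_le i) _ _

/-- Input `i` is occupied by `ψ`, so `φ` need not be annihilated there. This matters for `theta`,
where the occupied input is the former root, and for the product, where it is a free input of `μ`.
-/
theorem cmp_mem_bar_of {i p q n : ℕ} {φ : O p} {ψ : O q}
    (hφ : ∀ k c, k ≠ i → P.cmp k c φ P.e = 0) (hψ : ψ ∈ P.bar q) : P.cmp i n φ ψ ∈ P.bar n := by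
  rw [mem_bar_iff] at hψ ⊢
  intro k c
  by_cases h : p + q = n + 1 ∧ i < p ∧ n = c + 1
  swap
  · by_cases h1 : p + q = n + 1
    · by_cases h2 : i < p
      · exact P.cmp_of_ne (by omega) _ _
      · rw [P.cmp_of_le (not_lt.1 h2), map_zero, LinearMap.zero_apply]
    · rw [P.cmp_of_ne h1, map_zero, LinearMap.zero_apply]
  obtain ⟨h1, h2, h3⟩ := h
  rcases lt_or_ge k i with hk | hk
  · rw [P.cmp_cmp_par (c := p - 1) h1 (by omega) (by omega) hk h2, hφ k _ (by omega)]
    simp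
  rcases lt_or_ge k (i + q) with hk' | hk'
  · obtain ⟨j, rfl⟩ : ∃ j, k = i + j := ⟨k - i, by omega⟩
    rw [P.cmp_cmp_seq (c := q - 1) h1 (by omega) (by omega) h2 (by omega), hψ, map_zero]
  · obtain ⟨j, rfl, hij⟩ : ∃ j, k = j + q - 1 ∧ i < j := ⟨k + 1 - q, by omega, by omega⟩
    by_cases hj : j < p
    · rw [P.cmp_cmp_par' (c := p - 1) h1 (by omega) (by omega) hij hj, hφ j _ (by omega)]
      simp
    · exact P.cmp_of_le (by omega) _ _

theorem cmp_mem_bar {i p q n : ℕ} {φ : O p} {ψ : O q} (hφ : φ ∈ P.bar p) (hψ : ψ ∈ P.bar q) :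
    P.cmp i n φ ψ ∈ P.bar n :=
  P.cmp_mem_bar_of (fun k c _ => (P.mem_bar_iff φ).1 hφ k c) hψ

/-- Every input of the rotated element other than the former root is an input of `y`. -/
theorem t_pow_cmp_e {a k n c : ℕ} (ha : a < n) (hk : k ≠ n - 1 - a) {y : O n}
    (hy : y ∈ P.bar n) : P.cmp k c ((P.t n ^ (a + 1)) y) P.e = 0 := by
  rw [mem_bar_iff] at hy
  by_cases hkn : k < n
  swap
  · exact P.cmp_of_le (by omega) _ _
  rcases lt_or_ge k (n - 1 - a) with h | h
  · rw [← P.t_pow_cmp (by omega), hy, map_zero]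
  · have h1 := P.t_pow_cmp_wrap (n := c) (k := a + k - n) (l := n - 1 - k) (by omega) y P.e
    rw [hy, map_zero, show n - 1 - (n - 1 - k) = k by omega,
      show a + k - n + 2 + (n - 1 - k) = a + 1 by omega] at h1
    exact h1.symm

theorem theta_mem_bar {a n q N : ℕ} (ha : a < n) {y : O n} {m : O q} (hy : y ∈ P.bar n)
    (hm : m ∈ P.bar q) : P.theta a N y m ∈ P.bar N :=
  P.cmp_mem_bar_of (fun _ _ hk => P.t_pow_cmp_e ha hk hy) hm

theorem insertion_mem_bar {p q n : ℕ} {φ : O p} {ψ : O q} (hφ : φ ∈ P.bar p)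
    (hψ : ψ ∈ P.bar q) : P.insertion n φ ψ ∈ P.bar n := by
  rw [insertion_apply]
  exact sum_mem fun i _ => P.cmp_mem_bar hφ hψ

theorem graft_mem_bar {p q n : ℕ} {φ : O p} {m : O q} (hφ : φ ∈ P.bar p)
    (hm : m ∈ P.bar q) : P.graft n φ m ∈ P.bar n := by
  rw [graft_apply]
  exact sum_mem fun a ha => P.theta_mem_bar (mem_range.1 ha) hφ hm

theorem gbracket_mem_bar {p q n : ℕ} {φ : O p} {ψ : O q} (hφ : φ ∈ P.bar p)
    (hψ : ψ ∈ P.bar q) : P.gbracket n φ ψ ∈ P.bar n :=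
  sub_mem (P.insertion_mem_bar hφ hψ) (Submodule.smul_mem _ _ (P.insertion_mem_bar hψ hφ))

theorem lie_mem_bar {p q n : ℕ} {φ : O p} {m : O q} (hφ : φ ∈ P.bar p)
    (hm : m ∈ P.bar q) : P.lie n φ m ∈ P.bar n :=
  sub_mem (P.insertion_mem_bar hm hφ) (Submodule.smul_mem _ _ (P.graft_mem_bar hφ hm))

theorem hom_mem_bar {p r q n : ℕ} {x : O p} {f : O r} {m : O q} (hx : x ∈ P.bar p)
    (hf : f ∈ P.bar r) (hm : m ∈ P.bar q) : P.hom n x f m ∈ P.bar n := by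
  by_cases h : p + r + q = n + 2
  swap
  · rw [P.hom_of_ne h]; exact zero_mem _
  rw [hom_apply]
  refine sum_mem fun b hb => sum_mem fun a ha => ?_
  rw [mem_range] at hb ha
  exact P.theta_mem_bar (by omega) (P.cmp_mem_bar hx hf) hm

theorem cup_mem_bar {p q n : ℕ} {φ : O p} {ψ : O q} (hφ : φ ∈ P.bar p)
    (hψ : ψ ∈ P.bar q) : P.cup n φ ψ ∈ P.bar n := by
  rw [mem_bar_iff] at hψ
  rw [cup_apply]
  refine Submodule.smul_mem _ _ (P.cmp_mem_bar_of (fun k c hk => ?_) hφ)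
  by_cases hc : q = c
  swap
  · exact P.cmp_of_ne (by omega) _ _
  subst hc
  by_cases hkq : k < q + 1
  swap
  · exact P.cmp_of_le (by omega) _ _
  obtain ⟨j, rfl⟩ : ∃ j, k = 1 + j := ⟨k - 1, by omega⟩
  rw [P.cmp_cmp_seq (c := q - 1) (by omega) (by omega) (by omega) (by omega) (by omega), hψ,
    map_zero]

theorem diff_mem_bar {p n : ℕ} {φ : O p} (hφ : φ ∈ P.bar p) : P.diff n φ ∈ P.bar n := by
  by_cases hn : p + 1 = n
  swap
  · rw [P.diff_of_ne hn]; exact zero_mem _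
  subst hn
  rw [mem_bar_iff] at hφ ⊢
  intro k c
  by_cases hc : p = c
  swap
  · exact P.cmp_of_ne (by omega) _ _
  subst hc
  by_cases hk : k ≤ p
  swap
  · exact P.cmp_of_le (by omega) _ _
  -- Only the insertions of `μ` that meet `e` survive, and the unit laws give `φ` and `-φ`. The sum
  -- telescopes, and the terms with `μ` outside compensate at the two ends.
  have h1 : ∀ i ∈ range p, P.cmp k p (P.cmp i (p + 1) φ P.μ) P.e =
      (if i = k then φ else 0) - (if i + 1 = k then φ else 0) := fun i hi => by
    rw [mem_range] at hi
    rcases lt_trichotomy k i with h | rfl | h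
    · rw [P.cmp_cmp_par (c := p - 1) (by omega) (by omega) (by omega) h hi, hφ,
        if_neg (by omega), if_neg (by omega)]
      simp
    · have h2 := P.cmp_cmp_seq (j := 0) (a := p + 1) (c := 1) (n := p) (by omega) (by omega)
        (by omega) hi (by omega) φ P.μ P.e
      rw [add_zero, cmp_zero_μ_e, P.cmp_one_right hi] at h2
      simp [h2]
    · rcases Nat.lt_or_ge (i + 1) k with h' | h'
      · obtain ⟨j, rfl⟩ : ∃ j, k = j + 2 - 1 := ⟨k - 1, by omega⟩
        rw [P.cmp_cmp_par' (c := p - 1) (by omega) (by omega) (by omega) (by omega : i < j)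
          (by omega), hφ, if_neg (by omega), if_neg (by omega)]
        simp
      · obtain rfl : k = i + 1 := by omega
        rw [P.cmp_cmp_seq (j := 1) (a := p + 1) (c := 1) (n := p) (by omega) (by omega)
          (by omega) hi (by omega), cmp_one_μ_e, map_neg, P.cmp_one_right hi]
        simp
  have h2 : P.cmp k p (P.cmp 0 (p + 1) P.μ φ) P.e = if k = p then sgn K p • φ else 0 := by
    split_ifs with h
    · subst h; exact P.cmp_last_mul_e φ
    · have h3 := P.cmp_cmp_seq (i := 0) (j := k) (a := p + 1) (c := p - 1) (n := p) (by omega)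
        (by omega) (by omega) (by omega) (by omega) P.μ φ P.e
      rw [zero_add] at h3
      rw [h3, hφ, map_zero]
  have h3 : P.cmp k p (P.cmp 1 (p + 1) P.μ φ) P.e = if k = 0 then -sgn K p • φ else 0 := by
    split_ifs with h
    · subst h; exact P.cmp_first_mul_e φ
    · obtain ⟨j, rfl⟩ : ∃ j, k = 1 + j := ⟨k - 1, by omega⟩
      rw [P.cmp_cmp_seq (i := 1) (j := j) (a := p + 1) (c := p - 1) (n := p) (by omega)
        (by omega) (by omega) (by omega) (by omega), hφ, map_zero]
  rw [diff_eq, insertion_apply, insertion_μ]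
  simp only [map_add, map_sum, map_smul, LinearMap.add_apply, LinearMap.sum_apply,
    LinearMap.smul_apply]
  rw [sum_congr rfl h1, h2, h3, sum_sub_distrib, sum_ite_eq']
  rcases k with _ | k
  · rcases p with _ | p
    · simp
    · simp [smul_smul, sgn_mul_self]
  · simp only [add_left_inj, sum_ite_eq', mem_range]
    rcases eq_or_lt_of_le hk with h | h
    · subst h
      simp [smul_smul, sgn_mul_self]
    · rw [if_pos h, if_pos (by omega), if_neg (by omega)]
      simp

/-! ### Elements annihilated by plugging `e` into the root -/

/-- Plugging `e` into the root gives zero. -/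
def RootKilled {p : ℕ} (x : O p) : Prop := ∀ n, P.cmp (p - 1) n (P.t p x) P.e = 0

variable {P}

theorem RootKilled.sum {p : ℕ} {ι : Type*} {s : Finset ι} {x : ι → O p}
    (h : ∀ i ∈ s, P.RootKilled (x i)) : P.RootKilled (∑ i ∈ s, x i) := fun n => by
  rw [map_sum, map_sum, LinearMap.sum_apply]
  exact sum_eq_zero fun i hi => h i hi n

/-- Insertion of `f` at an input leaves the root untouched and can be exchanged with plugging `e`
there; the cases only follow what one rotation does to the position of `f`. -/
theorem RootKilled.cmp {i p q n : ℕ} {x : O p} (hx : P.RootKilled x) (f : O q) :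
    P.RootKilled (P.cmp i n x f) := fun c => by
  by_cases h : p + q = n + 1 ∧ i < p ∧ n = c + 1
  swap
  · by_cases h1 : p + q = n + 1
    · by_cases h2 : i < p
      · exact P.cmp_of_ne (by omega) _ _
      · rw [P.cmp_of_le (not_lt.1 h2), map_zero, map_zero, LinearMap.zero_apply]
    · rw [P.cmp_of_ne h1, map_zero, map_zero, LinearMap.zero_apply]
  obtain ⟨h1, h2, h3⟩ := h
  rcases i with _ | i
  · rcases Nat.eq_zero_or_pos q with rfl | hq
    · obtain ⟨k, rfl⟩ : ∃ k, p = k + 2 := ⟨p - 2, by omega⟩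
      obtain rfl : n = k + 1 := by omega
      have e1 := P.t_pow_cmp_zero (n := k + 1) (by omega) x f
      rw [zero_add, pow_one, show k + 2 - 1 = k + 1 by omega] at e1
      have e2 := P.t_pow_cmp (n := k + 1) (l := 1) (i := k) (by omega) (P.t (k + 2) x) P.e
      rw [add_comm 1 k, ← t_pow_apply_succ'] at e2
      have e3 := hx (k + 1)
      rw [show k + 2 - 1 = k + 1 by omega] at e3
      rw [e3, map_zero] at e2
      rw [e1, P.cmp_cmp_par (c := k + 1) (by omega) (by omega) (by omega) (by omega) (by omega),
        show k + 1 - 1 = k by omega, ← e2]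
      simp
    · rw [P.t_cmp_zero (by omega) hq, map_smul, LinearMap.smul_apply,
        show n - 1 = q - 1 + (p - 1) by omega,
        P.cmp_cmp_seq (c := p - 1) (by omega) (by omega) (by omega) (by omega) (by omega), hx,
        map_zero, smul_zero]
  · rw [P.t_cmp h2, show n - 1 = p - 1 + q - 1 by omega,
      P.cmp_cmp_par' (c := p - 1) h1 (by omega) (by omega) (by omega) (by omega), hx]
    simp

/-- The new root is an input of the normalised `y`. -/
theorem rootKilled_theta {a n q N : ℕ} (ha : a < n) {y : O n} (hy : y ∈ P.bar n) (m : O q) :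
    P.RootKilled (P.theta a N y m) := by
  refine RootKilled.cmp (fun c => ?_) m
  rw [mem_bar_iff] at hy
  have h := P.t_pow_cmp_wrap (n := c) (k := a) (l := 0) (by omega) y P.e
  rw [hy, map_zero] at h
  rw [← t_pow_apply_succ]
  exact h.symm

theorem rootKilled_graft {p q n : ℕ} {φ : O p} (hφ : φ ∈ P.bar p) (m : O q) :
    P.RootKilled (P.graft n φ m) := by
  rw [graft_apply]
  exact RootKilled.sum fun a ha => rootKilled_theta (mem_range.1 ha) hφ m

theorem rootKilled_hom {p r q n : ℕ} {x : O p} {f : O r} (hx : x ∈ P.bar p) (hf : f ∈ P.bar r)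
    (m : O q) : P.RootKilled (P.hom n x f m) := by
  rw [hom_apply]
  refine RootKilled.sum fun b hb => RootKilled.sum fun a ha => ?_
  rw [mem_range] at hb ha
  by_cases h : a < p + r - 1
  · exact rootKilled_theta h (P.cmp_mem_bar hx hf) m
  · omega

/-- Here `e` is glued to the old root, precisely the leg at which it is annihilated. -/
theorem RootKilled.theta_e {a n N : ℕ} (ha : a < n) {x : O n} (hx : P.RootKilled x) :
    P.theta a N x P.e = 0 := by
  have h := P.t_pow_cmp (n := N) (i := n - 1 - a) (l := a) (by omega) (P.t n x) P.e
  rw [show a + (n - 1 - a) = n - 1 by omega, hx, map_zero, ← t_pow_apply_succ'] at h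
  exact h.symm

theorem RootKilled.graft_e {p n : ℕ} {x : O p} (hx : P.RootKilled x) :
    P.graft n x P.e = 0 := by
  rw [graft_apply]
  exact sum_eq_zero fun a ha => hx.theta_e (mem_range.1 ha)

theorem RootKilled.hom_e {p r n : ℕ} {x : O p} (hx : P.RootKilled x) (f : O r) :
    P.hom n x f P.e = 0 := by
  rw [hom_apply]
  refine sum_eq_zero fun b hb => sum_eq_zero fun a ha => ?_
  rw [mem_range] at hb ha
  exact RootKilled.theta_e (by omega) (hx.cmp f)

end CyclicOperadWithMul

/-! ### Rewriting the signs of the calculus as Koszul signs -/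

section Sign

variable {K : Type u} [Field K]

theorem sgn_mul_pred (p r : ℕ) : sgn K ((p : ℤ) * ((r : ℤ) - 1)) = -(koszul K p r * sgn K r) := by
  rw [← mul_neg, ← sgn_sub_one, koszul, ← sgn_add]
  congr 1; ring

theorem sgn_mul_add (p r q : ℕ) :
    sgn K ((q : ℤ) * ((p : ℤ) + r)) = koszul K p q * koszul K r q * (sgn K p * sgn K r) := by
  rw [koszul, koszul, ← sgn_add, ← sgn_add, ← sgn_add]
  apply sgn_congr
  exact ⟨(q : ℤ) - 1, by ring⟩

end Sign

namespace CyclicOperadWithMul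

open Finset

variable {K : Type u} [Field K] {O : ℕ → Type v} [∀ n, AddCommGroup (O n)] [∀ n, Module K (O n)]
  (P : CyclicOperadWithMul K O)

/-! ### The calculus operators on a cyclic operad -/

/-- The cochain differential `b`. -/
def cochainDiff {q : ℕ} (n : ℕ) : O q →ₗ[K] O n := -P.diff n

theorem cochainDiff_apply {q n : ℕ} (m : O q) : P.cochainDiff n m = -P.diff n m := rfl

theorem cochainDiff_of_ne {q n : ℕ} (h : q + 1 ≠ n) (m : O q) : P.cochainDiff n m = 0 := by
  rw [cochainDiff_apply, P.diff_of_ne h, neg_zero]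

/-- The cyclic differential `B`. -/
def connes {q : ℕ} (n : ℕ) : O q →ₗ[K] O n := -(P.graft n).flip P.e

theorem connes_apply {q n : ℕ} (m : O q) : P.connes n m = -P.graft n m P.e := rfl

theorem connes_of_ne {q n : ℕ} (h : q ≠ n + 1) (m : O q) : P.connes n m = 0 := by
  rw [connes_apply, P.graft_of_ne (by omega), neg_zero]

/-- The Lie derivative, with the sign of the calculus. -/
def lieDer {p q : ℕ} (n : ℕ) : O p →ₗ[K] O q →ₗ[K] O n := -sgn K (p : ℤ) • P.lie n

theorem lieDer_apply {p q n : ℕ} (f : O p) (m : O q) :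
    P.lieDer n f m = -sgn K (p : ℤ) • P.lie n f m := rfl

theorem lieDer_of_ne {p q n : ℕ} (h : p + q ≠ n + 1) (f : O p) (m : O q) :
    P.lieDer n f m = 0 := by
  rw [lieDer_apply, lie_apply, P.graft_of_ne h, P.insertion_of_ne (by omega)]
  simp

/-- The operator `S`. -/
def cyclicHomotopy {p q : ℕ} (n : ℕ) : O p →ₗ[K] O q →ₗ[K] O n :=
  sgn K (p : ℤ) • (P.hom n).flip.compr₂ (LinearMap.applyₗ P.e)

theorem cyclicHomotopy_apply {p q n : ℕ} (f : O p) (m : O q) :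
    P.cyclicHomotopy n f m = sgn K (p : ℤ) • P.hom n m f P.e := rfl

theorem cyclicHomotopy_of_ne {p q n : ℕ} (h : p + q ≠ n + 2) (f : O p) (m : O q) :
    P.cyclicHomotopy n f m = 0 := by
  rw [cyclicHomotopy_apply, P.hom_of_ne (by omega), smul_zero]

/-- The operator `T`. -/
def gdtHomotopy {p r q : ℕ} (n : ℕ) : O p →ₗ[K] O r →ₗ[K] O q →ₗ[K] O n :=
  sgn K ((q : ℤ) * ((p : ℤ) + r)) • (P.hom n).flip

theorem gdtHomotopy_apply {p r q n : ℕ} (f : O p) (g : O r) (m : O q) :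
    P.gdtHomotopy n f g m = sgn K ((q : ℤ) * ((p : ℤ) + r)) • P.hom n g f m := rfl

theorem gdtHomotopy_of_ne {p r q n : ℕ} (h : p + r + q ≠ n + 2) (f : O p) (g : O r) (m : O q) :
    P.gdtHomotopy n f g m = 0 := by
  rw [gdtHomotopy_apply, P.hom_of_ne (by omega), smul_zero]

theorem gdtHomotopy_eq {p r q n : ℕ} (f : O p) (g : O r) (m : O q) :
    P.gdtHomotopy n f g m =
      (koszul K p q * koszul K r q * (sgn K p * sgn K r)) • P.hom n g f m := by
  rw [gdtHomotopy_apply, sgn_mul_add]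

theorem cochainDiff_cochainDiff [CharZero K] {q n : ℕ} (m : O q) :
    P.cochainDiff n (P.cochainDiff (q + 1) m) = 0 := by
  rw [cochainDiff_apply, cochainDiff_apply, map_neg, diff_diff, neg_zero, neg_zero]

theorem connes_connes {q n : ℕ} {m : O q} (hm : m ∈ P.bar q) :
    P.connes n (P.connes (q - 1) m) = 0 := by
  rw [connes_apply, connes_apply, map_neg, LinearMap.neg_apply, (rootKilled_graft hm P.e).graft_e,
    neg_zero, neg_zero]

theorem connes_cyclicHomotopy {p q n : ℕ} {f : O p} {m : O q} (hf : f ∈ P.bar p)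
    (hm : m ∈ P.bar q) : P.connes n (P.cyclicHomotopy (p + q - 2) f m) = 0 := by
  rw [connes_apply, cyclicHomotopy_apply, map_smul, LinearMap.smul_apply,
    (rootKilled_hom hm hf P.e).graft_e, smul_zero, neg_zero]

theorem cyclicHomotopy_connes {p q n : ℕ} (f : O p) {m : O q} (hm : m ∈ P.bar q) :
    P.cyclicHomotopy n f (P.connes (q - 1) m) = 0 := by
  rw [connes_apply, cyclicHomotopy_apply, map_neg, LinearMap.neg_apply, LinearMap.neg_apply,
    (rootKilled_graft hm P.e).hom_e, neg_zero, smul_zero]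

theorem cochainDiff_eq_lie {q n : ℕ} (m : O q) : P.cochainDiff n m = -P.lie n P.μ m := by
  rw [lie_μ, cochainDiff_apply, diff_apply]

/-- This is `lie_graft` for `g = μ` and `e` at the root: `e` has no inputs, so only the term with
`μ` inserted in `m` remains, and the outer part of the differential is annihilated by
`graft_insertion_μ_e`. -/
theorem connes_cochainDiff {q n : ℕ} (m : O q) :
    P.connes n (P.cochainDiff (q + 1) m) + P.cochainDiff n (P.connes (q - 1) m) = 0 := by
  by_cases hq : q = n
  · subst hq
    have h1 : P.connes q (P.cochainDiff (q + 1) m) =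
        P.graft q (P.insertion (q + 1) m P.μ) P.e := by
      rw [connes_apply, cochainDiff_apply, diff_eq, map_neg, LinearMap.neg_apply, neg_neg, map_add,
        LinearMap.add_apply, map_smul, LinearMap.smul_apply, graft_insertion_μ_e, smul_zero,
        add_zero]
    rw [h1, cochainDiff_eq_lie, connes_apply, map_neg, neg_neg]
    rcases Nat.eq_zero_or_pos q with rfl | hq
    · simp [graft, insertion]
    · rw [P.lie_graft (by omega) (by omega), insertion_e, map_zero, koszul_zero_left,
        sgn_even (by decide), zero_add, show q + 2 - 1 = q + 1 by omega]
      module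
  · rw [P.connes_of_ne (by omega), zero_add]
    by_cases h : q = q - 1 + 1
    · exact P.cochainDiff_of_ne (by omega) _
    · rw [P.connes_of_ne h, map_zero]

/-- The master identity for `μ` acting on `hom m f e`: the action is `bS_f`, insertion of `μ` into
`m` is part of `S_f b`, the bracket is `S_{df}`, and the `graft` term is `ι_f B`. The outer part of
`S_f b` together with `Bι_f` leaves exactly `L_f`. -/
theorem cartan_homotopy {p q n : ℕ} (f : O p) (m : O q) :
    P.lieDer n f m =
      (P.connes n (P.cup (p + q) f m) - sgn K p • P.cup n f (P.connes (q - 1) m))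
      + (P.cochainDiff n (P.cyclicHomotopy (p + q - 2) f m)
        - sgn K p • P.cyclicHomotopy n f (P.cochainDiff (q + 1) m))
      + P.cyclicHomotopy n (P.diff (p + 1) f) m := by
  by_cases h : p + q = n + 1
  swap
  · have h1 : P.cup n f (P.connes (q - 1) m) = 0 := by
      by_cases hq : q = q - 1 + 1
      · exact P.cup_of_ne (by omega) _ _
      · rw [P.connes_of_ne hq, map_zero]
    have h2 : P.cochainDiff n (P.cyclicHomotopy (p + q - 2) f m) = 0 := by
      by_cases hq : p + q = p + q - 2 + 2
      · exact P.cochainDiff_of_ne (by omega) _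
      · rw [P.cyclicHomotopy_of_ne hq, map_zero]
    rw [P.lieDer_of_ne h, P.connes_of_ne h, h1, h2, P.cyclicHomotopy_of_ne (by omega),
      P.cyclicHomotopy_of_ne (by omega)]
    simp
  have H := P.lie_hom (v := p + q - 2) (N := n) (by omega) (by omega) P.μ m f P.e
  have e0 : P.insertion (0 + 2 - 1) P.e P.μ = 0 := insertion_e P P.μ
  rw [e0, map_zero, koszul_two_right, koszul_two_right, koszul_two_right, zero_add,
    show q + 2 - 1 = q + 1 by omega, show p + 2 - 1 = p + 1 by omega, add_zero,
    ← diff_apply] at H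
  -- This identifies the last term of the master identity with the contraction of `B m`.
  have hc : P.cup n f (P.connes (q - 1) m) =
      (sgn K (p : ℤ) * (sgn K (q : ℤ) * koszul K p q)) • P.hom n P.μ f (P.graft (q - 1) m P.e) := by
    rcases Nat.eq_zero_or_pos q with rfl | hq
    · simp [graft, connes]
    · rw [P.hom_μ (by omega), connes_apply, map_neg, smul_smul]
      obtain ⟨k, rfl⟩ : ∃ k, q = k + 1 := ⟨q - 1, by omega⟩
      rw [koszul_succ_right, show k + 1 - 1 = k by omega]
      push_cast
      rw [sgn_add_one]
      have h1 := sgn_mul_self (K := K) (p : ℤ)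
      have h2 := sgn_mul_self (K := K) (k : ℤ)
      have h3 := koszul_mul_self (K := K) p k
      clear H
      rw [← neg_one_smul K]
      congr 1
      grind
  rw [cochainDiff_eq_lie, hc, connes_apply, P.graft_cup_e h]
  simp only [lieDer_apply, P.lie_apply f m, cyclicHomotopy_apply, cochainDiff_apply, P.diff_eq m, map_smul,
    map_neg, map_add]
  rw [H, P.hom_insertion_μ_e h, koszul_comm q p]
  have hn : sgn K (n : ℤ) = -(sgn K (p : ℤ) * sgn K (q : ℤ)) := by
    rw [← sgn_add, ← sgn_sub_one]; congr 1; omega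
  rw [hn]
  push_cast
  rw [sgn_add_one, sgn_zero]
  have h1 := sgn_mul_self (K := K) (p : ℤ)
  have h2 := sgn_mul_self (K := K) (q : ℤ)
  have h3 := koszul_mul_self (K := K) p q
  generalize sgn K (p : ℤ) = x at *
  generalize sgn K (q : ℤ) = y at *
  generalize koszul K p q = z at *
  clear H hc hn
  match_scalars
  all_goals grind

theorem cochainDiff_cup {p q n : ℕ} (f : O p) (m : O q) :
    P.cochainDiff n (P.cup (p + q) f m) - sgn K p • P.cup n f (P.cochainDiff (q + 1) m)
      + P.cup n (P.diff (p + 1) f) m = 0 := by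
  rw [cochainDiff_apply, diff_cup, cochainDiff_apply, map_neg]
  module

/-- The master identity for `g` acting on `hom m f e`. Its `graft` term is `T(f,g)B`, while `B
T(f,g)` vanishes on normalised `f` and `g`. -/
theorem cyclicHomotopy_lieDer {p r q n : ℕ} {f : O p} {g : O r} (hf : f ∈ P.bar p)
    (hg : g ∈ P.bar r) (m : O q) :
    P.cyclicHomotopy n f (P.lieDer (r + q - 1) g m)
      - (koszul K p r * -sgn K r) • P.lieDer n g (P.cyclicHomotopy (p + q - 2) f m)
      - P.cyclicHomotopy n (P.gbracket (p + r - 1) g f) m =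
    P.connes n (P.gdtHomotopy (p + r + q - 2) f g m)
      - (sgn K p * sgn K r) • P.gdtHomotopy n f g (P.connes (q - 1) m) := by
  have hB : P.connes n (P.gdtHomotopy (p + r + q - 2) f g m) = 0 := by
    rw [gdtHomotopy_apply, map_smul, connes_apply, (rootKilled_hom hg hf m).graft_e, neg_zero,
      smul_zero]
  -- Only the insertion half of `lie g m` contributes: the grafted half is annihilated at its root
  -- since `g` is normalised.
  have hL : P.cyclicHomotopy n f (P.lieDer (r + q - 1) g m) =
      -(sgn K p * sgn K r) • P.hom n (P.insertion (r + q - 1) m g) f P.e := by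
    rw [cyclicHomotopy_apply, lieDer_apply, lie_apply]
    simp only [map_sub, map_smul, LinearMap.sub_apply, LinearMap.smul_apply]
    rw [(rootKilled_graft hg m).hom_e]
    module
  by_cases h : p + q + r = n + 3
  swap
  · have h1 : P.lieDer n g (P.cyclicHomotopy (p + q - 2) f m) = 0 := by
      by_cases hq : p + q = p + q - 2 + 2
      · exact P.lieDer_of_ne (by omega) _ _
      · rw [P.cyclicHomotopy_of_ne hq, map_zero]
    have h2 : P.hom n (P.insertion (r + q - 1) m g) f P.e = 0 := by
      by_cases hq : q + r = r + q - 1 + 1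
      · exact P.hom_of_ne (by omega) _ _ _
      · rw [P.insertion_of_ne hq]; simp
    have h3 : P.cyclicHomotopy n (P.gbracket (p + r - 1) g f) m = 0 := by
      by_cases hq : r + p = p + r - 1 + 1
      · exact P.cyclicHomotopy_of_ne (by omega) _ _
      · rw [P.gbracket_of_ne hq]; simp
    have h4 : P.gdtHomotopy n f g (P.connes (q - 1) m) = 0 := by
      by_cases hq : q = q - 1 + 1
      · exact P.gdtHomotopy_of_ne (by omega) _ _ _
      · rw [P.connes_of_ne hq, map_zero]
    rw [hB, hL, h1, h2, h3, h4]
    simp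
  have H := P.lie_hom (v := p + q - 2) (N := n) (by omega) (by omega) g m f P.e
  have e0 : P.insertion (0 + r - 1) P.e g = 0 := insertion_e P g
  rw [e0, map_zero, zero_add, koszul_zero_left, add_zero, show q + r - 1 = r + q - 1 by omega] at H
  have h3 : P.cyclicHomotopy n (P.gbracket (p + r - 1) g f) m =
      (sgn K p * sgn K r * koszul K p r) • P.hom n m (P.gbracket (p + r - 1) f g) P.e := by
    rw [cyclicHomotopy_apply, P.gbracket_antisymm f g]
    by_cases hq : p + r = p + r - 1 + 1
    · have : sgn K ((p + r - 1 : ℕ) : ℤ) = -(sgn K p * sgn K r) := by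
        rw [← sgn_add, ← sgn_sub_one]; congr 1; omega
      rw [this]
      simp only [map_neg, map_smul, LinearMap.neg_apply, LinearMap.smul_apply]
      module
    · rw [P.gbracket_of_ne hq]; simp
  have h4 : P.gdtHomotopy n f g (P.connes (q - 1) m) =
      -(koszul K p q * koszul K r q) • P.hom n g f (P.graft (q - 1) m P.e) := by
    rcases Nat.eq_zero_or_pos q with rfl | hq
    · simp [connes, graft]
    · obtain ⟨k, rfl⟩ : ∃ k, q = k + 1 := ⟨q - 1, by omega⟩
      rw [gdtHomotopy_eq, connes_apply, map_neg, koszul_succ_right, koszul_succ_right,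
        show k + 1 - 1 = k by omega]
      have h1 := sgn_mul_self (K := K) (p : ℤ)
      have h2 := sgn_mul_self (K := K) (r : ℤ)
      match_scalars
      grind
  rw [hB, hL, h3, h4, lieDer_apply, cyclicHomotopy_apply, map_smul, H, koszul_comm q p,
    koszul_comm q r]
  have h1 := sgn_mul_self (K := K) (p : ℤ)
  have h2 := sgn_mul_self (K := K) (r : ℤ)
  have h5 := koszul_mul_self (K := K) p q
  have h6 := koszul_mul_self (K := K) p r
  have h7 := koszul_mul_self (K := K) r q
  generalize sgn K (p : ℤ) = x at *
  generalize sgn K (r : ℤ) = y at *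
  generalize koszul K p q = a at *
  generalize koszul K p r = b at *
  generalize koszul K r q = c at *
  match_scalars
  all_goals grind

theorem cup_lieDer {p r q n : ℕ} (f : O p) (g : O r) (m : O q) :
    P.cup n f (P.lieDer (r + q - 1) g m)
      - -(koszul K p r * sgn K r) • P.lieDer n g (P.cup (p + q) f m)
      - P.cup n (P.gbracket (p + r - 1) g f) m =
    P.cochainDiff n (P.gdtHomotopy (p + r + q - 2) f g m)
      - (sgn K p * sgn K r) • P.gdtHomotopy n f g (P.cochainDiff (q + 1) m)
      - P.gdtHomotopy n (P.diff (p + 1) f) g m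
      - -sgn K p • P.gdtHomotopy n f (P.diff (r + 1) g) m := by
  by_cases h : p + q + r = n + 1
  swap
  · have h1 : P.cup n f (P.lieDer (r + q - 1) g m) = 0 := by
      by_cases hq : r + q = r + q - 1 + 1
      · exact P.cup_of_ne (by omega) _ _
      · rw [P.lieDer_of_ne hq, map_zero]
    have h2 : P.cup n (P.gbracket (p + r - 1) g f) m = 0 := by
      by_cases hq : r + p = p + r - 1 + 1
      · exact P.cup_of_ne (by omega) _ _
      · rw [P.gbracket_of_ne hq]; simp
    have h3 : P.cochainDiff n (P.gdtHomotopy (p + r + q - 2) f g m) = 0 := by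
      by_cases hq : p + r + q = p + r + q - 2 + 2
      · exact P.cochainDiff_of_ne (by omega) _
      · rw [P.gdtHomotopy_of_ne hq, map_zero]
    rw [h1, h2, h3, P.lieDer_of_ne (by omega), P.gdtHomotopy_of_ne (by omega),
      P.gdtHomotopy_of_ne (by omega), P.gdtHomotopy_of_ne (by omega)]
    simp
  -- With `x = μ` the homotopy is the contraction and `lie μ` is the differential. The two
  -- commutators become `[ι_f, L_g]` and `[b, T(f,g)]`, and the three brackets become `T(f, dg)`,
  -- `ι` of the bracket, and `T(df, g)`.
  have H := P.lie_hom_sub (p := 2) (r := p) (q := q) (s := r) (N := n) (by omega) g P.μ f m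
  rw [show 2 + p + q - 2 = p + q by omega, P.hom_μ rfl, show r + p + q - 2 = p + r + q - 2 by omega,
    show q + 2 - 1 = q + 1 by omega, show p + 2 - 1 = p + 1 by omega,
    show 2 + r - 1 = r + 1 by omega, P.gbracket_antisymm g P.μ, ← diff_apply, ← diff_apply,
    koszul_two_left, koszul_two_left, koszul_two_right, koszul_two_right,
    P.gbracket_antisymm g f, show q + r - 1 = r + q - 1 by omega] at H
  have h1 : P.hom n P.μ f (P.lie (r + q - 1) g m) =
      (sgn K q * sgn K r * (koszul K p q * koszul K p r)) • P.cup n f (P.lie (r + q - 1) g m) := by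
    by_cases hq : r + q = r + q - 1 + 1
    · have : sgn K ((r + q - 1 : ℕ) : ℤ) = -(sgn K q * sgn K r) := by
        rw [← sgn_add, ← sgn_sub_one]; congr 1; omega
      rw [P.hom_μ (by omega), this, koszul_add_right hq, neg_neg, mul_comm (koszul K p q)]
    · rw [lie_apply, P.insertion_of_ne (by omega), P.graft_of_ne hq]; simp
  have h2 : P.hom n P.μ (P.gbracket (p + r - 1) g f) m =
      (-sgn K q * (koszul K p q * koszul K r q)) • P.cup n (P.gbracket (p + r - 1) g f) m := by
    by_cases hq : p + r = p + r - 1 + 1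
    · rw [P.hom_μ (by omega), koszul_add_left hq]
    · rw [P.gbracket_of_ne (by omega)]; simp
  simp only [map_neg, map_smul, LinearMap.neg_apply, LinearMap.smul_apply] at H
  rw [h1, h2, koszul_comm q r, koszul_comm r p] at H
  simp only [lieDer_apply, gdtHomotopy_eq, cochainDiff_eq_lie, koszul_succ_left, koszul_succ_right,
    map_neg, map_smul]
  push_cast
  rw [sgn_add_one, sgn_add_one]
  have s1 := sgn_mul_self (K := K) (p : ℤ)
  have s2 := sgn_mul_self (K := K) (r : ℤ)
  have s3 := sgn_mul_self (K := K) (q : ℤ)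
  have s5 := koszul_mul_self (K := K) p q
  have s6 := koszul_mul_self (K := K) p r
  have s7 := koszul_mul_self (K := K) r q
  generalize sgn K (p : ℤ) = x at *
  generalize sgn K (r : ℤ) = y at *
  generalize sgn K (q : ℤ) = z at *
  generalize koszul K p q = a at *
  generalize koszul K p r = b at *
  generalize koszul K r q = c at *
  -- The factor is the sign by which `H` differs from the goal; all the signs square to `1`.
  linear_combination (norm := skip) (z * a * b * c) • H
  clear H h1 h2
  match_scalars
  all_goals grind

end CyclicOperadWithMul

namespace CyclicOperadWithMul

open Finset

variable {K : Type u} [Field K] {O : ℕ → Type v} [∀ n, AddCommGroup (O n)] [∀ n, Module K (O n)]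
  (P : CyclicOperadWithMul K O)

/-! ### The operators in terms of the compositions without suspension signs -/

theorem sum_Icc_one {V : Type v} [AddCommMonoid V] (p : ℕ) (F : ℕ → V) :
    ∑ i ∈ Icc 1 p, F i = ∑ i ∈ range p, F (i + 1) := by
  rw [← Finset.Ico_add_one_right_eq_Icc, sum_Ico_eq_sum_range, Nat.add_sub_cancel]
  simp only [add_comm 1]

theorem insertion_eq_brace {p q n : ℕ} (h : p + q = n + 1) (φ : O p) (ψ : O q) :
    P.insertion n φ ψ = P.brace h φ ψ := by
  rw [insertion_apply, brace, sum_Icc_one]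
  refine sum_congr rfl fun i _ => ?_
  rw [P.cmp_eq h, negOnePow_smul_eq_sgn (K := K)]
  push_cast
  rw [add_sub_cancel_right]

theorem gbracket_eq {p q n : ℕ} (h : p + q = n + 1) (φ : O p) (ψ : O q) :
    P.gbracket n φ ψ = P.gerstenhaber h φ ψ := by
  rw [gbracket_apply, gerstenhaber, P.insertion_eq_brace h, P.insertion_eq_brace,
    negOnePow_smul_eq_sgn (K := K), koszul]

theorem diff_eq_delta {p : ℕ} (φ : O p) :
    P.diff (p + 1) φ = (p : ℤ).negOnePow • P.delta φ := by
  rw [diff_eq, delta, insertion_apply, insertion_μ, sum_Icc_one, negOnePow_smul_eq_sgn (K := K),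
    smul_add, smul_add, smul_add, smul_sum, negOnePow_smul_eq_sgn (K := K)]
  have e1 : ∑ i ∈ range p, P.cmp i (p + 1) φ P.μ = ∑ i ∈ range p, sgn K p •
      (((i + 1 : ℕ) : ℤ).negOnePow • P.comp (p - (i + 1) + 1) (by omega) φ P.μ) := by
    rw [← sum_range_reflect]
    refine sum_congr rfl fun i hi => ?_
    rw [mem_range] at hi
    rw [P.cmp_eq (by omega), negOnePow_smul_eq_sgn (K := K), smul_smul, ← sgn_add,
      show p - 1 - i = p - (i + 1) by omega]
    congr 1
    apply sgn_congr
    rw [show ((p - (i + 1) : ℕ) : ℤ) = p - i - 1 by omega]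
    push_cast
    exact ⟨-(i : ℤ) - 1, by ring⟩
  have e2 : P.cmp 1 (p + 1) P.μ φ =
      sgn K ((p : ℤ) + 1) • P.comp 2 (by omega) P.μ φ := by
    rw [P.cmp_eq (by omega)]
    congr 1
    apply sgn_congr
    push_cast
    exact ⟨-1, by ring⟩
  have e3 : P.cmp 0 (p + 1) P.μ φ = P.comp 1 (by omega) P.μ φ := by
    rw [P.cmp_eq (by omega)]
    simp [sgn_zero]
  rw [e1, e2, e3]
  abel

theorem cochainDiff_eq {q : ℕ} (m : O q) :
    P.cochainDiff (q + 1) m = P.comp 2 (by omega) P.μ m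
      + ∑ i ∈ Icc 1 q, (i : ℤ).negOnePow • P.comp i (by omega) m P.μ
      + ((q : ℤ) + 1).negOnePow • P.comp 1 (by omega) P.μ m := by
  rw [cochainDiff_apply, diff_eq, insertion_apply, insertion_μ, sum_Icc_one,
    negOnePow_smul_eq_sgn (K := K)]
  have e1 : ∑ i ∈ range q, P.cmp i (q + 1) m P.μ = -∑ i ∈ range q,
      (((i + 1 : ℕ) : ℤ).negOnePow • P.comp (i + 1) (by omega) m P.μ) := by
    rw [← sum_neg_distrib]
    refine sum_congr rfl fun i hi => ?_
    rw [P.cmp_eq (by omega), negOnePow_smul_eq_sgn (K := K)]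
    push_cast
    rw [sgn_add_one, neg_smul, neg_neg]
    congr 2
    ring
  have e2 : P.cmp 1 (q + 1) P.μ m = -sgn K (q : ℤ) • P.comp 2 (by omega) P.μ m := by
    rw [P.cmp_eq (by omega), ← sgn_sub_one]
    congr 2
    push_cast
    ring
  have e3 : P.cmp 0 (q + 1) P.μ m = P.comp 1 (by omega) P.μ m := by
    rw [P.cmp_eq (by omega)]
    simp [sgn_zero]
  rw [e1, e2, e3, sgn_add_one, smul_add, smul_smul, mul_neg, sgn_mul_self]
  module

theorem connes_eq {n : ℕ} (m : O (n + 1)) :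
    P.connes n m = ∑ i ∈ range (n + 1), ((n : ℤ) * (i : ℤ)).negOnePow •
      (P.τ n ^ i) (P.comp (n + 1) (q := 0) rfl (P.τ (n + 1) m) P.e) := by
  rw [connes_apply, graft_apply, ← sum_neg_distrib]
  refine sum_congr rfl fun a ha => ?_
  rw [mem_range] at ha
  -- The powers of `τ` in `B` carry `e` from the last input to input `n - a`, where `theta a` puts
  -- it.
  have h := P.t_pow_cmp (n := n) (i := n - a) (l := a) (by omega) (P.t (n + 1) m) P.e
  rw [← t_pow_apply_succ', show a + (n - a) = n by omega] at h
  rw [theta_apply, show n + 1 - 1 - a = n - a by omega, ← h, t_pow_eq,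
    P.cmp_eq (rfl : n + 1 + 0 = n + 1), t]
  simp only [LinearMap.smul_apply, map_smul, smul_smul]
  rw [negOnePow_smul_eq_sgn (K := K), ← sgn_add, ← sgn_add, ← neg_smul, ← sgn_sub_one]
  congr 1
  apply sgn_congr
  push_cast
  exact ⟨0, by ring⟩

theorem lieDer_eq {p q n : ℕ} (h : p + q = n + 1) (φ : O p) (m : O q) :
    P.lieDer n φ m = ((p : ℤ) - 1).negOnePow •
      (∑ i ∈ Icc 1 q, (((p : ℤ) - 1) * ((i : ℤ) - 1)).negOnePow •
          P.comp i ((Nat.add_comm q p).trans h) m φ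
        + ∑ i ∈ Icc 1 p, (((p : ℤ) - 1) * (i : ℤ) + (q : ℤ) * ((i : ℤ) - 1)).negOnePow •
          P.comp (p - i + 1) h ((P.τ p ^ i) φ) m) := by
  rw [lieDer_apply, lie_apply, P.insertion_eq_brace ((Nat.add_comm q p).trans h), brace,
    negOnePow_smul_eq_sgn (K := K), sgn_sub_one, sub_eq_add_neg, ← neg_smul, graft_apply, smul_sum,
    sum_Icc_one p]
  congr 2
  refine sum_congr rfl fun a ha => ?_
  rw [mem_range] at ha
  rw [theta_apply, t_pow_eq, P.cmp_eq h, negOnePow_smul_eq_sgn (K := K), koszul]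
  simp only [LinearMap.smul_apply, map_smul, smul_smul]
  rw [show p - 1 - a + 1 = p - (a + 1) + 1 by omega, ← sgn_sub_one,
    ← sgn_add, ← sgn_add]
  congr 1
  apply sgn_congr
  rw [show ((p - 1 - a : ℕ) : ℤ) = p - 1 - a by omega]
  push_cast
  exact ⟨(p - 1) * (q - 1) + a - q * a, by ring⟩

theorem cyclicHomotopy_eq {p k n : ℕ} (h : p + (k + 1) = n + 2) (φ : O p) (m : O (k + 1)) :
    P.cyclicHomotopy n φ m = ∑ i ∈ Icc 1 k, ∑ j ∈ Icc 1 i,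
      ((p : ℤ) * ((i : ℤ) - j) + ((k : ℤ) + 1) * ((j : ℤ) - 1) + i - 1).negOnePow •
        P.comp (i - j + 1) (p := k) (by omega)
          (P.comp (k + 1 - j + 1) (q := 0) rfl ((P.τ (k + 1) ^ j) m) P.e) φ := by
  rw [cyclicHomotopy_apply, P.hom_eq (by omega : k + 1 + p = k + p + 1), sum_range_succ',
    range_zero, sum_empty, add_zero, smul_sum, sum_Icc_one k]
  refine sum_congr rfl fun b hb => ?_
  rw [mem_range] at hb
  rw [smul_sum, sum_Icc_one]
  refine sum_congr rfl fun a ha => ?_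
  rw [mem_range] at ha
  obtain ⟨d, rfl⟩ : ∃ d, b = a + d := ⟨b - a, by omega⟩
  have h1 := P.t_pow_cmp (n := k + p) (i := d) (l := a + 1) (by omega) m φ
  rw [show a + 1 + d = a + d + 1 by omega] at h1
  -- The tree receives `f` before `e`, the explicit formula `e` before `f`; they occupy different
  -- inputs of the rotated `m`, so the two insertions are exchanged.
  rw [theta_apply, h1, show k + p - 1 - a = k - a + p - 1 by omega,
    P.cmp_cmp_par' (c := k) (by omega) (by omega) (by omega) (by omega) (by omega),
    koszul_zero_right, t_pow_eq, P.cmp_eq (by omega), P.cmp_eq (rfl : k + 1 + 0 = k + 1),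
    negOnePow_smul_eq_sgn (K := K)]
  simp only [LinearMap.smul_apply, map_smul, smul_smul]
  rw [neg_mul, mul_neg, ← mul_assoc, sgn_mul_self, one_mul, show a + d + 1 - (a + 1) = d by omega,
    show k + 1 - (a + 1) + 1 = k - a + 1 by omega, ← sgn_add,
    ← sgn_add, ← sgn_sub_one]
  congr 1
  apply sgn_congr
  rw [show ((k - a : ℕ) : ℤ) = k - a by omega]
  push_cast
  exact ⟨-(d : ℤ), by ring⟩

theorem gdtHomotopy_eq_sum {p k q n : ℕ} (h : k + 1 + p + q = n + 2) (f : O p) (g : O (k + 1))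
    (m : O q) :
    P.gdtHomotopy n f g m = ((p : ℤ) * (((k + 1 : ℕ) : ℤ) - 1)).negOnePow •
      ∑ j ∈ Icc 1 k, ∑ i ∈ Icc j k,
        ((q : ℤ) * ((j : ℤ) - 1) + (p : ℤ) * ((i : ℤ) - 1) + (k : ℤ) * j + i).negOnePow •
          P.comp (k + 1 - i) (p := k + q) (by omega)
            (P.comp (k + 1 - j + 1) (by omega) ((P.τ (k + 1) ^ j) g) m) f := by
  rw [gdtHomotopy_apply, P.hom_eq (by omega : k + 1 + p = k + p + 1),
    ← sum_range_triangle (k + 1) fun a b => P.theta a n (P.cmp b (k + p) g f) m, sum_range_succ,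
    show k + 1 - 1 - k = 0 by omega, range_zero, sum_empty, add_zero,
    negOnePow_smul_eq_sgn (K := K), smul_sum, smul_sum, sum_Icc_one k]
  refine sum_congr rfl fun a ha => ?_
  rw [mem_range] at ha
  -- The inner sum is reversed: after rotation `f` sits at input `c = b - a - 1` of `g`, and the
  -- explicit index is `i = k - c`.
  rw [smul_sum, smul_sum, ← Finset.Ico_add_one_right_eq_Icc, sum_Ico_eq_sum_range,
    ← sum_range_reflect]
  refine sum_congr (by congr 1; omega) fun κ hκ => ?_
  rw [mem_range] at hκ
  obtain ⟨c, rfl⟩ : ∃ c, k = a + 1 + κ + c := ⟨k - (a + 1 + κ), by omega⟩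
  have h1 := P.t_pow_cmp (n := a + 1 + κ + c + p) (i := c) (l := a + 1) (by omega) g f
  rw [show a + 1 + κ + c + 1 - 1 - a - 1 - κ = c by omega, theta_apply, h1,
    show a + 1 + κ + c + p - 1 - a = κ + c + 1 + p - 1 by omega,
    P.cmp_cmp_par' (c := a + 1 + κ + c + q) (by omega) (by omega) (by omega) (by omega) (by omega),
    t_pow_eq, P.cmp_eq (by omega), P.cmp_eq (by omega), negOnePow_smul_eq_sgn (K := K), koszul]
  simp only [LinearMap.smul_apply, map_smul, smul_smul]
  rw [show a + 1 + κ + c + 1 - (a + 1 + κ) = c + 1 by omega,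
    show a + 1 + κ + c + 1 - (a + 1) + 1 = κ + c + 1 + 1 by omega, ← sgn_add, ← sgn_add, ← sgn_add,
    ← sgn_add, ← sgn_add]
  clear h1
  congr 1
  apply sgn_congr
  push_cast
  -- The exponents are polynomials in five integers, so their agreement modulo `2` is a finite
  -- check.
  simp only [Int.even_add, Int.even_sub, Int.even_mul, Int.not_even_one]
  by_cases h1 : Even (a : ℤ) <;> by_cases h2 : Even (κ : ℤ) <;> by_cases h3 : Even (c : ℤ) <;>
    by_cases h4 : Even (p : ℤ) <;> by_cases h5 : Even (q : ℤ) <;> simp only [h1, h2, h3, h4, h5] <;> decide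

end CyclicOperadWithMul

namespace CyclicModule

variable {K : Type u} [Field K] {O : ℕ → Type v} [∀ n, AddCommGroup (O n)] [∀ n, Module K (O n)]
  {P : CyclicOperadWithMul K O} {M : ℕ → Type w} [∀ n, AddCommGroup (M n)] [∀ n, Module K (M n)]
  (Q : CyclicModule P M)

/-! ### The square-zero extension of a cyclic operad by a cyclic module -/

/-- The partial compositions of the square-zero extension. -/
def extComp (i : ℕ) {p q n : ℕ} (h : p + q = n + 1) :
    O p × M p →ₗ[K] O q × M q →ₗ[K] O n × M n :=
  LinearMap.mk₂ K
    (fun x y => (P.comp i h x.1 y.1, Q.compL i h x.1 y.2 + Q.compR i h x.2 y.1))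
    (fun x x' y => by ext <;> simp; abel) (fun c x y => by ext <;> simp)
    (fun x y y' => by ext <;> simp; abel) (fun c x y => by ext <;> simp)

theorem extComp_apply (i : ℕ) {p q n : ℕ} (h : p + q = n + 1) (x : O p × M p) (y : O q × M q) :
    Q.extComp i h x y = (P.comp i h x.1 y.1, Q.compL i h x.1 y.2 + Q.compR i h x.2 y.1) := rfl

theorem prodMap_pow_apply {V : Type v} {W : Type w} [AddCommGroup V] [Module K V] [AddCommGroup W]
    [Module K W] (f : Module.End K V) (g : Module.End K W) (l : ℕ) (x : V × W) :
    (f.prodMap g ^ l) x = ((f ^ l) x.1, (g ^ l) x.2) := by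
  induction l generalizing x with
  | zero => rfl
  | succ l ih => rw [pow_succ, Module.End.mul_apply, ih, pow_succ, pow_succ]; rfl

/-- The square-zero extension of `P` by the cyclic module `Q`. -/
def squareZeroExt : CyclicOperadWithMul K (fun n => O n × M n) where
  comp i _ _ _ h := Q.extComp i h
  comp_eq_zero h x y hi := by
    rw [extComp_apply, P.comp_eq_zero h _ _ hi, Q.compL_eq_zero h _ _ hi,
      Q.compR_eq_zero h _ _ hi, add_zero]
    rfl
  -- The `M`-component of a double composite is the sum of three terms with a single argument in
  -- `M`, one for each of the three families of module axioms.
  comp_comp_of_lt hpq har hpr hcq x y z h1 h2 h3 := by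
    simp only [extComp_apply, map_add, LinearMap.add_apply]
    rw [P.comp_comp_of_lt hpq har hpr hcq _ _ _ h1 h2 h3,
      Q.assocOOM_of_lt hpq har hpr hcq _ _ _ h1 h2 h3,
      Q.assocOMO_of_lt hpq har hpr hcq _ _ _ h1 h2 h3,
      Q.assocMOO_of_lt hpq har hpr hcq _ _ _ h1 h2 h3]
    congr 1
    abel
  comp_comp_of_mid hpq har hpr hcq x y z h1 h2 h3 h4 := by
    simp only [extComp_apply, map_add, LinearMap.add_apply]
    rw [P.comp_comp_of_mid hpq har hpr hcq _ _ _ h1 h2 h3 h4,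
      Q.assocOOM_of_mid hpq har hpr hcq _ _ _ h1 h2 h3 h4,
      Q.assocOMO_of_mid hpq har hpr hcq _ _ _ h1 h2 h3 h4,
      Q.assocMOO_of_mid hpq har hpr hcq _ _ _ h1 h2 h3 h4]
    congr 1
    abel
  comp_comp_of_ge hpq har hpr hcq x y z h1 h2 h3 h4 := by
    simp only [extComp_apply, map_add, LinearMap.add_apply]
    rw [P.comp_comp_of_ge hpq har hpr hcq _ _ _ h1 h2 h3 h4,
      Q.assocOOM_of_ge hpq har hpr hcq _ _ _ h1 h2 h3 h4,
      Q.assocOMO_of_ge hpq har hpr hcq _ _ _ h1 h2 h3 h4,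
      Q.assocMOO_of_ge hpq har hpr hcq _ _ _ h1 h2 h3 h4]
    congr 1
    abel
  one := (P.one, 0)
  comp_one i x h1 h2 := by
    simp [extComp_apply, P.comp_one i _ h1 h2, Q.compR_one i _ h1 h2]
  one_comp x := by
    simp [extComp_apply, P.one_comp, Q.one_compL]
  μ := (P.μ, 0)
  e := (P.e, 0)
  μ_assoc := by simp [extComp_apply, P.μ_assoc]
  μ_e_left := by simp [extComp_apply, P.μ_e_left]
  μ_e_right := by simp [extComp_apply, P.μ_e_right]
  τ p := (P.τ p).prodMap (Q.τ p)
  τ_comp h x y h1 h2 := by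
    simp [extComp_apply, P.τ_comp h _ _ h1 h2, Q.τ_compL h _ _ h1 h2, Q.τ_compR h _ _ h1 h2]
  τ_comp_one h x y h1 h2 := by
    simp [extComp_apply, P.τ_comp_one h _ _ h1 h2, Q.τ_compL_one h _ _ h1 h2,
      Q.τ_compR_one h _ _ h1 h2, add_comm]
  τ_pow p := by
    refine LinearMap.ext fun x => ?_
    rw [prodMap_pow_apply, P.τ_pow, Q.τ_pow]
    rfl
  τ_μ := by simp [P.τ_μ]

theorem ext_comp (i : ℕ) {p q n : ℕ} (h : p + q = n + 1) (x : O p × M p) (y : O q × M q) :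
    Q.squareZeroExt.comp i h x y =
      (P.comp i h x.1 y.1, Q.compL i h x.1 y.2 + Q.compR i h x.2 y.1) := rfl

theorem ext_comp_inl_inl (i : ℕ) {p q n : ℕ} (h : p + q = n + 1) (φ : O p) (ψ : O q) :
    Q.squareZeroExt.comp i h (φ, 0) (ψ, 0) = (P.comp i h φ ψ, 0) := by
  simp [ext_comp]

theorem ext_comp_inl_inr (i : ℕ) {p q n : ℕ} (h : p + q = n + 1) (φ : O p) (m : M q) :
    Q.squareZeroExt.comp i h (φ, 0) (0, m) = (0, Q.compL i h φ m) := by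
  simp [ext_comp]

theorem ext_comp_inr_inl (i : ℕ) {p q n : ℕ} (h : q + p = n + 1) (m : M q) (φ : O p) :
    Q.squareZeroExt.comp i h (0, m) (φ, 0) = (0, Q.compR i h m φ) := by
  simp [ext_comp]

theorem ext_μ : Q.squareZeroExt.μ = (P.μ, 0) := rfl

theorem ext_e : Q.squareZeroExt.e = (P.e, 0) := rfl

theorem ext_τ_inr {p : ℕ} (m : M p) : Q.squareZeroExt.τ p (0, m) = (0, Q.τ p m) := by
  simp [squareZeroExt]

theorem ext_τ_pow_inl {p : ℕ} (l : ℕ) (φ : O p) :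
    (Q.squareZeroExt.τ p ^ l) (φ, 0) = ((P.τ p ^ l) φ, 0) := by
  rw [squareZeroExt, prodMap_pow_apply, map_zero]

theorem ext_τ_pow_inr {p : ℕ} (l : ℕ) (m : M p) :
    (Q.squareZeroExt.τ p ^ l) (0, m) = (0, (Q.τ p ^ l) m) := by
  rw [squareZeroExt, prodMap_pow_apply, map_zero]

theorem inl_mem_ext_bar {p : ℕ} {φ : O p} : (φ, 0) ∈ Q.squareZeroExt.bar p ↔ φ ∈ P.bar p := by
  refine forall₃_congr fun i n h => ?_
  rw [ext_e, ext_comp_inl_inl, Prod.mk_eq_zero]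
  simp

theorem inr_mem_ext_bar {q : ℕ} {m : M q} : (0, m) ∈ Q.squareZeroExt.bar q ↔ m ∈ Q.bar q := by
  refine forall₃_congr fun i n h => ?_
  rw [ext_e, ext_comp_inr_inl, Prod.mk_eq_zero]
  simp

theorem sum_inr {V : Type v} {W : Type w} [AddCommGroup V] [AddCommGroup W] {α : Type*}
    (s : Finset α) (f : α → W) : ∑ a ∈ s, ((0 : V), f a) = (0, ∑ a ∈ s, f a) := by
  ext <;> simp [Prod.fst_sum, Prod.snd_sum]

theorem smul_inr {V : Type v} {W : Type w} [AddCommGroup V] [AddCommGroup W] {R : Type*} [Monoid R]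
    [DistribMulAction R V] [DistribMulAction R W] (c : R) (x : W) :
    c • ((0 : V), x) = (0, c • x) := by
  rw [Prod.smul_mk, smul_zero]

theorem add_inr {V : Type v} {W : Type w} [AddCommGroup V] [AddCommGroup W] (x y : W) :
    ((0 : V), x) + (0, y) = (0, x + y) := by
  rw [Prod.mk_add_mk, add_zero]

theorem ext_cmp_inl_inl (i n : ℕ) {p q : ℕ} (φ : O p) (ψ : O q) :
    Q.squareZeroExt.cmp i n (φ, 0) (ψ, 0) = (P.cmp i n φ ψ, 0) := by
  by_cases h : p + q = n + 1
  · rw [CyclicOperadWithMul.cmp_eq _ h, P.cmp_eq h, ext_comp_inl_inl, Prod.smul_mk, smul_zero]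
  · rw [CyclicOperadWithMul.cmp_of_ne _ h, P.cmp_of_ne h]; rfl

theorem ext_insertion_inl_inl (n : ℕ) {p q : ℕ} (φ : O p) (ψ : O q) :
    Q.squareZeroExt.insertion n (φ, 0) (ψ, 0) = (P.insertion n φ ψ, 0) := by
  rw [CyclicOperadWithMul.insertion_apply, CyclicOperadWithMul.insertion_apply]
  simp only [ext_cmp_inl_inl]
  ext <;> simp [Prod.fst_sum, Prod.snd_sum]

theorem ext_gbracket_inl_inl (n : ℕ) {p q : ℕ} (φ : O p) (ψ : O q) :
    Q.squareZeroExt.gbracket n (φ, 0) (ψ, 0) = (P.gbracket n φ ψ, 0) := by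
  rw [CyclicOperadWithMul.gbracket_apply, CyclicOperadWithMul.gbracket_apply,
    ext_insertion_inl_inl, ext_insertion_inl_inl, Prod.smul_mk, smul_zero, Prod.mk_sub_mk, sub_zero]

theorem ext_diff_inl (n : ℕ) {p : ℕ} (φ : O p) :
    Q.squareZeroExt.diff n (φ, 0) = (P.diff n φ, 0) :=
  Q.ext_gbracket_inl_inl n φ P.μ

theorem ext_cup_inl_inl (n : ℕ) {p q : ℕ} (φ : O p) (ψ : O q) :
    Q.squareZeroExt.cup n (φ, 0) (ψ, 0) = (P.cup n φ ψ, 0) := by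
  by_cases h : p + q = n
  · rw [CyclicOperadWithMul.cup_eq _ h, P.cup_eq h]
    simp only [CyclicOperadWithMul.cupProd, ext_μ, ext_comp_inl_inl]
  · rw [CyclicOperadWithMul.cup_of_ne _ h, P.cup_of_ne h]; rfl

/-! ### The calculus operators of a cyclic module -/

/-- As in the lemmas that follow, every composition in the formula contains the module element once,
so the result lies in the `M`-summand. -/
theorem ext_cochainDiff {q : ℕ} (m : M q) :
    Q.squareZeroExt.cochainDiff (q + 1) (0, m) = (0, Q.opb m) := by
  rw [CyclicOperadWithMul.cochainDiff_eq, opb]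
  simp only [ext_μ, ext_comp_inl_inr, ext_comp_inr_inl, smul_inr, sum_inr, add_inr]

theorem ext_connes {n : ℕ} (m : M (n + 1)) :
    Q.squareZeroExt.connes n (0, m) = (0, Q.opB m) := by
  rw [CyclicOperadWithMul.connes_eq, opB]
  simp only [ext_e, ext_τ_inr, ext_comp_inr_inl, ext_τ_pow_inr, smul_inr, sum_inr]

theorem ext_cup {p q n : ℕ} (h : p + q = n) (φ : O p) (m : M q) :
    Q.squareZeroExt.cup n (φ, 0) (0, m) = (0, Q.opι h φ m) := by
  rw [CyclicOperadWithMul.cup_eq _ h, opι]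
  simp only [CyclicOperadWithMul.cupProd, ext_μ, ext_comp_inl_inr, ext_comp_inr_inl]

theorem ext_lieDer {p q n : ℕ} (h : p + q = n + 1) (φ : O p) (m : M q) :
    Q.squareZeroExt.lieDer n (φ, 0) (0, m) = (0, ((p : ℤ) - 1).negOnePow • Q.opL h φ m) := by
  rw [CyclicOperadWithMul.lieDer_eq _ h, opL]
  simp only [ext_comp_inl_inr, ext_comp_inr_inl, ext_τ_pow_inl, smul_inr, sum_inr, add_inr]

theorem ext_cyclicHomotopy {p q n : ℕ} (h : p + q = n + 2) (φ : O p) (m : M q) :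
    Q.squareZeroExt.cyclicHomotopy n (φ, 0) (0, m) = (0, Q.opS h φ m) := by
  cases q with
  | zero =>
    rw [CyclicOperadWithMul.cyclicHomotopy_apply, CyclicOperadWithMul.hom_of_le_one _ (by omega),
      smul_zero, opS]
    rfl
  | succ k =>
    rw [CyclicOperadWithMul.cyclicHomotopy_eq _ h, opS]
    simp only [ext_e, ext_comp_inr_inl, ext_τ_pow_inr, smul_inr, sum_inr]

theorem ext_gdtHomotopy {p r q n : ℕ} (h : r + p + q = n + 2) (φ : O p) (ψ : O r) (m : M q) :
    Q.squareZeroExt.gdtHomotopy n (φ, 0) (ψ, 0) (0, m) =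
      (0, ((p : ℤ) * ((r : ℤ) - 1)).negOnePow • Q.opT h ψ φ m) := by
  cases r with
  | zero =>
    rw [CyclicOperadWithMul.gdtHomotopy_apply, CyclicOperadWithMul.hom_of_le_one _ (by omega),
      smul_zero, opT, smul_zero]
    rfl
  | succ k =>
    rw [CyclicOperadWithMul.gdtHomotopy_eq_sum _ h, opT]
    simp only [ext_comp_inl_inr, ext_comp_inr_inl, ext_τ_pow_inl, smul_inr, sum_inr]

end CyclicModule

/-! ### Restriction to submodules and graded maps on direct sums -/

section Restrict

variable {K : Type u} [Field K] {U V W : Type*} [AddCommGroup U] [Module K U] [AddCommGroup V]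
  [Module K V] [AddCommGroup W] [Module K W]

/-- Restriction of a bilinear map to submodules. -/
def LinearMap.restrictBilin (G : U →ₗ[K] V →ₗ[K] W) {A : Submodule K U} {B : Submodule K V}
    {C : Submodule K W} (h : ∀ x ∈ A, ∀ y ∈ B, G x y ∈ C) : A →ₗ[K] B →ₗ[K] C :=
  LinearMap.mk₂ K (fun x y => ⟨G x y, h x x.2 y y.2⟩)
    (fun x x' y => Subtype.ext (by simp)) (fun c x y => Subtype.ext (by simp))
    (fun x y y' => Subtype.ext (by simp)) (fun c x y => Subtype.ext (by simp))

end Restrict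

namespace DirectSum

variable {K : Type u} [Field K] {A B C D : ℕ → Type*} [∀ n, AddCommGroup (A n)]
  [∀ n, Module K (A n)] [∀ n, AddCommGroup (B n)] [∀ n, Module K (B n)]
  [∀ n, AddCommGroup (C n)] [∀ n, Module K (C n)] [∀ n, AddCommGroup (D n)] [∀ n, Module K (D n)]

/-! ### Graded multilinear maps on direct sums -/

theorem coe_neg_apply {A : ℕ → Type*} [∀ n, AddCommGroup (A n)] (f : ⨁ n, A n) (n : ℕ) :
    (-f) n = -f n := DFinsupp.neg_apply f n

/-- This reads the components of a graded map in every degree without comparing indices: the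
operators vanish in wrong arities, so truncated subtraction in the target degree is harmless. -/
theorem lof_section (f : ∀ n, A n) {N : ℕ} (hf : ∀ n, n ≠ N → f n = 0) (n : ℕ) :
    (lof K ℕ A N (f N)) n = f n := by
  by_cases h : n = N
  · subst h; exact lof_apply K n _
  · rw [lof_eq_of, of_eq_of_ne _ _ _ h, hf n h]

/-- The graded linear map on a direct sum with components `F p (N p)`. -/
def gradedLift (N : ℕ → ℕ) (F : ∀ p n, A p →ₗ[K] B n) : (⨁ p, A p) →ₗ[K] ⨁ n, B n :=
  toModule K ℕ _ fun p => lof K ℕ B (N p) ∘ₗ F p (N p)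

theorem gradedLift_lof (N : ℕ → ℕ) (F : ∀ p n, A p →ₗ[K] B n) (p : ℕ) (x : A p) :
    gradedLift N F (lof K ℕ A p x) = lof K ℕ B (N p) (F p (N p) x) := by
  rw [gradedLift, toModule_lof, LinearMap.comp_apply]

/-- The graded bilinear map on direct sums with components `F p q (N p q)`. -/
def gradedLift₂ (N : ℕ → ℕ → ℕ) (F : ∀ p q n, A p →ₗ[K] B q →ₗ[K] C n) :
    (⨁ p, A p) →ₗ[K] (⨁ q, B q) →ₗ[K] ⨁ n, C n :=
  toModule K ℕ _ fun p => (toModule K ℕ _ fun q =>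
    ((F p q (N p q)).compr₂ (lof K ℕ C (N p q))).flip).flip

theorem gradedLift₂_lof (N : ℕ → ℕ → ℕ) (F : ∀ p q n, A p →ₗ[K] B q →ₗ[K] C n) (p q : ℕ) (x : A p)
    (y : B q) :
    gradedLift₂ N F (lof K ℕ A p x) (lof K ℕ B q y) = lof K ℕ C (N p q) (F p q (N p q) x y) := by
  rw [gradedLift₂, toModule_lof, LinearMap.flip_apply, toModule_lof, LinearMap.flip_apply,
    LinearMap.compr₂_apply]

/-- The graded trilinear map on direct sums with components `F p r q (N p r q)`. -/
def gradedLift₃ (N : ℕ → ℕ → ℕ → ℕ) (F : ∀ p r q n, A p →ₗ[K] B r →ₗ[K] C q →ₗ[K] D n) :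
    (⨁ p, A p) →ₗ[K] (⨁ r, B r) →ₗ[K] (⨁ q, C q) →ₗ[K] ⨁ n, D n :=
  toModule K ℕ _ fun p => (toModule K ℕ _ fun r =>
    (LinearMap.mk₂ K (fun x y => gradedLift (N p r) fun q n => F p r q n x y)
      (fun x x' y => by ext : 2; simp [gradedLift_lof])
      (fun c x y => by ext : 2; simp [gradedLift_lof])
      (fun x y y' => by ext : 2; simp [gradedLift_lof])
      (fun c x y => by ext : 2; simp [gradedLift_lof])).flip).flip

theorem gradedLift₃_lof (N : ℕ → ℕ → ℕ → ℕ) (F : ∀ p r q n, A p →ₗ[K] B r →ₗ[K] C q →ₗ[K] D n)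
    (p r q : ℕ) (x : A p) (y : B r) (z : C q) :
    gradedLift₃ N F (lof K ℕ A p x) (lof K ℕ B r y) (lof K ℕ C q z) =
      lof K ℕ D (N p r q) (F p r q (N p r q) x y z) := by
  rw [gradedLift₃, toModule_lof, LinearMap.flip_apply, toModule_lof, LinearMap.flip_apply,
    LinearMap.mk₂_apply, gradedLift_lof]

theorem end_ext_lof {X Y : Module.End K (⨁ n, A n)}
    (h : ∀ q x n, X (lof K ℕ A q x) n = Y (lof K ℕ A q x) n) : X = Y :=
  linearMap_ext K fun q => LinearMap.ext fun x => DFinsupp.ext fun n => h q x n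

end DirectSum

/-! ### The shifted grading of a direct sum -/

section ShiftedGrading

open DirectSum

variable {K : Type u} [Field K] {A : ℕ → Type v} [∀ n, AddCommGroup (A n)] [∀ n, Module K (A n)]

theorem lof_mem_shiftedGrading {s k : ℤ} {n : ℕ} (h : (n : ℤ) = k + s) (x : A n) :
    lof K ℕ A n x ∈ shiftedGrading K A s k := fun j hj => by
  rw [lof_eq_of, of_eq_of_ne _ _ _ (by omega)]

/-- A degree with `k + s < 0` contains only zero; otherwise a single summand has that degree. -/
theorem eq_lof_of_mem_shiftedGrading {s k : ℤ} {f : ⨁ n, A n} (hf : f ∈ shiftedGrading K A s k) :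
    f = 0 ∨ ∃ (n : ℕ) (x : A n), (n : ℤ) = k + s ∧ f = lof K ℕ A n x := by
  by_cases h : 0 ≤ k + s
  · obtain ⟨n, hn⟩ := Int.eq_ofNat_of_zero_le h
    refine Or.inr ⟨n, f n, hn.symm, DFinsupp.ext fun j => ?_⟩
    by_cases hj : j = n
    · subst hj; exact (lof_apply K j _).symm
    · rw [hf j (by omega), lof_eq_of, of_eq_of_ne _ _ _ hj]
  · exact Or.inl (DFinsupp.ext fun j => hf j (by omega))

theorem shiftedGrading_isInternal (s : ℤ) : DirectSum.IsInternal (shiftedGrading K A s) := by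
  -- The inverse of the summation map sends the summand `A n` to degree `n - s`.
  let dec : (⨁ n, A n) →ₗ[K] ⨁ k, shiftedGrading K A s k :=
    toModule K ℕ _ fun n => lof K ℤ (fun k => shiftedGrading K A s k) (n - s) ∘ₗ
      (lof K ℕ A n).codRestrict _ fun x => lof_mem_shiftedGrading (by omega) x
  have h_dec (n : ℕ) (x : A n) : dec (lof K ℕ A n x) =
      lof K ℤ (fun k => shiftedGrading K A s k) (n - s)
        ⟨lof K ℕ A n x, lof_mem_shiftedGrading (by omega) x⟩ := toModule_lof _ _ _
  have dec_of_mem (k : ℤ) (f : ⨁ n, A n) (hf : f ∈ shiftedGrading K A s k) :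
      dec f = lof K ℤ (fun k => shiftedGrading K A s k) k ⟨f, hf⟩ := by
    obtain rfl | ⟨n, x, hn, rfl⟩ := eq_lof_of_mem_shiftedGrading hf
    · rw [map_zero]
      exact (map_zero (lof K ℤ (fun k => shiftedGrading K A s k) k)).symm
    · obtain rfl : k = n - s := by omega
      exact h_dec n x
  let _ := DirectSum.Decomposition.ofLinearMap (shiftedGrading K A s) dec
    (by
      ext n x : 2
      simp only [LinearMap.comp_apply, LinearMap.id_apply, h_dec, coeLinearMap_lof])
    (by
      ext k f : 2
      simp only [LinearMap.comp_apply, LinearMap.id_apply, coeLinearMap_lof]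
      exact dec_of_mem k f f.2)
  exact DirectSum.Decomposition.isInternal _

end ShiftedGrading

/-! ### The module operators as components of the extension -/

namespace CyclicModule

variable {K : Type u} [Field K] {O : ℕ → Type v} [∀ n, AddCommGroup (O n)] [∀ n, Module K (O n)]
  {P : CyclicOperadWithMul K O} {M : ℕ → Type w} [∀ n, AddCommGroup (M n)] [∀ n, Module K (M n)]
  (Q : CyclicModule P M)

theorem sub_inr {V : Type v} {W : Type w} [AddCommGroup V] [AddCommGroup W] (x y : W) :
    ((0 : V), x) - (0, y) = (0, x - y) := by
  rw [Prod.mk_sub_mk, sub_zero]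

/-- The differential `b` of a cyclic module. -/
def cochainDiff {q : ℕ} (n : ℕ) : M q →ₗ[K] M n :=
  LinearMap.snd K (O n) (M n) ∘ₗ Q.squareZeroExt.cochainDiff n ∘ₗ LinearMap.inr K (O q) (M q)

/-- The differential `B` of a cyclic module. -/
def connes {q : ℕ} (n : ℕ) : M q →ₗ[K] M n :=
  LinearMap.snd K (O n) (M n) ∘ₗ Q.squareZeroExt.connes n ∘ₗ LinearMap.inr K (O q) (M q)

/-- The contraction by an operad element. -/
def contraction {p q : ℕ} (n : ℕ) : O p →ₗ[K] M q →ₗ[K] M n :=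
  ((Q.squareZeroExt.cup n).compl₁₂ (LinearMap.inl K (O p) (M p))
    (LinearMap.inr K (O q) (M q))).compr₂ (LinearMap.snd K (O n) (M n))

/-- The Lie derivative along an operad element. -/
def lieDer {p q : ℕ} (n : ℕ) : O p →ₗ[K] M q →ₗ[K] M n :=
  ((Q.squareZeroExt.lieDer n).compl₁₂ (LinearMap.inl K (O p) (M p))
    (LinearMap.inr K (O q) (M q))).compr₂ (LinearMap.snd K (O n) (M n))

/-- The operator `S` of a cyclic module. -/
def cyclicHomotopy {p q : ℕ} (n : ℕ) : O p →ₗ[K] M q →ₗ[K] M n :=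
  ((Q.squareZeroExt.cyclicHomotopy n).compl₁₂ (LinearMap.inl K (O p) (M p))
    (LinearMap.inr K (O q) (M q))).compr₂ (LinearMap.snd K (O n) (M n))

/-- The operator `T` of a cyclic module. -/
def gdtHomotopy {p r q : ℕ} (n : ℕ) : O p →ₗ[K] O r →ₗ[K] M q →ₗ[K] M n :=
  (Q.squareZeroExt.gdtHomotopy n).compl₁₂ (LinearMap.inl K (O p) (M p))
    (LinearMap.inl K (O r) (M r)) |>.compr₂ <|
      LinearMap.lcomp K (M n) (LinearMap.inr K (O q) (M q)) ∘ₗ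
        LinearMap.llcomp K (O q × M q) (O n × M n) (M n) (LinearMap.snd K (O n) (M n))

theorem cochainDiff_eq {q : ℕ} (m : M q) : Q.cochainDiff (q + 1) m = Q.opb m :=
  congrArg Prod.snd (Q.ext_cochainDiff m)

theorem connes_eq {n : ℕ} (m : M (n + 1)) : Q.connes n m = Q.opB m :=
  congrArg Prod.snd (Q.ext_connes m)

theorem contraction_eq {p q n : ℕ} (h : p + q = n) (φ : O p) (m : M q) :
    Q.contraction n φ m = Q.opι h φ m :=
  congrArg Prod.snd (Q.ext_cup h φ m)

theorem lieDer_eq {p q n : ℕ} (h : p + q = n + 1) (φ : O p) (m : M q) :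
    Q.lieDer n φ m = ((p : ℤ) - 1).negOnePow • Q.opL h φ m :=
  congrArg Prod.snd (Q.ext_lieDer h φ m)

theorem cyclicHomotopy_eq {p q n : ℕ} (h : p + q = n + 2) (φ : O p) (m : M q) :
    Q.cyclicHomotopy n φ m = Q.opS h φ m :=
  congrArg Prod.snd (Q.ext_cyclicHomotopy h φ m)

theorem gdtHomotopy_eq {p r q n : ℕ} (h : r + p + q = n + 2) (φ : O p) (ψ : O r) (m : M q) :
    Q.gdtHomotopy n φ ψ m = ((p : ℤ) * ((r : ℤ) - 1)).negOnePow • Q.opT h ψ φ m :=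
  congrArg Prod.snd (Q.ext_gdtHomotopy h φ ψ m)

theorem cochainDiff_of_ne {q n : ℕ} (h : q + 1 ≠ n) (m : M q) : Q.cochainDiff n m = 0 :=
  congrArg Prod.snd (Q.squareZeroExt.cochainDiff_of_ne h _)

theorem connes_of_ne {q n : ℕ} (h : q ≠ n + 1) (m : M q) : Q.connes n m = 0 :=
  congrArg Prod.snd (Q.squareZeroExt.connes_of_ne h _)

theorem contraction_of_ne {p q n : ℕ} (h : p + q ≠ n) (φ : O p) (m : M q) :
    Q.contraction n φ m = 0 :=
  congrArg Prod.snd (Q.squareZeroExt.cup_of_ne h _ _)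

theorem lieDer_of_ne {p q n : ℕ} (h : p + q ≠ n + 1) (φ : O p) (m : M q) :
    Q.lieDer n φ m = 0 :=
  congrArg Prod.snd (Q.squareZeroExt.lieDer_of_ne h _ _)

theorem cyclicHomotopy_of_ne {p q n : ℕ} (h : p + q ≠ n + 2) (φ : O p) (m : M q) :
    Q.cyclicHomotopy n φ m = 0 :=
  congrArg Prod.snd (Q.squareZeroExt.cyclicHomotopy_of_ne h _ _)

theorem gdtHomotopy_of_ne {p r q n : ℕ} (h : p + r + q ≠ n + 2) (φ : O p) (ψ : O r) (m : M q) :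
    Q.gdtHomotopy n φ ψ m = 0 :=
  congrArg Prod.snd (Q.squareZeroExt.gdtHomotopy_of_ne h _ _ _)

/-- Both sides vanish in wrong arities, so no arity hypothesis is needed; identities of the
extension then transfer to the module by rewriting. -/
theorem ext_cochainDiff_inr {q n : ℕ} (m : M q) :
    Q.squareZeroExt.cochainDiff n (0, m) = (0, Q.cochainDiff n m) := by
  by_cases h : q + 1 = n
  · subst h; rw [ext_cochainDiff, cochainDiff_eq]
  · rw [CyclicOperadWithMul.cochainDiff_of_ne _ h, cochainDiff_of_ne _ h]; rfl

theorem ext_connes_inr {q n : ℕ} (m : M q) :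
    Q.squareZeroExt.connes n (0, m) = (0, Q.connes n m) := by
  by_cases h : q = n + 1
  · subst h; rw [ext_connes, connes_eq]
  · rw [CyclicOperadWithMul.connes_of_ne _ h, connes_of_ne _ h]; rfl

theorem ext_cup_inr {p q n : ℕ} (φ : O p) (m : M q) :
    Q.squareZeroExt.cup n (φ, 0) (0, m) = (0, Q.contraction n φ m) := by
  by_cases h : p + q = n
  · rw [Q.ext_cup h, Q.contraction_eq h]
  · rw [CyclicOperadWithMul.cup_of_ne _ h, contraction_of_ne _ h]; rfl

theorem ext_lieDer_inr {p q n : ℕ} (φ : O p) (m : M q) :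
    Q.squareZeroExt.lieDer n (φ, 0) (0, m) = (0, Q.lieDer n φ m) := by
  by_cases h : p + q = n + 1
  · rw [Q.ext_lieDer h, Q.lieDer_eq h]
  · rw [CyclicOperadWithMul.lieDer_of_ne _ h, lieDer_of_ne _ h]; rfl

theorem ext_cyclicHomotopy_inr {p q n : ℕ} (φ : O p) (m : M q) :
    Q.squareZeroExt.cyclicHomotopy n (φ, 0) (0, m) = (0, Q.cyclicHomotopy n φ m) := by
  by_cases h : p + q = n + 2
  · rw [Q.ext_cyclicHomotopy h, Q.cyclicHomotopy_eq h]
  · rw [CyclicOperadWithMul.cyclicHomotopy_of_ne _ h, cyclicHomotopy_of_ne _ h]; rfl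

theorem ext_gdtHomotopy_inr {p r q n : ℕ} (φ : O p) (ψ : O r) (m : M q) :
    Q.squareZeroExt.gdtHomotopy n (φ, 0) (ψ, 0) (0, m) = (0, Q.gdtHomotopy n φ ψ m) := by
  by_cases h : p + r + q = n + 2
  · rw [Q.ext_gdtHomotopy (by omega), Q.gdtHomotopy_eq (by omega)]
  · rw [CyclicOperadWithMul.gdtHomotopy_of_ne _ h, gdtHomotopy_of_ne _ h]; rfl

/-! ### The operators restrict to the normalised spaces -/

section Normalised

variable {p r q n : ℕ} {φ : O p} {ψ : O r} {m : M q}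

theorem cochainDiff_mem_bar (hm : m ∈ Q.bar q) : Q.cochainDiff n m ∈ Q.bar n := by
  rw [← inr_mem_ext_bar, ← ext_cochainDiff_inr, CyclicOperadWithMul.cochainDiff_apply]
  exact neg_mem (CyclicOperadWithMul.diff_mem_bar _ (Q.inr_mem_ext_bar.2 hm))

theorem connes_mem_bar (hm : m ∈ Q.bar q) : Q.connes n m ∈ Q.bar n := by
  rw [← inr_mem_ext_bar, ← ext_connes_inr, CyclicOperadWithMul.connes_apply]
  exact neg_mem (CyclicOperadWithMul.graft_mem_bar _ (Q.inr_mem_ext_bar.2 hm)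
    (CyclicOperadWithMul.mem_bar_zero _ _))

theorem contraction_mem_bar (hφ : φ ∈ P.bar p) (hm : m ∈ Q.bar q) :
    Q.contraction n φ m ∈ Q.bar n := by
  rw [← inr_mem_ext_bar, ← ext_cup_inr]
  exact CyclicOperadWithMul.cup_mem_bar _ (Q.inl_mem_ext_bar.2 hφ) (Q.inr_mem_ext_bar.2 hm)

theorem lieDer_mem_bar (hφ : φ ∈ P.bar p) (hm : m ∈ Q.bar q) : Q.lieDer n φ m ∈ Q.bar n := by
  rw [← inr_mem_ext_bar, ← ext_lieDer_inr, CyclicOperadWithMul.lieDer_apply]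
  exact Submodule.smul_mem _ _
    (CyclicOperadWithMul.lie_mem_bar _ (Q.inl_mem_ext_bar.2 hφ) (Q.inr_mem_ext_bar.2 hm))

theorem cyclicHomotopy_mem_bar (hφ : φ ∈ P.bar p) (hm : m ∈ Q.bar q) :
    Q.cyclicHomotopy n φ m ∈ Q.bar n := by
  rw [← inr_mem_ext_bar, ← ext_cyclicHomotopy_inr, CyclicOperadWithMul.cyclicHomotopy_apply]
  exact Submodule.smul_mem _ _ (CyclicOperadWithMul.hom_mem_bar _ (Q.inr_mem_ext_bar.2 hm)
    (Q.inl_mem_ext_bar.2 hφ) (CyclicOperadWithMul.mem_bar_zero _ _))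

theorem gdtHomotopy_mem_bar (hφ : φ ∈ P.bar p) (hψ : ψ ∈ P.bar r) (hm : m ∈ Q.bar q) :
    Q.gdtHomotopy n φ ψ m ∈ Q.bar n := by
  rw [← inr_mem_ext_bar, ← ext_gdtHomotopy_inr, CyclicOperadWithMul.gdtHomotopy_apply]
  exact Submodule.smul_mem _ _ (CyclicOperadWithMul.hom_mem_bar _ (Q.inl_mem_ext_bar.2 hψ)
    (Q.inl_mem_ext_bar.2 hφ) (Q.inr_mem_ext_bar.2 hm))

end Normalised

/-! ### The identities of the calculus -/

section Identities

variable {p r q n : ℕ}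

theorem cochainDiff_cochainDiff [CharZero K] (m : M q) :
    Q.cochainDiff n (Q.cochainDiff (q + 1) m) = 0 := by
  have H := Q.squareZeroExt.cochainDiff_cochainDiff (n := n) (0, m)
  simpa only [ext_cochainDiff_inr, Prod.mk_eq_zero, true_and] using H

theorem connes_connes {m : M q} (hm : m ∈ Q.bar q) : Q.connes n (Q.connes (q - 1) m) = 0 := by
  have H := Q.squareZeroExt.connes_connes (n := n) (Q.inr_mem_ext_bar.2 hm)
  simpa only [ext_connes_inr, Prod.mk_eq_zero, true_and] using H

theorem connes_cyclicHomotopy {f : O p} {m : M q} (hf : f ∈ P.bar p) (hm : m ∈ Q.bar q) :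
    Q.connes n (Q.cyclicHomotopy (p + q - 2) f m) = 0 := by
  have H := Q.squareZeroExt.connes_cyclicHomotopy (n := n) (Q.inl_mem_ext_bar.2 hf)
    (Q.inr_mem_ext_bar.2 hm)
  simpa only [ext_connes_inr, ext_cyclicHomotopy_inr, Prod.mk_eq_zero, true_and] using H

theorem cyclicHomotopy_connes (f : O p) {m : M q} (hm : m ∈ Q.bar q) :
    Q.cyclicHomotopy n f (Q.connes (q - 1) m) = 0 := by
  have H := Q.squareZeroExt.cyclicHomotopy_connes (n := n) (f, 0) (Q.inr_mem_ext_bar.2 hm)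
  simpa only [ext_connes_inr, ext_cyclicHomotopy_inr, Prod.mk_eq_zero, true_and] using H

theorem connes_cochainDiff (m : M q) :
    Q.connes n (Q.cochainDiff (q + 1) m) + Q.cochainDiff n (Q.connes (q - 1) m) = 0 := by
  have H := Q.squareZeroExt.connes_cochainDiff (n := n) (0, m)
  simpa only [ext_connes_inr, ext_cochainDiff_inr, add_inr, Prod.mk_eq_zero, true_and] using H

theorem cartan_homotopy (f : O p) (m : M q) :
    Q.lieDer n f m =
      (Q.connes n (Q.contraction (p + q) f m) - sgn K p • Q.contraction n f (Q.connes (q - 1) m))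
      + (Q.cochainDiff n (Q.cyclicHomotopy (p + q - 2) f m)
        - sgn K p • Q.cyclicHomotopy n f (Q.cochainDiff (q + 1) m))
      + Q.cyclicHomotopy n (P.diff (p + 1) f) m := by
  have H := Q.squareZeroExt.cartan_homotopy (n := n) (f, 0) (0, m)
  simp only [ext_connes_inr, ext_cochainDiff_inr, ext_cup_inr, ext_cyclicHomotopy_inr, ext_diff_inl,
    ext_lieDer_inr, smul_inr, sub_inr, add_inr] at H
  exact (Prod.mk.inj H).2

theorem cochainDiff_contraction (f : O p) (m : M q) :
    Q.cochainDiff n (Q.contraction (p + q) f m)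
      - sgn K p • Q.contraction n f (Q.cochainDiff (q + 1) m)
      + Q.contraction n (P.diff (p + 1) f) m = 0 := by
  have H := Q.squareZeroExt.cochainDiff_cup (n := n) (f, 0) (0, m)
  simp only [ext_cochainDiff_inr, ext_cup_inr, ext_diff_inl, smul_inr, sub_inr, add_inr] at H
  exact (Prod.mk.inj H).2

theorem contraction_cup (f : O p) (g : O r) (m : M q) :
    Q.contraction n (P.cup (p + r) f g) m = Q.contraction n f (Q.contraction (r + q) g m) := by
  have H := Q.squareZeroExt.cup_assoc (n := n) (f, 0) (g, 0) (0, m)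
  simp only [ext_cup_inr, ext_cup_inl_inl] at H
  exact (Prod.mk.inj H).2

theorem contraction_e (m : M q) : Q.contraction q P.e m = m := by
  have H := Q.squareZeroExt.e_cup (0, m)
  simp only [ext_cup_inr, ext_e] at H
  exact (Prod.mk.inj H).2

theorem contraction_lieDer (f : O p) (g : O r) (m : M q) :
    Q.contraction n f (Q.lieDer (r + q - 1) g m)
      - -(koszul K p r * sgn K r) • Q.lieDer n g (Q.contraction (p + q) f m)
      - Q.contraction n (P.gbracket (p + r - 1) g f) m =
    Q.cochainDiff n (Q.gdtHomotopy (p + r + q - 2) f g m)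
      - (sgn K p * sgn K r) • Q.gdtHomotopy n f g (Q.cochainDiff (q + 1) m)
      - Q.gdtHomotopy n (P.diff (p + 1) f) g m
      - -sgn K p • Q.gdtHomotopy n f (P.diff (r + 1) g) m := by
  have H := Q.squareZeroExt.cup_lieDer (n := n) (f, 0) (g, 0) (0, m)
  simp only [ext_cochainDiff_inr, ext_cup_inr, ext_gdtHomotopy_inr, ext_diff_inl,
    ext_gbracket_inl_inl, ext_lieDer_inr, smul_inr, sub_inr] at H
  exact (Prod.mk.inj H).2

theorem cyclicHomotopy_lieDer {f : O p} {g : O r} (hf : f ∈ P.bar p) (hg : g ∈ P.bar r) (m : M q) :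
    Q.cyclicHomotopy n f (Q.lieDer (r + q - 1) g m)
      - (koszul K p r * -sgn K r) • Q.lieDer n g (Q.cyclicHomotopy (p + q - 2) f m)
      - Q.cyclicHomotopy n (P.gbracket (p + r - 1) g f) m =
    Q.connes n (Q.gdtHomotopy (p + r + q - 2) f g m)
      - (sgn K p * sgn K r) • Q.gdtHomotopy n f g (Q.connes (q - 1) m) := by
  have H := Q.squareZeroExt.cyclicHomotopy_lieDer (n := n) (Q.inl_mem_ext_bar.2 hf)
    (Q.inl_mem_ext_bar.2 hg) (0, m)
  simp only [ext_connes_inr, ext_cyclicHomotopy_inr, ext_gdtHomotopy_inr,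
    ext_gbracket_inl_inl, ext_lieDer_inr, smul_inr, sub_inr] at H
  exact (Prod.mk.inj H).2

end Identities

end CyclicModule

namespace CyclicOperadWithMul

open DirectSum

variable {K : Type u} [Field K] {O : ℕ → Type v} [∀ n, AddCommGroup (O n)] [∀ n, Module K (O n)]
  (P : CyclicOperadWithMul K O)

/-! ### The dg Lie algebra and dg algebra of a cyclic operad with multiplication -/

/-- The components of the differential on the normalised spaces. -/
def barDiff (p n : ℕ) : P.bar p →ₗ[K] P.bar n :=
  (P.diff n).restrict fun _ => P.diff_mem_bar

/-- The components of the bracket on the normalised spaces. -/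
def barBracket (p r n : ℕ) : P.bar p →ₗ[K] P.bar r →ₗ[K] P.bar n :=
  (P.gbracket n).flip.restrictBilin fun _ hφ _ hψ => P.gbracket_mem_bar hψ hφ

/-- The components of the product on the normalised spaces. -/
def barCup (p r n : ℕ) : P.bar p →ₗ[K] P.bar r →ₗ[K] P.bar n :=
  (P.cup n).restrictBilin fun _ hφ _ hψ => P.cup_mem_bar hφ hψ

/-- The differential on the sum of the normalised spaces. -/
def totalDiff : (⨁ p, P.bar p) →ₗ[K] ⨁ n, P.bar n :=
  gradedLift (fun p => p + 1) P.barDiff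

/-- The bracket on the sum of the normalised spaces. -/
def totalBracket : (⨁ p, P.bar p) →ₗ[K] (⨁ r, P.bar r) →ₗ[K] ⨁ n, P.bar n :=
  gradedLift₂ (fun p r => p + r - 1) P.barBracket

/-- The product on the sum of the normalised spaces. -/
def totalCup : (⨁ p, P.bar p) →ₗ[K] (⨁ r, P.bar r) →ₗ[K] ⨁ n, P.bar n :=
  gradedLift₂ (fun p r => p + r) P.barCup

/-- The unit of the product. -/
def totalUnit : ⨁ p, P.bar p := lof K ℕ (fun p => P.bar p) 0 ⟨P.e, P.mem_bar_zero _⟩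

section Components

variable {p r : ℕ} (φ : P.bar p) (ψ : P.bar r) (n : ℕ)

theorem totalDiff_lof : P.totalDiff (lof K ℕ (fun p => P.bar p) p φ) =
    lof K ℕ (fun p => P.bar p) (p + 1) (P.barDiff p (p + 1) φ) := gradedLift_lof _ _ _ _

theorem totalBracket_lof :
    P.totalBracket (lof K ℕ (fun p => P.bar p) p φ) (lof K ℕ (fun p => P.bar p) r ψ) =
      lof K ℕ (fun p => P.bar p) (p + r - 1) (P.barBracket p r (p + r - 1) φ ψ) :=
  gradedLift₂_lof _ _ _ _ _ _

theorem totalCup_lof :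
    P.totalCup (lof K ℕ (fun p => P.bar p) p φ) (lof K ℕ (fun p => P.bar p) r ψ) =
      lof K ℕ (fun p => P.bar p) (p + r) (P.barCup p r (p + r) φ ψ) :=
  gradedLift₂_lof _ _ _ _ _ _

theorem coe_barDiff : (P.barDiff p n φ : O n) = P.diff n (φ : O p) := rfl

theorem coe_barBracket : (P.barBracket p r n φ ψ : O n) = P.gbracket n (ψ : O r) (φ : O p) := rfl

theorem coe_barCup : (P.barCup p r n φ ψ : O n) = P.cup n (φ : O p) (ψ : O r) := rfl

theorem lof_barDiff :
    (lof K ℕ (fun p => P.bar p) (p + 1) (P.barDiff p (p + 1) φ)) n = P.barDiff p n φ :=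
  lof_section (fun n => P.barDiff p n φ)
    (fun _ hn => Subtype.ext (P.diff_of_ne (Ne.symm hn) _)) n

theorem lof_barBracket :
    (lof K ℕ (fun p => P.bar p) (p + r - 1) (P.barBracket p r (p + r - 1) φ ψ)) n =
      P.barBracket p r n φ ψ :=
  lof_section (fun n => P.barBracket p r n φ ψ)
    (fun _ hn => Subtype.ext (P.gbracket_of_ne (by omega) _ _)) n

theorem lof_barCup :
    (lof K ℕ (fun p => P.bar p) (p + r) (P.barCup p r (p + r) φ ψ)) n = P.barCup p r n φ ψ :=
  lof_section (fun n => P.barCup p r n φ ψ)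
    (fun _ hn => Subtype.ext (P.cup_of_ne (Ne.symm hn) _ _)) n

end Components

section Structure

variable {h j k : ℤ} {f f' f'' : ⨁ p, P.bar p}

theorem totalDiff_mem (hf : f ∈ shiftedGrading K (fun p => P.bar p) 1 h) :
    P.totalDiff f ∈ shiftedGrading K (fun p => P.bar p) 1 (h + 1) := by
  obtain rfl | ⟨p, φ, hp, rfl⟩ := eq_lof_of_mem_shiftedGrading hf
  · simp
  intro n hn
  rw [totalDiff_lof, lof_barDiff]
  exact Subtype.ext (P.diff_of_ne (by omega) _)

theorem totalBracket_mem (hf : f ∈ shiftedGrading K (fun p => P.bar p) 1 h)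
    (hf' : f' ∈ shiftedGrading K (fun p => P.bar p) 1 j) :
    P.totalBracket f f' ∈ shiftedGrading K (fun p => P.bar p) 1 (h + j) := by
  obtain rfl | ⟨p, φ, hp, rfl⟩ := eq_lof_of_mem_shiftedGrading hf
  · simp
  obtain rfl | ⟨r, ψ, hr, rfl⟩ := eq_lof_of_mem_shiftedGrading hf'
  · simp
  intro n hn
  rw [totalBracket_lof, lof_barBracket]
  exact Subtype.ext (P.gbracket_of_ne (by omega) _ _)

theorem totalCup_mem (hf : f ∈ shiftedGrading K (fun p => P.bar p) 1 h)
    (hf' : f' ∈ shiftedGrading K (fun p => P.bar p) 1 j) :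
    P.totalCup f f' ∈ shiftedGrading K (fun p => P.bar p) 1 (h + j + 1) := by
  obtain rfl | ⟨p, φ, hp, rfl⟩ := eq_lof_of_mem_shiftedGrading hf
  · simp
  obtain rfl | ⟨r, ψ, hr, rfl⟩ := eq_lof_of_mem_shiftedGrading hf'
  · simp
  intro n hn
  rw [totalCup_lof, lof_barCup]
  exact Subtype.ext (P.cup_of_ne (by omega) _ _)

theorem totalDiff_totalDiff [CharZero K] (f : ⨁ p, P.bar p) :
    P.totalDiff (P.totalDiff f) = 0 := by
  induction f using DirectSum.induction_on with
  | zero => simp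
  | of p φ =>
    rw [← lof_eq_of K]
    refine DFinsupp.ext fun n => Subtype.ext ?_
    rw [totalDiff_lof, totalDiff_lof, lof_barDiff, coe_barDiff, coe_barDiff, diff_diff]
    rfl
  | add f g hf hg => rw [map_add, map_add, hf, hg, add_zero]

theorem totalBracket_antisymm (hf : f ∈ shiftedGrading K (fun p => P.bar p) 1 h)
    (hf' : f' ∈ shiftedGrading K (fun p => P.bar p) 1 j) :
    P.totalBracket f f' = -((h * j).negOnePow • P.totalBracket f' f) := by
  obtain rfl | ⟨p, φ, hp, rfl⟩ := eq_lof_of_mem_shiftedGrading hf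
  · simp
  obtain rfl | ⟨r, ψ, hr, rfl⟩ := eq_lof_of_mem_shiftedGrading hf'
  · simp
  obtain rfl : h = p - 1 := by omega
  obtain rfl : j = r - 1 := by omega
  refine DFinsupp.ext fun n => Subtype.ext ?_
  rw [negOnePow_smul_eq_sgn (K := K)]
  simp only [totalBracket_lof, lof_barBracket, DirectSum.coe_neg_apply, DirectSum.smul_apply,
    Submodule.coe_neg, Submodule.coe_smul, coe_barBracket]
  exact P.gbracket_antisymm _ _

theorem totalBracket_jacobi (hf : f ∈ shiftedGrading K (fun p => P.bar p) 1 h)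
    (hf' : f' ∈ shiftedGrading K (fun p => P.bar p) 1 j)
    (hf'' : f'' ∈ shiftedGrading K (fun p => P.bar p) 1 k) :
    P.totalBracket f (P.totalBracket f' f'') = P.totalBracket (P.totalBracket f f') f''
      + (h * j).negOnePow • P.totalBracket f' (P.totalBracket f f'') := by
  obtain rfl | ⟨p, φ, hp, rfl⟩ := eq_lof_of_mem_shiftedGrading hf
  · simp
  obtain rfl | ⟨q, ψ, hq, rfl⟩ := eq_lof_of_mem_shiftedGrading hf'
  · simp
  obtain rfl | ⟨r, χ, hr, rfl⟩ := eq_lof_of_mem_shiftedGrading hf''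
  · simp
  obtain rfl : h = p - 1 := by omega
  obtain rfl : j = q - 1 := by omega
  refine DFinsupp.ext fun n => Subtype.ext ?_
  rw [negOnePow_smul_eq_sgn (K := K)]
  simp only [totalBracket_lof, lof_barBracket, DirectSum.add_apply, DirectSum.smul_apply,
    Submodule.coe_add, Submodule.coe_smul, coe_barBracket]
  exact P.gbracket_jacobi rfl rfl rfl _ _ _

theorem totalDiff_totalBracket (hf : f ∈ shiftedGrading K (fun p => P.bar p) 1 h)
    (hf' : f' ∈ shiftedGrading K (fun p => P.bar p) 1 j) :
    P.totalDiff (P.totalBracket f f') =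
      P.totalBracket (P.totalDiff f) f' + h.negOnePow • P.totalBracket f (P.totalDiff f') := by
  obtain rfl | ⟨p, φ, hp, rfl⟩ := eq_lof_of_mem_shiftedGrading hf
  · simp
  obtain rfl | ⟨r, ψ, hr, rfl⟩ := eq_lof_of_mem_shiftedGrading hf'
  · simp
  obtain rfl : h = p - 1 := by omega
  refine DFinsupp.ext fun n => Subtype.ext ?_
  rw [negOnePow_smul_eq_sgn (K := K), sgn_sub_one]
  simp only [totalBracket_lof, totalDiff_lof, lof_barDiff, lof_barBracket, DirectSum.add_apply,
    DirectSum.smul_apply, Submodule.coe_add, Submodule.coe_smul, coe_barBracket, coe_barDiff]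
  exact P.diff_gbracket rfl _ _

theorem totalDiff_totalCup (hf : f ∈ shiftedGrading K (fun p => P.bar p) 1 h)
    (hf' : f' ∈ shiftedGrading K (fun p => P.bar p) 1 j) :
    P.totalDiff (P.totalCup f f') =
      P.totalCup (P.totalDiff f) f' + (h + 1).negOnePow • P.totalCup f (P.totalDiff f') := by
  obtain rfl | ⟨p, φ, hp, rfl⟩ := eq_lof_of_mem_shiftedGrading hf
  · simp
  obtain rfl | ⟨r, ψ, hr, rfl⟩ := eq_lof_of_mem_shiftedGrading hf'
  · simp
  refine DFinsupp.ext fun n => Subtype.ext ?_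
  rw [negOnePow_smul_eq_sgn (K := K), ← hp]
  simp only [totalCup_lof, totalDiff_lof, lof_barDiff, lof_barCup, DirectSum.add_apply,
    DirectSum.smul_apply, Submodule.coe_add, Submodule.coe_smul, coe_barCup, coe_barDiff]
  exact P.diff_cup _ _

theorem totalCup_assoc (f f' f'' : ⨁ p, P.bar p) :
    P.totalCup (P.totalCup f f') f'' = P.totalCup f (P.totalCup f' f'') := by
  induction f using DirectSum.induction_on with
  | zero => simp
  | add f g hf hg => simp only [map_add, LinearMap.add_apply, hf, hg]
  | of p φ =>
  rw [← lof_eq_of K]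
  induction f' using DirectSum.induction_on with
  | zero => simp
  | add f g hf hg => simp only [map_add, LinearMap.add_apply, hf, hg]
  | of q ψ =>
  rw [← lof_eq_of K]
  induction f'' using DirectSum.induction_on with
  | zero => simp
  | add f g hf hg => simp only [map_add, hf, hg]
  | of r χ =>
    rw [← lof_eq_of K]
    refine DFinsupp.ext fun n => Subtype.ext ?_
    simp only [totalCup_lof, lof_barCup, coe_barCup]
    exact P.cup_assoc _ _ _

theorem totalUnit_totalCup (f : ⨁ p, P.bar p) : P.totalCup P.totalUnit f = f := by
  induction f using DirectSum.induction_on with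
  | zero => simp
  | add f g hf hg => simp only [map_add, hf, hg]
  | of p φ =>
    rw [← lof_eq_of K, totalUnit, totalCup_lof]
    refine DFinsupp.ext fun n => Subtype.ext ?_
    rw [lof_barCup, coe_barCup]
    by_cases h : n = p
    · subst h
      rw [lof_apply, e_cup]
    · rw [P.cup_of_ne (by omega), lof_eq_of, of_eq_of_ne _ _ _ h]
      rfl

theorem totalCup_totalUnit (f : ⨁ p, P.bar p) : P.totalCup f P.totalUnit = f := by
  induction f using DirectSum.induction_on with
  | zero => simp
  | add f g hf hg => simp only [map_add, LinearMap.add_apply, hf, hg]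
  | of p φ =>
    rw [← lof_eq_of K, totalUnit, totalCup_lof]
    exact congrArg (lof K ℕ (fun p => P.bar p) p) (Subtype.ext (P.cup_e _))

end Structure

end CyclicOperadWithMul

namespace CyclicModule

open DirectSum

variable {K : Type u} [Field K] {O : ℕ → Type v} [∀ n, AddCommGroup (O n)] [∀ n, Module K (O n)]
  {P : CyclicOperadWithMul K O} {M : ℕ → Type w} [∀ n, AddCommGroup (M n)] [∀ n, Module K (M n)]
  (Q : CyclicModule P M)

/-! ### The calculus on the normalised spaces -/

/-- The components of `b` on the normalised spaces. -/
def barCochainDiff (q n : ℕ) : Q.bar q →ₗ[K] Q.bar n :=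
  (Q.cochainDiff n).restrict fun _ => Q.cochainDiff_mem_bar

/-- The components of `B` on the normalised spaces. -/
def barConnes (q n : ℕ) : Q.bar q →ₗ[K] Q.bar n :=
  (Q.connes n).restrict fun _ => Q.connes_mem_bar

/-- The components of `ι` on the normalised spaces. -/
def barContraction (p q n : ℕ) : P.bar p →ₗ[K] Q.bar q →ₗ[K] Q.bar n :=
  (Q.contraction n).restrictBilin fun _ hφ _ hm => Q.contraction_mem_bar hφ hm

/-- The components of `L` on the normalised spaces. -/
def barLieDer (p q n : ℕ) : P.bar p →ₗ[K] Q.bar q →ₗ[K] Q.bar n :=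
  (Q.lieDer n).restrictBilin fun _ hφ _ hm => Q.lieDer_mem_bar hφ hm

/-- The components of `S` on the normalised spaces. -/
def barCyclicHomotopy (p q n : ℕ) : P.bar p →ₗ[K] Q.bar q →ₗ[K] Q.bar n :=
  (Q.cyclicHomotopy n).restrictBilin fun _ hφ _ hm => Q.cyclicHomotopy_mem_bar hφ hm

/-- The components of `T` on the normalised spaces. -/
def barGdtHomotopy (p r q n : ℕ) : P.bar p →ₗ[K] P.bar r →ₗ[K] Q.bar q →ₗ[K] Q.bar n :=
  LinearMap.mk₂ K
    (fun φ ψ => (Q.gdtHomotopy n φ.1 ψ.1).restrict fun _ => Q.gdtHomotopy_mem_bar φ.2 ψ.2)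
    (fun φ φ' ψ => LinearMap.ext fun m => Subtype.ext (by simp [LinearMap.restrict_apply]))
    (fun c φ ψ => LinearMap.ext fun m => Subtype.ext (by simp [LinearMap.restrict_apply]))
    (fun φ ψ ψ' => LinearMap.ext fun m => Subtype.ext (by simp [LinearMap.restrict_apply]))
    (fun c φ ψ => LinearMap.ext fun m => Subtype.ext (by simp [LinearMap.restrict_apply]))

/-- The operator `b` on the sum of the normalised spaces. -/
def totalCochainDiff : Module.End K (⨁ q, Q.bar q) :=
  gradedLift (fun q => q + 1) Q.barCochainDiff

/-- The operator `B` on the sum of the normalised spaces. -/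
def totalConnes : Module.End K (⨁ q, Q.bar q) :=
  gradedLift (fun q => q - 1) Q.barConnes

/-- The operator `ι` on the sum of the normalised spaces. -/
def totalContraction : (⨁ p, P.bar p) →ₗ[K] Module.End K (⨁ q, Q.bar q) :=
  gradedLift₂ (fun p q => p + q) Q.barContraction

/-- The operator `L` on the sum of the normalised spaces. -/
def totalLieDer : (⨁ p, P.bar p) →ₗ[K] Module.End K (⨁ q, Q.bar q) :=
  gradedLift₂ (fun p q => p + q - 1) Q.barLieDer

/-- The operator `S` on the sum of the normalised spaces. -/
def totalCyclicHomotopy : (⨁ p, P.bar p) →ₗ[K] Module.End K (⨁ q, Q.bar q) :=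
  gradedLift₂ (fun p q => p + q - 2) Q.barCyclicHomotopy

/-- The operator `T` on the sum of the normalised spaces. -/
def totalGdtHomotopy :
    (⨁ p, P.bar p) →ₗ[K] (⨁ r, P.bar r) →ₗ[K] Module.End K (⨁ q, Q.bar q) :=
  gradedLift₃ (fun p r q => p + r + q - 2) Q.barGdtHomotopy

section Components

variable {p r q : ℕ} (φ : P.bar p) (ψ : P.bar r) (m : Q.bar q) (n : ℕ)

theorem totalCochainDiff_lof : Q.totalCochainDiff (lof K ℕ (fun q => Q.bar q) q m) =
    lof K ℕ (fun q => Q.bar q) (q + 1) (Q.barCochainDiff q (q + 1) m) := gradedLift_lof _ _ _ _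

theorem totalConnes_lof : Q.totalConnes (lof K ℕ (fun q => Q.bar q) q m) =
    lof K ℕ (fun q => Q.bar q) (q - 1) (Q.barConnes q (q - 1) m) := gradedLift_lof _ _ _ _

theorem totalContraction_lof :
    Q.totalContraction (lof K ℕ (fun p => P.bar p) p φ) (lof K ℕ (fun q => Q.bar q) q m) =
      lof K ℕ (fun q => Q.bar q) (p + q) (Q.barContraction p q (p + q) φ m) :=
  gradedLift₂_lof _ _ _ _ _ _

theorem totalLieDer_lof :
    Q.totalLieDer (lof K ℕ (fun p => P.bar p) p φ) (lof K ℕ (fun q => Q.bar q) q m) =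
      lof K ℕ (fun q => Q.bar q) (p + q - 1) (Q.barLieDer p q (p + q - 1) φ m) :=
  gradedLift₂_lof _ _ _ _ _ _

theorem totalCyclicHomotopy_lof :
    Q.totalCyclicHomotopy (lof K ℕ (fun p => P.bar p) p φ) (lof K ℕ (fun q => Q.bar q) q m) =
      lof K ℕ (fun q => Q.bar q) (p + q - 2) (Q.barCyclicHomotopy p q (p + q - 2) φ m) :=
  gradedLift₂_lof _ _ _ _ _ _

theorem totalGdtHomotopy_lof :
    Q.totalGdtHomotopy (lof K ℕ (fun p => P.bar p) p φ) (lof K ℕ (fun p => P.bar p) r ψ)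
        (lof K ℕ (fun q => Q.bar q) q m) =
      lof K ℕ (fun q => Q.bar q) (p + r + q - 2) (Q.barGdtHomotopy p r q (p + r + q - 2) φ ψ m) :=
  gradedLift₃_lof _ _ _ _ _ _ _ _

theorem coe_barCochainDiff : (Q.barCochainDiff q n m : M n) = Q.cochainDiff n (m : M q) := rfl

theorem coe_barConnes : (Q.barConnes q n m : M n) = Q.connes n (m : M q) := rfl

theorem coe_barContraction :
    (Q.barContraction p q n φ m : M n) = Q.contraction n (φ : O p) (m : M q) := rfl

theorem coe_barLieDer : (Q.barLieDer p q n φ m : M n) = Q.lieDer n (φ : O p) (m : M q) := rfl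

theorem coe_barCyclicHomotopy :
    (Q.barCyclicHomotopy p q n φ m : M n) = Q.cyclicHomotopy n (φ : O p) (m : M q) := rfl

theorem coe_barGdtHomotopy :
    (Q.barGdtHomotopy p r q n φ ψ m : M n) = Q.gdtHomotopy n (φ : O p) (ψ : O r) (m : M q) := rfl

theorem lof_barCochainDiff :
    (lof K ℕ (fun q => Q.bar q) (q + 1) (Q.barCochainDiff q (q + 1) m)) n =
      Q.barCochainDiff q n m :=
  lof_section (fun n => Q.barCochainDiff q n m)
    (fun _ hn => Subtype.ext (Q.cochainDiff_of_ne (Ne.symm hn) _)) n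

theorem lof_barConnes :
    (lof K ℕ (fun q => Q.bar q) (q - 1) (Q.barConnes q (q - 1) m)) n = Q.barConnes q n m :=
  lof_section (fun n => Q.barConnes q n m)
    (fun _ hn => Subtype.ext (Q.connes_of_ne (by omega) _)) n

theorem lof_barContraction :
    (lof K ℕ (fun q => Q.bar q) (p + q) (Q.barContraction p q (p + q) φ m)) n =
      Q.barContraction p q n φ m :=
  lof_section (fun n => Q.barContraction p q n φ m)
    (fun _ hn => Subtype.ext (Q.contraction_of_ne (Ne.symm hn) _ _)) n

theorem lof_barLieDer :
    (lof K ℕ (fun q => Q.bar q) (p + q - 1) (Q.barLieDer p q (p + q - 1) φ m)) n =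
      Q.barLieDer p q n φ m :=
  lof_section (fun n => Q.barLieDer p q n φ m)
    (fun _ hn => Subtype.ext (Q.lieDer_of_ne (by omega) _ _)) n

theorem lof_barCyclicHomotopy :
    (lof K ℕ (fun q => Q.bar q) (p + q - 2) (Q.barCyclicHomotopy p q (p + q - 2) φ m)) n =
      Q.barCyclicHomotopy p q n φ m :=
  lof_section (fun n => Q.barCyclicHomotopy p q n φ m)
    (fun _ hn => Subtype.ext (Q.cyclicHomotopy_of_ne (by omega) _ _)) n

theorem lof_barGdtHomotopy :
    (lof K ℕ (fun q => Q.bar q) (p + r + q - 2)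
      (Q.barGdtHomotopy p r q (p + r + q - 2) φ ψ m)) n = Q.barGdtHomotopy p r q n φ ψ m :=
  lof_section (fun n => Q.barGdtHomotopy p r q n φ ψ m)
    (fun _ hn => Subtype.ext (Q.gdtHomotopy_of_ne (by omega) _ _ _)) n

end Components

section Calculus

variable {h j k : ℤ} {f f' : ⨁ p, P.bar p} {x : ⨁ q, Q.bar q}

theorem totalCochainDiff_mem (hx : x ∈ shiftedGrading K (fun q => Q.bar q) 0 k) :
    Q.totalCochainDiff x ∈ shiftedGrading K (fun q => Q.bar q) 0 (k + 1) := by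
  obtain rfl | ⟨q, m, hq, rfl⟩ := eq_lof_of_mem_shiftedGrading hx
  · simp
  intro n hn
  rw [totalCochainDiff_lof, lof_barCochainDiff]
  exact Subtype.ext (Q.cochainDiff_of_ne (by omega) _)

theorem totalConnes_mem (hx : x ∈ shiftedGrading K (fun q => Q.bar q) 0 k) :
    Q.totalConnes x ∈ shiftedGrading K (fun q => Q.bar q) 0 (k - 1) := by
  obtain rfl | ⟨q, m, hq, rfl⟩ := eq_lof_of_mem_shiftedGrading hx
  · simp
  intro n hn
  rw [totalConnes_lof, lof_barConnes]
  exact Subtype.ext (Q.connes_of_ne (by omega) _)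

theorem totalContraction_mem (hf : f ∈ shiftedGrading K (fun p => P.bar p) 1 h)
    (hx : x ∈ shiftedGrading K (fun q => Q.bar q) 0 k) :
    Q.totalContraction f x ∈ shiftedGrading K (fun q => Q.bar q) 0 (h + k + 1) := by
  obtain rfl | ⟨p, φ, hp, rfl⟩ := eq_lof_of_mem_shiftedGrading hf
  · simp
  obtain rfl | ⟨q, m, hq, rfl⟩ := eq_lof_of_mem_shiftedGrading hx
  · simp
  intro n hn
  rw [totalContraction_lof, lof_barContraction]
  exact Subtype.ext (Q.contraction_of_ne (by omega) _ _)

theorem totalLieDer_mem (hf : f ∈ shiftedGrading K (fun p => P.bar p) 1 h)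
    (hx : x ∈ shiftedGrading K (fun q => Q.bar q) 0 k) :
    Q.totalLieDer f x ∈ shiftedGrading K (fun q => Q.bar q) 0 (h + k) := by
  obtain rfl | ⟨p, φ, hp, rfl⟩ := eq_lof_of_mem_shiftedGrading hf
  · simp
  obtain rfl | ⟨q, m, hq, rfl⟩ := eq_lof_of_mem_shiftedGrading hx
  · simp
  intro n hn
  rw [totalLieDer_lof, lof_barLieDer]
  exact Subtype.ext (Q.lieDer_of_ne (by omega) _ _)

theorem totalCyclicHomotopy_mem (hf : f ∈ shiftedGrading K (fun p => P.bar p) 1 h)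
    (hx : x ∈ shiftedGrading K (fun q => Q.bar q) 0 k) :
    Q.totalCyclicHomotopy f x ∈ shiftedGrading K (fun q => Q.bar q) 0 (h + k - 1) := by
  obtain rfl | ⟨p, φ, hp, rfl⟩ := eq_lof_of_mem_shiftedGrading hf
  · simp
  obtain rfl | ⟨q, m, hq, rfl⟩ := eq_lof_of_mem_shiftedGrading hx
  · simp
  intro n hn
  rw [totalCyclicHomotopy_lof, lof_barCyclicHomotopy]
  exact Subtype.ext (Q.cyclicHomotopy_of_ne (by omega) _ _)

theorem totalGdtHomotopy_mem (hf : f ∈ shiftedGrading K (fun p => P.bar p) 1 h)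
    (hf' : f' ∈ shiftedGrading K (fun p => P.bar p) 1 j)
    (hx : x ∈ shiftedGrading K (fun q => Q.bar q) 0 k) :
    Q.totalGdtHomotopy f f' x ∈ shiftedGrading K (fun q => Q.bar q) 0 (h + j + k) := by
  obtain rfl | ⟨p, φ, hp, rfl⟩ := eq_lof_of_mem_shiftedGrading hf
  · simp
  obtain rfl | ⟨r, ψ, hr, rfl⟩ := eq_lof_of_mem_shiftedGrading hf'
  · simp
  obtain rfl | ⟨q, m, hq, rfl⟩ := eq_lof_of_mem_shiftedGrading hx
  · simp
  intro n hn
  rw [totalGdtHomotopy_lof, lof_barGdtHomotopy]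
  exact Subtype.ext (Q.gdtHomotopy_of_ne (by omega) _ _ _)

theorem gradedComm_eq {V : Type v} [AddCommGroup V] [Module K V] (a c : ℤ) (X Y : Module.End K V) :
    gradedComm a c X Y = X * Y - sgn K (a * c) • (Y * X) := by
  rw [gradedComm, negOnePow_smul_eq_sgn (K := K)]

theorem gradedComm_neg_one_one {V : Type v} [AddCommGroup V] [Module K V]
    (X Y : Module.End K V) : gradedComm (-1) 1 X Y = X * Y + Y * X := by
  rw [gradedComm_eq, sgn_odd (by decide), neg_one_smul, sub_neg_eq_add]

theorem gradedComm_zero {V : Type v} [AddCommGroup V] [Module K V] (a c : ℤ) (X : Module.End K V) :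
    gradedComm a c X 0 = 0 := by
  simp [gradedComm]

theorem zero_gradedComm {V : Type v} [AddCommGroup V] [Module K V] (a c : ℤ) (X : Module.End K V) :
    gradedComm a c 0 X = 0 := by
  simp [gradedComm]

theorem totalCochainDiff_mul_self [CharZero K] : Q.totalCochainDiff * Q.totalCochainDiff = 0 := by
  refine end_ext_lof fun q m n => Subtype.ext ?_
  simp only [Module.End.mul_apply, totalCochainDiff_lof, lof_barCochainDiff, coe_barCochainDiff]
  exact Q.cochainDiff_cochainDiff _

theorem totalConnes_mul_self : Q.totalConnes * Q.totalConnes = 0 := by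
  refine end_ext_lof fun q m n => Subtype.ext ?_
  simp only [Module.End.mul_apply, totalConnes_lof, lof_barConnes, coe_barConnes]
  exact Q.connes_connes m.2

theorem gradedComm_totalConnes_totalCochainDiff :
    gradedComm (-1) 1 Q.totalConnes Q.totalCochainDiff = 0 := by
  refine end_ext_lof fun q m n => Subtype.ext ?_
  rw [gradedComm_neg_one_one]
  simp only [LinearMap.add_apply, Module.End.mul_apply,
    totalConnes_lof, totalCochainDiff_lof, DirectSum.add_apply, lof_barConnes, lof_barCochainDiff,
    Submodule.coe_add, coe_barConnes, coe_barCochainDiff]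
  exact Q.connes_cochainDiff _

theorem totalLieDer_eq (hf : f ∈ shiftedGrading K (fun p => P.bar p) 1 h) :
    Q.totalLieDer f = gradedComm (-1) (h + 1) Q.totalConnes (Q.totalContraction f)
      + gradedComm 1 (h - 1) Q.totalCochainDiff (Q.totalCyclicHomotopy f)
      + Q.totalCyclicHomotopy (P.totalDiff f) := by
  obtain rfl | ⟨p, φ, hp, rfl⟩ := eq_lof_of_mem_shiftedGrading hf
  · simp [gradedComm_zero]
  obtain rfl : h = p - 1 := by omega
  refine end_ext_lof fun q m n => Subtype.ext ?_
  -- An element of arity `p` has degree `p - 1`, so its contraction has degree `p` and its `S`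
  -- degree `p - 2`; both commutator signs are `(-1)^p`.
  have e1 : sgn K (-1 * ((p : ℤ) - 1 + 1)) = sgn K (p : ℤ) := sgn_congr ⟨-p, by ring⟩
  have e2 : sgn K (1 * ((p : ℤ) - 1 - 1)) = sgn K (p : ℤ) := sgn_congr ⟨-1, by ring⟩
  rw [gradedComm_eq, gradedComm_eq, e1, e2]
  simp only [LinearMap.add_apply, LinearMap.sub_apply, LinearMap.smul_apply, Module.End.mul_apply,
    totalConnes_lof, totalCochainDiff_lof, totalContraction_lof, totalCyclicHomotopy_lof,
    totalLieDer_lof, P.totalDiff_lof,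
    DirectSum.add_apply, DirectSum.sub_apply, DirectSum.smul_apply, lof_barConnes,
    lof_barCochainDiff, lof_barContraction, lof_barCyclicHomotopy, lof_barLieDer,
    Submodule.coe_add, Submodule.coe_sub, Submodule.coe_smul, coe_barConnes, coe_barCochainDiff,
    coe_barContraction, coe_barCyclicHomotopy, coe_barLieDer, P.coe_barDiff]
  exact Q.cartan_homotopy _ _

theorem gradedComm_totalCochainDiff_totalContraction
    (hf : f ∈ shiftedGrading K (fun p => P.bar p) 1 h) :
    gradedComm 1 (h + 1) Q.totalCochainDiff (Q.totalContraction f)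
      + Q.totalContraction (P.totalDiff f) = 0 := by
  obtain rfl | ⟨p, φ, hp, rfl⟩ := eq_lof_of_mem_shiftedGrading hf
  · simp [gradedComm_zero]
  refine end_ext_lof fun q m n => Subtype.ext ?_
  rw [gradedComm_eq, one_mul, ← hp]
  simp only [LinearMap.add_apply, LinearMap.sub_apply, LinearMap.smul_apply, Module.End.mul_apply,
    totalCochainDiff_lof, totalContraction_lof, P.totalDiff_lof,
    DirectSum.add_apply, DirectSum.sub_apply, DirectSum.smul_apply,
    lof_barCochainDiff, lof_barContraction,
    Submodule.coe_add, Submodule.coe_sub, Submodule.coe_smul, coe_barCochainDiff,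
    coe_barContraction, P.coe_barDiff]
  exact Q.cochainDiff_contraction _ _

theorem gradedComm_totalConnes_totalCyclicHomotopy
    (hf : f ∈ shiftedGrading K (fun p => P.bar p) 1 h) :
    gradedComm (-1) (h - 1) Q.totalConnes (Q.totalCyclicHomotopy f) = 0 := by
  obtain rfl | ⟨p, φ, hp, rfl⟩ := eq_lof_of_mem_shiftedGrading hf
  · simp [gradedComm_zero]
  refine end_ext_lof fun q m n => Subtype.ext ?_
  rw [gradedComm_eq]
  simp only [LinearMap.sub_apply, LinearMap.smul_apply, Module.End.mul_apply,
    totalConnes_lof, totalCyclicHomotopy_lof, DirectSum.sub_apply, DirectSum.smul_apply,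
    lof_barConnes, lof_barCyclicHomotopy, Submodule.coe_sub, Submodule.coe_smul, coe_barConnes,
    coe_barCyclicHomotopy]
  rw [Q.connes_cyclicHomotopy φ.2 m.2, Q.cyclicHomotopy_connes _ m.2, smul_zero, sub_zero]
  rfl

theorem gradedComm_totalContraction_totalLieDer
    (hf : f ∈ shiftedGrading K (fun p => P.bar p) 1 h)
    (hf' : f' ∈ shiftedGrading K (fun p => P.bar p) 1 j) :
    gradedComm (h + 1) j (Q.totalContraction f) (Q.totalLieDer f')
        - Q.totalContraction (P.totalBracket f f') =
      gradedComm 1 (h + j) Q.totalCochainDiff (Q.totalGdtHomotopy f f')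
        - Q.totalGdtHomotopy (P.totalDiff f) f'
        - h.negOnePow • Q.totalGdtHomotopy f (P.totalDiff f') := by
  obtain rfl | ⟨p, φ, hp, rfl⟩ := eq_lof_of_mem_shiftedGrading hf
  · simp only [map_zero, LinearMap.zero_apply, zero_gradedComm, gradedComm_zero, smul_zero]
    exact LinearMap.ext fun x => by simp only [LinearMap.sub_apply, LinearMap.zero_apply, sub_zero]
  obtain rfl | ⟨r, ψ, hr, rfl⟩ := eq_lof_of_mem_shiftedGrading hf'
  · simp only [map_zero, gradedComm_zero, smul_zero]
    exact LinearMap.ext fun x => by simp only [LinearMap.sub_apply, LinearMap.zero_apply, sub_zero]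
  obtain rfl : h = p - 1 := by omega
  obtain rfl : j = r - 1 := by omega
  refine end_ext_lof fun q m n => Subtype.ext ?_
  have e1 : sgn K (((p : ℤ) - 1 + 1) * ((r : ℤ) - 1)) = -(koszul K p r * sgn K r) := by
    rw [sub_add_cancel, sgn_mul_pred]
  have e2 : sgn K (1 * ((p : ℤ) - 1 + (r - 1))) = sgn K (p : ℤ) * sgn K (r : ℤ) := by
    rw [← sgn_add]; exact sgn_congr ⟨-1, by ring⟩
  rw [gradedComm_eq, gradedComm_eq, e1, e2]
  simp only [LinearMap.sub_apply, negOnePow_smul_eq_sgn (K := K), sgn_sub_one, LinearMap.smul_apply, Module.End.mul_apply,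
    totalCochainDiff_lof, totalContraction_lof, totalGdtHomotopy_lof,
    totalLieDer_lof, P.totalDiff_lof, P.totalBracket_lof,
    DirectSum.sub_apply, DirectSum.smul_apply,
    lof_barCochainDiff, lof_barContraction, lof_barGdtHomotopy, lof_barLieDer,
    Submodule.coe_sub, Submodule.coe_smul, coe_barCochainDiff,
    coe_barContraction, coe_barGdtHomotopy, coe_barLieDer, P.coe_barDiff, P.coe_barBracket]
  exact Q.contraction_lieDer _ _ _

theorem gradedComm_totalCyclicHomotopy_totalLieDer
    (hf : f ∈ shiftedGrading K (fun p => P.bar p) 1 h)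
    (hf' : f' ∈ shiftedGrading K (fun p => P.bar p) 1 j) :
    gradedComm (h - 1) j (Q.totalCyclicHomotopy f) (Q.totalLieDer f')
        - Q.totalCyclicHomotopy (P.totalBracket f f') =
      gradedComm (-1) (h + j) Q.totalConnes (Q.totalGdtHomotopy f f') := by
  obtain rfl | ⟨p, φ, hp, rfl⟩ := eq_lof_of_mem_shiftedGrading hf
  · simp only [map_zero, LinearMap.zero_apply, zero_gradedComm, gradedComm_zero]
    exact LinearMap.ext fun x => by simp only [LinearMap.sub_apply, LinearMap.zero_apply, sub_zero]
  obtain rfl | ⟨r, ψ, hr, rfl⟩ := eq_lof_of_mem_shiftedGrading hf'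
  · simp only [map_zero, gradedComm_zero]
    exact LinearMap.ext fun x => by simp only [LinearMap.sub_apply, LinearMap.zero_apply, sub_zero]
  obtain rfl : h = p - 1 := by omega
  obtain rfl : j = r - 1 := by omega
  refine end_ext_lof fun q m n => Subtype.ext ?_
  have e1 : sgn K (((p : ℤ) - 1 - 1) * ((r : ℤ) - 1)) = koszul K p r * -sgn K r := by
    rw [mul_neg, ← sgn_mul_pred]; exact sgn_congr ⟨-(r - 1), by ring⟩
  have e2 : sgn K (-1 * ((p : ℤ) - 1 + (r - 1))) = sgn K (p : ℤ) * sgn K (r : ℤ) := by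
    rw [← sgn_add]; exact sgn_congr ⟨-p - r + 1, by ring⟩
  rw [gradedComm_eq, gradedComm_eq, e1, e2]
  simp only [LinearMap.sub_apply, LinearMap.smul_apply, Module.End.mul_apply,
    totalConnes_lof, totalCyclicHomotopy_lof, totalGdtHomotopy_lof,
    totalLieDer_lof, P.totalBracket_lof, DirectSum.sub_apply, DirectSum.smul_apply,
    lof_barConnes, lof_barCyclicHomotopy, lof_barGdtHomotopy, lof_barLieDer,
    Submodule.coe_sub, Submodule.coe_smul, coe_barConnes,
    coe_barCyclicHomotopy, coe_barGdtHomotopy, coe_barLieDer, P.coe_barBracket]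
  exact Q.cyclicHomotopy_lieDer φ.2 ψ.2 _

theorem totalContraction_totalCup (f f' : ⨁ p, P.bar p) :
    Q.totalContraction (P.totalCup f f') = Q.totalContraction f * Q.totalContraction f' := by
  induction f using DirectSum.induction_on with
  | zero => simp
  | add f g hf hg => simp only [map_add, LinearMap.add_apply, hf, hg, add_mul]
  | of p φ =>
  rw [← lof_eq_of K]
  induction f' using DirectSum.induction_on with
  | zero => simp
  | add f g hf hg => simp only [map_add, hf, hg, mul_add]
  | of r ψ =>
    rw [← lof_eq_of K]
    refine end_ext_lof fun q m n => Subtype.ext ?_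
    simp only [P.totalCup_lof, Module.End.mul_apply, totalContraction_lof, lof_barContraction,
      coe_barContraction, P.coe_barCup]
    exact Q.contraction_cup _ _ _

theorem totalContraction_totalUnit : Q.totalContraction P.totalUnit = 1 := by
  refine end_ext_lof fun q m n => Subtype.ext ?_
  rw [CyclicOperadWithMul.totalUnit, totalContraction_lof, lof_barContraction, coe_barContraction,
    Module.End.one_apply]
  by_cases h : n = q
  · subst h
    rw [lof_apply, contraction_e]
  · rw [Q.contraction_of_ne (by omega), lof_eq_of, of_eq_of_ne _ _ _ h]
    rfl

/-- The homotopy Cartan–Gerstenhaber calculus of a cyclic module over a cyclic operad with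
multiplication. -/
def calculus [CharZero K] : HomotopyCartanGerstenhaberCalculus
    (shiftedGrading K (fun p => P.bar p) 1) (shiftedGrading K (fun q => Q.bar q) 0) where
  g_isInternal := shiftedGrading_isInternal 1
  d := P.totalDiff
  bracket := P.totalBracket
  d_mem := P.totalDiff_mem
  bracket_mem := P.totalBracket_mem
  d_d := P.totalDiff_totalDiff
  bracket_antisymm := P.totalBracket_antisymm
  jacobi := P.totalBracket_jacobi
  d_bracket := P.totalDiff_totalBracket
  M_isInternal := shiftedGrading_isInternal 0
  b := Q.totalCochainDiff
  B := Q.totalConnes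
  b_mem := Q.totalCochainDiff_mem
  B_mem := Q.totalConnes_mem
  b_b := Q.totalCochainDiff_mul_self
  B_B := Q.totalConnes_mul_self
  B_b := Q.gradedComm_totalConnes_totalCochainDiff
  ι := Q.totalContraction
  L := Q.totalLieDer
  S := Q.totalCyclicHomotopy
  ι_mem := Q.totalContraction_mem
  L_mem := Q.totalLieDer_mem
  S_mem := Q.totalCyclicHomotopy_mem
  cartan := Q.totalLieDer_eq
  b_ι := Q.gradedComm_totalCochainDiff_totalContraction
  B_S := Q.gradedComm_totalConnes_totalCyclicHomotopy
  T := Q.totalGdtHomotopy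
  T_mem := Q.totalGdtHomotopy_mem
  ι_L := Q.gradedComm_totalContraction_totalLieDer
  S_L := Q.gradedComm_totalCyclicHomotopy_totalLieDer
  cup := P.totalCup
  unit := P.totalUnit
  cup_mem := P.totalCup_mem
  unit_mem := lof_mem_shiftedGrading (by simp) _
  cup_assoc := P.totalCup_assoc
  unit_cup := P.totalUnit_totalCup
  cup_unit := P.totalCup_totalUnit
  d_cup := P.totalDiff_totalCup
  ι_cup := Q.totalContraction_totalCup
  ι_unit := Q.totalContraction_totalUnit

end Calculus

end CyclicModule

theorem theoremF {K : Type u} [Field K] [CharZero K]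
    {O : ℕ → Type v} [∀ n, AddCommGroup (O n)] [∀ n, Module K (O n)]
    {M : ℕ → Type w} [∀ n, AddCommGroup (M n)] [∀ n, Module K (M n)]
    (P : CyclicOperadWithMul K O) (Q : CyclicModule P M) :
    ∃ C : HomotopyCartanGerstenhaberCalculus
        (shiftedGrading K (fun p => P.bar p) 1) (shiftedGrading K (fun q => Q.bar q) 0),
      -- the dg Lie algebra and the dg algebra structure on the normalised operad
      (∀ (p : ℕ) (φ : P.bar p),
        (C.d (DirectSum.lof K ℕ _ p φ) (p + 1) : O (p + 1)) =
          (p : ℤ).negOnePow • P.delta (φ : O p)) ∧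
      (∀ (p r n : ℕ) (h : p + r = n + 1) (φ : P.bar p) (ψ : P.bar r),
        (C.bracket (DirectSum.lof K ℕ _ p φ) (DirectSum.lof K ℕ _ r ψ) n : O n) =
          P.gerstenhaber ((Nat.add_comm r p).trans h) (ψ : O r) (φ : O p)) ∧
      (∀ (p r n : ℕ) (h : p + r = n) (φ : P.bar p) (ψ : P.bar r),
        (C.cup (DirectSum.lof K ℕ _ p φ) (DirectSum.lof K ℕ _ r ψ) n : O n) =
          P.cupProd h (φ : O p) (ψ : O r)) ∧
      ((C.unit 0 : O 0) = P.e) ∧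
      -- the mixed complex
      (∀ (q : ℕ) (m : Q.bar q),
        (C.b (DirectSum.lof K ℕ _ q m) (q + 1) : M (q + 1)) = Q.opb (m : M q)) ∧
      (∀ (n : ℕ) (m : Q.bar (n + 1)),
        (C.B (DirectSum.lof K ℕ _ (n + 1) m) n : M n) = Q.opB (m : M (n + 1))) ∧
      -- the calculus operators
      (∀ (p q n : ℕ) (h : p + q = n) (φ : P.bar p) (m : Q.bar q),
        (C.ι (DirectSum.lof K ℕ _ p φ) (DirectSum.lof K ℕ _ q m) n : M n) =
          Q.opι h (φ : O p) (m : M q)) ∧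
      (∀ (p q n : ℕ) (h : p + q = n + 1) (φ : P.bar p) (m : Q.bar q),
        (C.L (DirectSum.lof K ℕ _ p φ) (DirectSum.lof K ℕ _ q m) n : M n) =
          ((p : ℤ) - 1).negOnePow • Q.opL h (φ : O p) (m : M q)) ∧
      (∀ (p q n : ℕ) (h : p + q = n + 2) (φ : P.bar p) (m : Q.bar q),
        (C.S (DirectSum.lof K ℕ _ p φ) (DirectSum.lof K ℕ _ q m) n : M n) =
          Q.opS h (φ : O p) (m : M q)) ∧
      (∀ (p r q n : ℕ) (h : r + p + q = n + 2) (φ : P.bar p) (ψ : P.bar r) (m : Q.bar q),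
        (C.T (DirectSum.lof K ℕ _ p φ) (DirectSum.lof K ℕ _ r ψ) (DirectSum.lof K ℕ _ q m) n :
            M n) =
          ((p : ℤ) * ((r : ℤ) - 1)).negOnePow • Q.opT h (ψ : O r) (φ : O p) (m : M q)) := by
  refine ⟨Q.calculus, fun p φ => ?_, fun p r n h φ ψ => ?_, fun p r n h φ ψ => ?_, ?_,
    fun q m => ?_, fun n m => ?_, fun p q n h φ m => ?_, fun p q n h φ m => ?_,
    fun p q n h φ m => ?_, fun p r q n h φ ψ m => ?_⟩
  -- Each explicit formula is read backwards: unsuspended sum, suspended operator, its restriction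
  -- to normalised elements, and the component of the total operator.
  · rw [← P.diff_eq_delta, ← P.coe_barDiff, ← P.lof_barDiff, ← P.totalDiff_lof]
    rfl
  · rw [← P.gbracket_eq, ← P.coe_barBracket, ← P.lof_barBracket, ← P.totalBracket_lof]
    rfl
  · rw [← P.cup_eq h, ← P.coe_barCup, ← P.lof_barCup, ← P.totalCup_lof]
    rfl
  · exact congrArg Subtype.val (DirectSum.lof_apply K (M := fun p => P.bar p) 0 _)
  · rw [← Q.cochainDiff_eq, ← Q.coe_barCochainDiff, ← Q.lof_barCochainDiff,
      ← Q.totalCochainDiff_lof]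
    rfl
  · rw [← Q.connes_eq, ← Q.coe_barConnes, ← Q.lof_barConnes, ← Q.totalConnes_lof]
    rfl
  · rw [← Q.contraction_eq h, ← Q.coe_barContraction, ← Q.lof_barContraction,
      ← Q.totalContraction_lof]
    rfl
  · rw [← Q.lieDer_eq h, ← Q.coe_barLieDer, ← Q.lof_barLieDer, ← Q.totalLieDer_lof]
    rfl
  · rw [← Q.cyclicHomotopy_eq h, ← Q.coe_barCyclicHomotopy, ← Q.lof_barCyclicHomotopy,
      ← Q.totalCyclicHomotopy_lof]
    rfl
  · rw [← Q.gdtHomotopy_eq h, ← Q.coe_barGdtHomotopy, ← Q.lof_barGdtHomotopy,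
      ← Q.totalGdtHomotopy_lof]
    rfl
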